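/- Let $C$ be a site (no products or fiber products are assumed to exist in $C$) and let $X_\bullet$ be a simplicial presheaf of sets on $C$. For a simplicial presheaf $K_\bullet$, let $\mathbb{Z}K^\bullet$ be the associated cochain complex, in degrees $\le 0$, of sheaves of free abelian groups (the sheaf associated to the free abelian group on $K_n$ sits in degree $-n$, with alternating sums of face maps as differentials). A morphism $f : L_\bullet \to K_\bullet$ of simplicial presheaves is a local acyclic fibration if, for every object $U$ of $C$, every $k \ge 0$ and every commutative square with $\partial\Delta^k \to L_\bullet(U)$ and $\Delta^k \to K_\bullet(U)$, there is a covering sieve $R$ of $U$ such that for every $V \to U$ in $R$ there is a diagonal lift $\Delta^k \to L_\bullet(V)$ of the square restricted to $V$. Let $D(X_\bullet)$ be the full subcategory of the category of simplicial presheaves over $X_\bullet$ that consists of the local acyclic fibrations $K_\bullet \to X_\bullet$, and let $hD(X_\bullet)$ be the category with the same objects, and with morphisms up to the equivalence relation generated by simplicial homotopy over $X_\bullet$. Let $\mathscr{F}^\bullet$ be a bounded below complex of sheaves of abelian groups on $C$. Then $hD(X_\bullet)$ is cofiltered, and: 1. For every $p \in \mathbb{Z}$ there is a canonical isomorphism $$\varinjlim_{K_\bullet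 \in hD(X_\bullet)} H^p(\mathrm{Tot}\,\mathrm{Hom}(\mathbb{Z}K^\bullet, \mathscr{F}^\bullet)) \simeq \mathrm{Ext}^p(\mathbb{Z}X^\bullet, \mathscr{F}^\bullet),$$ where $\mathrm{Ext}^p(\mathbb{Z}X^\bullet, \mathscr{F}^\bullet)$ is the hyper-Ext group, i.e. the group of morphisms $\mathbb{Z}X^\bullet \to \mathscr{F}^\bullet[p]$ in the derived category. On the term of index $K_\bullet$, its composition with the map to $\mathrm{Ext}^p(\mathbb{Z}K^\bullet, \mathscr{F}^\bullet)$ induced by $\mathbb{Z}K^\bullet \to \mathbb{Z}X^\bullet$ sends the class of a morphism of complexes $\mathbb{Z}K^\bullet \to \mathscr{F}^\bullet[p]$ to its image in the derived category. 2. Give $\mathscr{F}^\bullet$ the filtration bête, whose $n$-th step is the subcomplex $\sigma_{\ge n}\mathscr{F}^\bullet$ equal to $\mathscr{F}^\bullet$ in degrees $\ge n$ and to zero in degrees $< n$, and filter $\mathrm{Tot}\,\mathrm{Hom}(\mathbb{Z}K^\bullet, \mathscr{F}^\bullet)$ by the subcomplexes $\mathrm{Tot}\,\mathrm{Hom}(\mathbb{Z}K^\bullet,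 \sigma_{\ge n}\mathscr{F}^\bullet)$. The filtered complex $\mathscr{F}^\bullet$ has a filtered injective resolution $\mathscr{F}^\bullet \to I^\bullet$ (a filtered quasi-isomorphism to a bounded below filtered complex with a filtration that is finite in each degree and with graded pieces consisting of injective sheaves). For each such resolution let $R\mathrm{Hom}(\mathbb{Z}X^\bullet, \mathscr{F}^\bullet)$ be $\mathrm{Tot}\,\mathrm{Hom}(\mathbb{Z}X^\bullet, I^\bullet)$ with the filtration induced by that of $I^\bullet$. Then for each $K_\bullet \in hD(X_\bullet)$ the morphism $\mathrm{Tot}\,\mathrm{Hom}(\mathbb{Z}X^\bullet, I^\bullet) \to \mathrm{Tot}\,\mathrm{Hom}(\mathbb{Z}K^\bullet, I^\bullet)$ is a filtered quasi-isomorphism, and the resulting morphisms $\mathrm{Tot}\,\mathrm{Hom}(\mathbb{Z}K^\bullet, \mathscr{F}^\bullet) \to \mathrm{Tot}\,\mathrm{Hom}(\mathbb{Z}K^\bullet, I^\bullet) \simeq R\mathrm{Hom}(\mathbb{Z}X^\bullet, \mathscr{F}^\bullet)$ in the filtered derived category form a filtered quasi-isomorphism of ind-objects $$\underset{K_\bullet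 \in hD(X_\bullet)}{``\varinjlim"} \mathrm{Tot}\,\mathrm{Hom}(\mathbb{Z}K^\bullet, \mathscr{F}^\bullet) \simeq R\mathrm{Hom}(\mathbb{Z}X^\bullet, \mathscr{F}^\bullet).$$ This means that it induces isomorphisms, from the colimit over $hD(X_\bullet)$ of the cohomology groups of $\mathrm{Tot}\,\mathrm{Hom}(\mathbb{Z}K^\bullet, \mathscr{F}^\bullet)$ to the cohomology groups of $R\mathrm{Hom}(\mathbb{Z}X^\bullet, \mathscr{F}^\bullet)$, and likewise for each step and for each graded piece of the filtrations. -/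

import Mathlib

open CategoryTheory CategoryTheory.Limits Opposite
open scoped Simplicial MonoidalCategory

universe w' w v u

noncomputable section

namespace CechExt

/-! ### The complex of homomorphisms, as a functor of both arguments -/

section TotHom

variable {A : Type u} [Category.{v} A] [Preadditive A]

open CochainComplex CochainComplex.HomComplex

/-- Composition of cochains of degree `n` with `f : K' ⟶ K` and `g : L ⟶ L'`. -/
def cochainMap {K K' L L' : CochainComplex A ℤ} (f : K' ⟶ K) (g : L ⟶ L') (n : ℤ) :
    Cochain K L n →+ Cochain K' L' n where
  toFun z := (Cochain.ofHom f).comp (z.comp (Cochain.ofHom g) (add_zero n)) (zero_add n)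
  map_zero' := by simp
  map_add' := by intros; simp

/-- The map `Tot Hom(K, L) ⟶ Tot Hom(K', L')` given by composition with `f : K' ⟶ K` and
`g : L ⟶ L'`. Here `Tot Hom(K, L)` is Mathlib's `CochainComplex.HomComplex K L`, which in
degree `n` is the product of the groups `Hom(K^p, L^q)` with `q - p = n`. -/
def totHomMap {K K' L L' : CochainComplex A ℤ} (f : K' ⟶ K) (g : L ⟶ L') :
    HomComplex K L ⟶ HomComplex K' L' where
  f n := AddCommGrpCat.ofHom (cochainMap f g n)
  comm' i j _ := by
    refine AddCommGrpCat.hom_ext (AddMonoidHom.ext fun (z : Cochain K L i) => ?_)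
    change δ i j (cochainMap f g i z) = cochainMap f g j (δ i j z)
    simp [cochainMap]

lemma totHomMap_id (K L : CochainComplex A ℤ) : totHomMap (𝟙 K) (𝟙 L) = 𝟙 _ := by
  ext n : 1
  refine AddCommGrpCat.hom_ext (AddMonoidHom.ext fun (z : Cochain K L n) => ?_)
  change cochainMap _ _ n z = z
  simp [cochainMap]

lemma totHomMap_comp {K K' K'' L L' L'' : CochainComplex A ℤ} (f : K' ⟶ K) (f' : K'' ⟶ K')
    (g : L ⟶ L') (g' : L' ⟶ L'') :
    totHomMap f g ≫ totHomMap f' g' = totHomMap (f' ≫ f) (g ≫ g') := by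
  ext n : 1
  refine AddCommGrpCat.hom_ext (AddMonoidHom.ext fun (z : Cochain K L n) => ?_)
  change cochainMap _ _ n (cochainMap _ _ n z) = cochainMap _ _ n z
  simp [cochainMap]

/-- The functor `(K, L) ↦ Tot Hom(K, L)`, contravariant in `K` and covariant in `L`. -/
def totHom : (CochainComplex A ℤ)ᵒᵖ ⥤ CochainComplex A ℤ ⥤ CochainComplex AddCommGrpCat.{v} ℤ where
  obj K :=
    { obj := fun L => HomComplex K.unop L
      map := fun g => totHomMap (𝟙 K.unop) g
      map_id := fun L => totHomMap_id _ _
      map_comp := fun g g' => by rw [totHomMap_comp, Category.comp_id] }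
  map f :=
    { app := fun L => totHomMap f.unop (𝟙 L)
      naturality := fun L L' g => by
        change totHomMap _ _ ≫ totHomMap _ _ = totHomMap _ _ ≫ totHomMap _ _
        simp [totHomMap_comp] }
  map_id K := by
    ext L : 2
    exact totHomMap_id _ _
  map_comp f f' := by
    ext L : 2
    change totHomMap _ _ = totHomMap _ _ ≫ totHomMap _ _
    rw [totHomMap_comp, Category.comp_id, unop_comp]

/-- The components of the homotopy `totHomHomotopy` below. -/
def totHomHomotopyAux {K K' : CochainComplex A ℤ} {f g : K' ⟶ K} (h : Homotopy f g)
    (L : CochainComplex A ℤ) (i j : ℤ) (hij : -1 + i = j) :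
    (HomComplex K L).X i ⟶ (HomComplex K' L).X j :=
  AddCommGrpCat.ofHom
    { toFun := fun z : Cochain K L i => i.negOnePow • (Cochain.ofHomotopy h).comp z hij
      map_zero' := by simp
      map_add' := by intros; simp }

/-- A chain homotopy between `f` and `g` induces one between the maps they induce on
`Tot Hom(-, L)`. -/
def totHomHomotopy {K K' : CochainComplex A ℤ} {f g : K' ⟶ K} (h : Homotopy f g)
    (L : CochainComplex A ℤ) : Homotopy (totHomMap f (𝟙 L)) (totHomMap g (𝟙 L)) where
  hom i j := if hij : -1 + i = j then totHomHomotopyAux h L i j hij else 0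
  zero i j hij := by
    rw [dif_neg]
    intro h
    apply hij
    simp only [ComplexShape.up_Rel]
    lia
  comm i := by
    rw [dNext_eq _ (show (ComplexShape.up ℤ).Rel i (i + 1) by simp),
      prevD_eq _ (show (ComplexShape.up ℤ).Rel (i - 1) i by simp),
      dif_pos (by lia), dif_pos (by lia)]
    refine AddCommGrpCat.hom_ext (AddMonoidHom.ext fun (z : Cochain K L i) => ?_)
    change cochainMap f (𝟙 L) i z =
      (i + 1).negOnePow • (Cochain.ofHomotopy h).comp (δ i (i + 1) z) (by lia) +
      δ (i - 1) i (i.negOnePow • (Cochain.ofHomotopy h).comp z (by lia)) + cochainMap g (𝟙 L) i z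
    rw [δ_units_smul, δ_comp (Cochain.ofHomotopy h) z (by lia) 0 (i + 1) i (by lia) (by lia) (by lia),
      δ_ofHomotopy]
    simp [cochainMap, Int.negOnePow_succ, smul_smul, sub_eq_add_neg]

lemma quasiIso_totHomMap_of_homotopyEquiv {K K' : CochainComplex A ℤ} (e : HomotopyEquiv K' K)
    (L : CochainComplex A ℤ) : QuasiIso (totHomMap e.hom (𝟙 L)) := by
  let E : HomotopyEquiv (HomComplex K L) (HomComplex K' L) :=
    { hom := totHomMap e.hom (𝟙 L)
      inv := totHomMap e.inv (𝟙 L)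
      homotopyHomInvId := (Homotopy.ofEq (by simp [totHomMap_comp])).trans
        ((totHomHomotopy e.homotopyInvHomId L).trans (Homotopy.ofEq (totHomMap_id _ _)))
      homotopyInvHomId := (Homotopy.ofEq (by simp [totHomMap_comp])).trans
        ((totHomHomotopy e.homotopyHomInvId L).trans (Homotopy.ofEq (totHomMap_id _ _))) }
  exact E.quasiIso_hom

end TotHom

/-! ### Filtered complexes and the filtered derived category -/

section Filtered

variable (A : Type u) [Category.{v} A] [Abelian A]

/-- A complex `X` with a decreasing filtration by subcomplexes
`⋯ ⊆ fil (n + 1) ⊆ fil n ⊆ ⋯ ⊆ X`, `n : ℤ`. -/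
structure FilteredComplex where
  X : CochainComplex A ℤ
  fil : ℤᵒᵖ ⥤ CochainComplex A ℤ
  ι : fil ⟶ (Functor.const ℤᵒᵖ).obj X
  mono_ι : ∀ n, Mono (ι.app n)

namespace FilteredComplex

variable {A}

/-- Morphisms of filtered complexes: morphisms of complexes that map the `n`-th step of the
filtration to the `n`-th step. -/
@[ext]
structure Hom (F G : FilteredComplex A) where
  hom : F.X ⟶ G.X
  fil : F.fil ⟶ G.fil
  comm : ∀ n, fil.app n ≫ G.ι.app n = F.ι.app n ≫ hom

instance : Category (FilteredComplex A) where
  Hom := Hom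
  id F := { hom := 𝟙 _, fil := 𝟙 _, comm := by simp }
  comp f g :=
    { hom := f.hom ≫ g.hom
      fil := f.fil ≫ g.fil
      comm := fun n => by
        have h₁ := f.comm n
        have h₂ := g.comm n
        simp only [Functor.const_obj_obj] at h₁ h₂
        simp [h₂, reassoc_of% h₁] }
  id_comp f := by apply Hom.ext <;> simp
  comp_id f := by apply Hom.ext <;> simp
  assoc f g h := by apply Hom.ext <;> simp

@[simp]
lemma id_fil (F : FilteredComplex A) : Hom.fil (𝟙 F) = 𝟙 F.fil := rfl

@[simp]
lemma comp_fil {F G H : FilteredComplex A} (f : F ⟶ G) (g : G ⟶ H) :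
    Hom.fil (f ≫ g) = Hom.fil f ≫ Hom.fil g := rfl

@[simp]
lemma id_hom (F : FilteredComplex A) : Hom.hom (𝟙 F) = 𝟙 F.X := rfl

@[simp]
lemma comp_hom {F G H : FilteredComplex A} (f : F ⟶ G) (g : G ⟶ H) :
    Hom.hom (f ≫ g) = Hom.hom f ≫ Hom.hom g := rfl

/-- The underlying complex. -/
def forget : FilteredComplex A ⥤ CochainComplex A ℤ where
  obj F := F.X
  map f := Hom.hom f

/-- The `n`-th step of the filtration. -/
def step (n : ℤ) : FilteredComplex A ⥤ CochainComplex A ℤ where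
  obj F := F.fil.obj (op n)
  map f := (Hom.fil f).app (op n)

/-- The inclusion of the `n + 1`-st step of the filtration in the `n`-th one. -/
def stepSucc (F : FilteredComplex A) (n : ℤ) : F.fil.obj (op (n + 1)) ⟶ F.fil.obj (op n) :=
  F.fil.map (homOfLE (by lia)).op

/-- The `n`-th graded piece, the quotient of the `n`-th step by the `n + 1`-st. -/
def gr (n : ℤ) : FilteredComplex A ⥤ CochainComplex A ℤ where
  obj F := cokernel (F.stepSucc n)
  map {F G} f := cokernel.map _ _ ((Hom.fil f).app _) ((Hom.fil f).app _)
    ((Hom.fil f).naturality _)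
  map_id F := by
    apply coequalizer.hom_ext
    simp
  map_comp f g := by
    apply coequalizer.hom_ext
    simp

/-- Filtered quasi-isomorphisms: morphisms of filtered complexes that induce quasi-isomorphisms
on the complexes and on each step of the filtrations; they then induce quasi-isomorphisms
on each graded piece. -/
def filteredQuasiIso : MorphismProperty (FilteredComplex A) := fun _ _ f =>
  QuasiIso (forget.map f) ∧ ∀ n, QuasiIso ((step n).map f)

lemma quasiIso_gr_map {F G : FilteredComplex A} (f : F ⟶ G) (hf : filteredQuasiIso f) (n : ℤ) :
    QuasiIso ((gr n).map f) := by
  have mono (F : FilteredComplex A) : Mono (F.stepSucc n) := by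
    have := F.mono_ι (op (n + 1))
    have h : F.stepSucc n ≫ F.ι.app (op n) = F.ι.app (op (n + 1)) := by
      have := F.ι.naturality (homOfLE (show n ≤ n + 1 by lia)).op
      simp only [Functor.const_obj_map] at this
      exact this.trans (Category.comp_id _)
    rw [← h] at this
    exact mono_of_mono (F.stepSucc n) (F.ι.app (op n))
  let S (F : FilteredComplex A) : ShortComplex (CochainComplex A ℤ) :=
    ShortComplex.mk (F.stepSucc n) (cokernel.π _) (cokernel.condition _)
  have hS (F : FilteredComplex A) : (S F).ShortExact :=
    { exact := ShortComplex.exact_cokernel _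
      mono_f := mono F
      epi_g := inferInstanceAs (Epi (cokernel.π _)) }
  let φ : S F ⟶ S G :=
    { τ₁ := (step (n + 1)).map f
      τ₂ := (step n).map f
      τ₃ := (gr n).map f
      comm₁₂ := ((Hom.fil f).naturality _).symm
      comm₂₃ := by
        dsimp [S, gr, step]
        simp }
  exact HomologicalComplex.HomologySequence.quasiIso_τ₃ φ (hS F) (hS G) (hf.2 _) (hf.2 _)

end FilteredComplex

open FilteredComplex

/-- The filtered derived category: the localization of the category of filtered complexes at the
filtered quasi-isomorphisms. -/
abbrev FilteredDerivedCategory := (filteredQuasiIso (A := A)).Localization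

namespace FilteredDerivedCategory

variable {A}

/-- The localization functor. -/
abbrev Q : FilteredComplex A ⥤ FilteredDerivedCategory A := filteredQuasiIso.Q

/-- A functor from filtered complexes to complexes that preserves quasi-isomorphisms induces,
in each degree `p`, a cohomology functor on the filtered derived category. -/
def cohomologyOf (G : FilteredComplex A ⥤ CochainComplex A ℤ)
    (hG : ∀ ⦃F F' : FilteredComplex A⦄ (f : F ⟶ F'), filteredQuasiIso f → QuasiIso (G.map f))
    (p : ℤ) : FilteredDerivedCategory A ⥤ A :=
  Localization.Construction.lift
    (G ⋙ HomologicalComplex.homologyFunctor A (ComplexShape.up ℤ) p)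
    (fun _ _ f hf => by
      have := hG f hf
      exact inferInstanceAs (IsIso (HomologicalComplex.homologyMap (G.map f) p)))

/-- The cohomology `H^p(X)` of a filtered complex. -/
def cohomology (p : ℤ) : FilteredDerivedCategory A ⥤ A :=
  cohomologyOf FilteredComplex.forget (fun _ _ _ hf => hf.1) p

/-- The cohomology `H^p(Fil^n X)` of a step of the filtration. -/
def stepCohomology (n p : ℤ) : FilteredDerivedCategory A ⥤ A :=
  cohomologyOf (FilteredComplex.step n) (fun _ _ _ hf => hf.2 n) p

/-- The cohomology `H^p(gr^n X)` of a graded piece. -/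
def grCohomology (n p : ℤ) : FilteredDerivedCategory A ⥤ A :=
  cohomologyOf (FilteredComplex.gr n) (fun _ _ f hf => quasiIso_gr_map f hf n) p

/-- Let `D` be an ind-object in the filtered derived category, `R` an object, and `Φ` a morphism
from the ind-object to `R`. The cohomology of an ind-object is the colimit of the cohomologies.
`Φ` is a filtered quasi-isomorphism if it induces isomorphisms on the cohomology of the
underlying complexes, of the steps of the filtration and of the graded pieces, that is, if `Φ`
exhibits the cohomology of `R` as the colimit of the cohomologies. -/
structure IsIndFilteredQuasiIso {I : Type u} [Category.{v} I] {B : Type w} [Category.{w'} B]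
    [Abelian B] {D : I ⥤ FilteredDerivedCategory B} {R : FilteredDerivedCategory B}
    (Φ : D ⟶ (Functor.const I).obj R) : Prop where
  cohomology (p : ℤ) :
    Nonempty (IsColimit ((cohomology p).mapCocone (Cocone.mk R Φ)))
  step (n p : ℤ) :
    Nonempty (IsColimit ((stepCohomology n p).mapCocone (Cocone.mk R Φ)))
  gr (n p : ℤ) :
    Nonempty (IsColimit ((grCohomology n p).mapCocone (Cocone.mk R Φ)))

end FilteredDerivedCategory

variable {A}

lemma mono_totHomMap (K : CochainComplex A ℤ) {L L' : CochainComplex A ℤ} (g : L ⟶ L') [Mono g] :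
    Mono (totHomMap (𝟙 K) g) := by
  have (n : ℤ) : Mono ((totHomMap (𝟙 K) g).f n) := by
    rw [AddCommGrpCat.mono_iff_injective]
    intro (z : CochainComplex.HomComplex.Cochain K L n)
      (z' : CochainComplex.HomComplex.Cochain K L n) h
    change cochainMap (𝟙 K) g n z = cochainMap (𝟙 K) g n z' at h
    refine CochainComplex.HomComplex.Cochain.ext _ _ fun p q hpq => ?_
    have h' := CochainComplex.HomComplex.Cochain.congr_v h p q hpq
    simpa [cochainMap, cancel_mono] using h'
  exact HomologicalComplex.mono_of_mono_f _ this

/-- For a complex `K` and a filtered complex `F`, the complex `Tot Hom(K, F)` with the filtration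
by the subcomplexes `Tot Hom(K, Fil^n F)`. -/
def totHomFilObj (K : CochainComplex A ℤ) (F : FilteredComplex A) :
    FilteredComplex AddCommGrpCat.{v} where
  X := (totHom.obj (op K)).obj F.X
  fil := F.fil ⋙ totHom.obj (op K)
  ι :=
    { app := fun n => (totHom.obj (op K)).map (F.ι.app n)
      naturality := fun m n f => by
        have h := F.ι.naturality f
        simp only [Functor.const_obj_map] at h
        simp [← Functor.map_comp, h] }
  mono_ι n := by
    have := F.mono_ι n
    exact mono_totHomMap K (F.ι.app n)

/-- The functor `(K, F) ↦ Tot Hom(K, F)` with values in filtered complexes, for complexes `K` and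
filtered complexes `F`. -/
def totHomFil : (CochainComplex A ℤ)ᵒᵖ ⥤ FilteredComplex A ⥤ FilteredComplex AddCommGrpCat.{v} where
  obj K :=
    { obj := fun F => totHomFilObj K.unop F
      map := fun f =>
        { hom := (totHom.obj K).map (Hom.hom f)
          fil := Functor.whiskerRight (Hom.fil f) (totHom.obj K)
          comm := fun n => by
            have h := Hom.comm f n
            dsimp [totHomFilObj]
            rw [← Functor.map_comp, ← Functor.map_comp]
            exact congrArg _ h }
      map_id := fun F => by apply Hom.ext <;> simp <;> rfl
      map_comp := fun f g => by apply Hom.ext <;> simp <;> rfl }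
  map {K K'} f :=
    { app := fun F =>
        { hom := (totHom.map f).app F.X
          fil := Functor.whiskerLeft F.fil (totHom.map f)
          comm := fun n => ((totHom.map f).naturality (F.ι.app n)).symm }
      naturality := fun F G g => by
        apply Hom.ext
        · exact (totHom.map f).naturality _
        · ext n : 2
          exact (totHom.map f).naturality _ }
  map_id K := by
    ext F : 2
    apply Hom.ext <;> simp <;> rfl
  map_comp f f' := by
    ext F : 2
    apply Hom.ext <;> simp <;> rfl

/-- Homotopic morphisms `K' ⟶ K` induce the same morphism on `Tot Hom(-, F)` in the filtered
derived category. -/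
lemma isInvertedBy_totHomFil (F : FilteredComplex A) :
    (HomologicalComplex.homotopyEquivalences A (ComplexShape.up ℤ)).IsInvertedBy
      ((totHomFil.flip.obj F ⋙ FilteredDerivedCategory.Q).rightOp) := by
  rintro K K' f ⟨e, rfl⟩
  have h : filteredQuasiIso ((totHomFil.map e.hom.op).app F) :=
    ⟨quasiIso_totHomMap_of_homotopyEquiv e _, fun n => quasiIso_totHomMap_of_homotopyEquiv e _⟩
  have := Localization.inverts FilteredDerivedCategory.Q filteredQuasiIso _ h
  exact inferInstanceAs (IsIso (Quiver.Hom.op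
    (FilteredDerivedCategory.Q.map ((totHomFil.map e.hom.op).app F))))

/-- Homotopic morphisms `K' ⟶ K` induce the same morphism on `H^p(Tot Hom(-, F))`. -/
lemma isInvertedBy_homology_totHom (F : CochainComplex A ℤ) (p : ℤ) :
    (HomologicalComplex.homotopyEquivalences A (ComplexShape.up ℤ)).IsInvertedBy
      ((totHom.flip.obj F ⋙ HomologicalComplex.homologyFunctor _ _ p).rightOp) := by
  rintro K K' f ⟨e, rfl⟩
  have := quasiIso_totHomMap_of_homotopyEquiv e F
  exact inferInstanceAs (IsIso (Quiver.Hom.op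
    (HomologicalComplex.homologyMap (totHomMap e.hom (𝟙 F)) p)))

/-! ### The filtration bête -/

section Bete

open HomologicalComplex ComplexShape

/-- The complex `σ_{≥ n} F`, which is `F` in degrees `≥ n` and zero in degrees `< n`. -/
abbrev sigmaGE (F : CochainComplex A ℤ) (n : ℤ) : CochainComplex A ℤ :=
  F.stupidTrunc (embeddingUpIntGE n)

lemma embeddingUpIntGE_f_toNat {n m : ℤ} (h : n ≤ m) :
    (embeddingUpIntGE n).f (m - n).toNat = m := by
  change n + ((m - n).toNat : ℤ) = m
  lia

/-- The identification of `σ_{≥ n} F` with `F` in degrees `m ≥ n`. -/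
def sigmaGEXIso (F : CochainComplex A ℤ) {n m : ℤ} (h : n ≤ m) : (sigmaGE F n).X m ≅ F.X m :=
  F.stupidTruncXIso (embeddingUpIntGE n) (embeddingUpIntGE_f_toNat h)

lemma isZero_sigmaGE_X (F : CochainComplex A ℤ) {n m : ℤ} (h : ¬ n ≤ m) :
    IsZero ((sigmaGE F n).X m) :=
  F.isZero_stupidTrunc_X _ _ ((notMem_range_embeddingUpIntGE_iff n m).2 (by lia))

lemma sigmaGE_d (F : CochainComplex A ℤ) {n m m' : ℤ} (h : n ≤ m) (h' : n ≤ m') :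
    (sigmaGE F n).d m m' = (sigmaGEXIso F h).hom ≫ F.d m m' ≫ (sigmaGEXIso F h').inv := by
  obtain ⟨i, rfl⟩ : ∃ i, (embeddingUpIntGE n).f i = m := ⟨_, embeddingUpIntGE_f_toNat h⟩
  obtain ⟨i', rfl⟩ : ∃ i, (embeddingUpIntGE n).f i = m' := ⟨_, embeddingUpIntGE_f_toNat h'⟩
  have key (j : ℕ) (h : n ≤ (embeddingUpIntGE n).f j) :
      sigmaGEXIso F h = (F.restriction (embeddingUpIntGE n)).extendXIso _ rfl := by
    have hj : ∀ (j' : ℕ) (hj' : (embeddingUpIntGE n).f j' = (embeddingUpIntGE n).f j), j' = j →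
        F.stupidTruncXIso (embeddingUpIntGE n) hj' =
          (F.restriction (embeddingUpIntGE n)).extendXIso _ rfl := by
      rintro _ _ rfl
      ext
      exact Category.comp_id _
    refine hj _ _ ?_
    change (n + (j : ℤ) - n).toNat = j
    lia
  rw [key, key]
  exact extend_d_eq _ _ rfl rfl

/-- The inclusion of `σ_{≥ n'} F` in `σ_{≥ n} F` for `n ≤ n'`. -/
def sigmaGEMap (F : CochainComplex A ℤ) {n n' : ℤ} (h : n ≤ n') : sigmaGE F n' ⟶ sigmaGE F n where
  f m := if hm : n' ≤ m then (sigmaGEXIso F hm).hom ≫ (sigmaGEXIso F (h.trans hm)).inv else 0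
  comm' m m' hmm' := by
    simp only [ComplexShape.up_Rel] at hmm'
    by_cases hm : n' ≤ m
    · have hm' : n' ≤ m' := by lia
      simp [dif_pos hm, dif_pos hm', sigmaGE_d F hm hm', sigmaGE_d F (h.trans hm) (h.trans hm')]
    · exact (isZero_sigmaGE_X F hm).eq_of_src _ _

/-- The inclusion of `σ_{≥ n} F` in `F`. -/
def sigmaGEι (F : CochainComplex A ℤ) (n : ℤ) : sigmaGE F n ⟶ F where
  f m := if hm : n ≤ m then (sigmaGEXIso F hm).hom else 0
  comm' m m' hmm' := by
    simp only [ComplexShape.up_Rel] at hmm'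
    by_cases hm : n ≤ m
    · have hm' : n ≤ m' := by lia
      simp [dif_pos hm, dif_pos hm', sigmaGE_d F hm hm']
    · exact (isZero_sigmaGE_X F hm).eq_of_src _ _

/-- A complex `F` with the filtration bête: the `n`-th step of the filtration is the
subcomplex `σ_{≥ n} F`, which is `F` in degrees `≥ n` and zero in degrees `< n`. -/
def bete (F : CochainComplex A ℤ) : FilteredComplex A where
  X := F
  fil :=
    { obj := fun n => sigmaGE F n.unop
      map := fun f => sigmaGEMap F (leOfHom f.unop)
      map_id := fun n => by
        ext m
        by_cases hm : n.unop ≤ m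
        · simp [sigmaGEMap, hm]
        · exact (isZero_sigmaGE_X F hm).eq_of_src _ _
      map_comp := fun {n₁ n₂ n₃} f g => by
        ext m
        by_cases hm : n₁.unop ≤ m
        · have h₂ := (leOfHom f.unop).trans hm
          simp [sigmaGEMap, dif_pos hm, dif_pos h₂]
        · exact (isZero_sigmaGE_X F hm).eq_of_src _ _ }
  ι :=
    { app := fun n => sigmaGEι F n.unop
      naturality := fun n n' f => by
        ext m
        by_cases hm : n.unop ≤ m
        · have h₂ := (leOfHom f.unop).trans hm
          simp [sigmaGEMap, sigmaGEι, dif_pos hm, dif_pos h₂]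
        · exact (isZero_sigmaGE_X F hm).eq_of_src _ _ }
  mono_ι n := by
    refine mono_of_mono_f _ fun m => ?_
    by_cases hm : n.unop ≤ m
    · have : (sigmaGEι F n.unop).f m = (sigmaGEXIso F hm).hom := by simp [sigmaGEι, dif_pos hm]
      change Mono ((sigmaGEι F n.unop).f m)
      rw [this]
      infer_instance
    · exact ⟨fun _ _ _ => (isZero_sigmaGE_X F hm).eq_of_tgt _ _⟩

end Bete

/-! ### Filtered injective resolutions -/

/-- A filtered injective resolution of a filtered complex `F`: a filtered quasi-isomorphism
`F ⟶ I` where `I` is bounded below, has a filtration that is finite in each degree, and has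
graded pieces that consist of injective objects. -/
structure FilteredInjectiveResolution (F : FilteredComplex A) where
  I : FilteredComplex A
  φ : F ⟶ I
  quasiIso : filteredQuasiIso φ
  bounded_below : ∃ N : ℤ, ∀ m < N, IsZero (I.X.X m)
  exhaustive : ∀ m : ℤ, ∃ a : ℤ, IsIso ((I.ι.app (op a)).f m)
  separated : ∀ m : ℤ, ∃ b : ℤ, IsZero ((I.fil.obj (op b)).X m)
  injective_gr : ∀ n m : ℤ, Injective (((gr n).obj I).X m)

/-- The filtered complex `RHom(K, F) = Tot Hom(K, I)`, computed by a filtered injective resolution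
`I` of `F`. -/
abbrev FilteredInjectiveResolution.rHom {F : FilteredComplex A}
    (I : FilteredInjectiveResolution F) (K : CochainComplex A ℤ) :
    FilteredComplex AddCommGrpCat.{v} :=
  (totHomFil.obj (op K)).obj I.I

end Filtered

/-! ### Local acyclic fibrations of simplicial presheaves -/

section Site

variable {C : Type u} [Category.{v} C]

/-- Simplicial presheaves on `C`. -/
abbrev SPre (C : Type u) [Category.{v} C] := SimplicialObject (Cᵒᵖ ⥤ Type (max u v))

/-- The simplicial set of sections of a simplicial presheaf, as a functor. -/
def sections (U : Cᵒᵖ) : SPre C ⥤ SSet.{max u v} :=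
  (SimplicialObject.whiskering _ _).obj ((evaluation _ _).obj U)

/-- The restriction map of the simplicial sets of sections. -/
def res {U V : Cᵒᵖ} (g : U ⟶ V) : sections (C := C) U ⟶ sections V :=
  (SimplicialObject.whiskering _ _).map ((evaluation _ _).map g)

variable (J : GrothendieckTopology C)

/-- A morphism `f : L ⟶ K` of simplicial presheaves is a local acyclic fibration if it has the
local right lifting property with respect to all inclusions `∂Δ[k] ⟶ Δ[k]`. -/
def IsLocalAcyclicFibration {L K : SPre C} (f : L ⟶ K) : Prop :=
  ∀ (U : C) (k : ℕ)
    (a : ((∂Δ[k] : SSet.Subcomplex.{max u v} _) : SSet.{max u v}) ⟶ (sections (op U)).obj L)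
    (b : Δ[k] ⟶ (sections (op U)).obj K),
    a ≫ (sections (op U)).map f = (∂Δ[k]).ι ≫ b →
    ∃ R ∈ J U, ∀ ⦃V : C⦄ (g : V ⟶ U), R g →
      ∃ l : Δ[k] ⟶ (sections (op V)).obj L,
        (∂Δ[k]).ι ≫ l = a ≫ (res g.op).app L ∧
        l ≫ (sections (op V)).map f = b ≫ (res g.op).app K

/-- The full subcategory `D(X)` of the category of simplicial presheaves over `X` that consists
of the local acyclic fibrations `K ⟶ X`. -/
abbrev LAF (X : SPre C) :=
  ObjectProperty.FullSubcategory (fun K : Over X => IsLocalAcyclicFibration J K.hom)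

variable {J}

/-- A simplicial homotopy over `X` between two morphisms `f, g : K ⟶ L` of simplicial presheaves
over `X`: a morphism `K × Δ[1] ⟶ L` over `X` (given by a family of morphisms
`K(U) × Δ[1] ⟶ L(U)`, natural in `U`) whose restrictions to the ends of `Δ[1]` are `f` and `g`. -/
structure SimplicialHomotopyOver {X : SPre C} {K L : Over X} (f g : K ⟶ L) where
  h (U : Cᵒᵖ) : (sections U).obj K.left ⊗ Δ[1] ⟶ (sections U).obj L.left
  naturality {U V : Cᵒᵖ} (i : U ⟶ V) :
    ((res i).app K.left ▷ Δ[1]) ≫ h V = h U ≫ (res i).app L.left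
  h₀ (U : Cᵒᵖ) : SSet.ι₀ ≫ h U = (sections U).map f.left
  h₁ (U : Cᵒᵖ) : SSet.ι₁ ≫ h U = (sections U).map g.left
  h_over (U : Cᵒᵖ) : h U ≫ (sections U).map L.hom =
    SemiCartesianMonoidalCategory.fst _ _ ≫ (sections U).map K.hom

variable (J)

/-- The relation of being simplicially homotopic over `X`. -/
def homotopyRel (X : SPre C) : HomRel (LAF J X) := fun _ _ f g =>
  Nonempty (SimplicialHomotopyOver f.hom g.hom)

/-- The homotopy category `hD(X)`: its objects are the local acyclic fibrations `K ⟶ X`, its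
morphisms are the morphisms over `X` up to the equivalence relation generated by simplicial
homotopy. -/
abbrev HLAF (X : SPre C) := CategoryTheory.Quotient (homotopyRel J X)

lemma SimplicialHomotopyOver.naturality_aux {X : SPre C} {K L : Over X} {f g : K ⟶ L}
    (H : SimplicialHomotopyOver f g) {U V : Cᵒᵖ} (i : U ⟶ V) {n m : ℕ}
    (x : ((sections U).obj K.left) _⦋n⦌) (y : ((Δ[n] : SSet.{max u v}) ⊗ Δ[1] : SSet.{max u v}) _⦋m⦌) :
    ((res i).app L.left).app _ ((SSet.yonedaEquiv.symm x ▷ Δ[1] ≫ H.h U).app _ y) =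
      (SSet.yonedaEquiv.symm (((res i).app K.left).app _ x) ▷ Δ[1] ≫ H.h V).app _ y := by
  have h : SSet.yonedaEquiv.symm (((res i).app K.left).app _ x) =
      SSet.yonedaEquiv.symm x ≫ (res i).app K.left := by
    apply SSet.yonedaEquiv.injective
    simp
  rw [h, MonoidalCategory.comp_whiskerRight, Category.assoc, H.naturality i]
  rfl

/-- The combinatorial simplicial homotopy associated to a simplicial homotopy over `X`. -/
def SimplicialHomotopyOver.toHomotopy {X : SPre C} {K L : Over X} {f g : K ⟶ L}
    (H : SimplicialHomotopyOver f g) : SimplicialObject.Homotopy f.left g.left := by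
  let H' (U : Cᵒᵖ) : SSet.Homotopy ((sections U).map f.left) ((sections U).map g.left) :=
    SSet.RelativeMorphism.Homotopy.mk (H.h U) (H.h₀ U) (H.h₁ U) (by
      ext n ⟨x, y⟩
      exact x.2.elim)
  exact
  { h := fun {n} i => { app := fun U => (H' U).toSimplicialObjectHomotopy.h i
                        naturality := fun U V j => by
                          ext x
                          exact (H.naturality_aux j x _).symm }
    h_zero_comp_δ_zero n := by
      ext U : 2
      exact (H' U).toSimplicialObjectHomotopy.h_zero_comp_δ_zero n
    h_last_comp_δ_last n := by
      ext U : 2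
      exact (H' U).toSimplicialObjectHomotopy.h_last_comp_δ_last n
    h_succ_comp_δ_castSucc_of_lt i j hij := by
      ext U : 2
      exact (H' U).toSimplicialObjectHomotopy.h_succ_comp_δ_castSucc_of_lt i j hij
    h_succ_comp_δ_castSucc_succ i := by
      ext U : 2
      exact (H' U).toSimplicialObjectHomotopy.h_succ_comp_δ_castSucc_succ i
    h_castSucc_comp_δ_succ_of_lt i j hij := by
      ext U : 2
      exact (H' U).toSimplicialObjectHomotopy.h_castSucc_comp_δ_succ_of_lt i j hij
    h_comp_σ_castSucc_of_le i j hij := by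
      ext U : 2
      exact (H' U).toSimplicialObjectHomotopy.h_comp_σ_castSucc_of_le i j hij
    h_comp_σ_succ_of_lt i j hij := by
      ext U : 2
      exact (H' U).toSimplicialObjectHomotopy.h_comp_σ_succ_of_lt i j hij }

/-- Sheaves of abelian groups. -/
abbrev AbSheaf := Sheaf J AddCommGrpCat.{max u v}

/-- The sheaf of free abelian groups associated to a presheaf of sets. -/
def freeAbSheaf : (Cᵒᵖ ⥤ Type (max u v)) ⥤ AbSheaf J :=
  (Functor.whiskeringRight _ _ _).obj AddCommGrpCat.free ⋙ presheafToSheaf J _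

/-- The cochain complex `ℤK`, in nonpositive degrees, of sheaves of free abelian groups associated to
a simplicial presheaf `K`; its term in degree `-n` is the sheaf of free abelian groups
associated to `K_n`, its differentials are the alternating sums of the face maps. -/
def freeComplex : SPre C ⥤ CochainComplex (AbSheaf J) ℤ :=
  (SimplicialObject.whiskering _ _).obj (freeAbSheaf J) ⋙
    AlgebraicTopology.alternatingFaceMapComplex _ ⋙
    ComplexShape.embeddingDownNat.extendFunctor _

/-- The functor `K ↦ ℤK` on `D(X)`. -/
def freeComplexLAF (X : SPre C) : LAF J X ⥤ CochainComplex (AbSheaf J) ℤ :=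
  ObjectProperty.ι _ ⋙ Over.forget X ⋙ freeComplex J

lemma nonempty_homotopy_freeComplex {X : SPre C} {K L : LAF J X} {f g : K ⟶ L}
    (h : homotopyRel J X f g) :
    Nonempty (Homotopy ((freeComplexLAF J X).map f) ((freeComplexLAF J X).map g)) := by
  obtain ⟨H⟩ := h
  exact ⟨((H.toHomotopy.whiskerRight (freeAbSheaf J)).toChainHomotopy).extend
    ComplexShape.embeddingDownNat⟩

variable {J} in
/-- A contravariant functor on complexes of sheaves that inverts the homotopy equivalences
induces a contravariant functor on `hD(X)`, through `K ↦ ℤK`. -/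
def liftHLAF (X : SPre C) {E : Type*} [Category* E] (G : (CochainComplex (AbSheaf J) ℤ)ᵒᵖ ⥤ E)
    (hG : (HomologicalComplex.homotopyEquivalences _ _).IsInvertedBy G.rightOp) :
    (HLAF J X)ᵒᵖ ⥤ E :=
  (CategoryTheory.Quotient.lift (homotopyRel J X) (freeComplexLAF J X ⋙ G.rightOp) (fun K L f g h => by
    obtain ⟨H⟩ := nonempty_homotopy_freeComplex J h
    exact H.map_eq_of_inverts_homotopyEquivalences (fun j => ⟨j - 1, by simp⟩) _ hG)).leftOp

/-- The functor `K ↦ H^p(Tot Hom(ℤK, F))` on `hD(X)`. -/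
def cechCohomology (X : SPre C) (F : CochainComplex (AbSheaf J) ℤ) (p : ℤ) :
    (HLAF J X)ᵒᵖ ⥤ AddCommGrpCat.{max u v} :=
  liftHLAF X (totHom.flip.obj F ⋙ HomologicalComplex.homologyFunctor _ _ p)
    (isInvertedBy_homology_totHom F p)

/-- The ind-object `K ↦ Tot Hom(ℤK, F)`, `K ∈ hD(X)`, of the filtered derived category of abelian
groups, for a filtered complex of sheaves `F`. -/
def cechIndObject (X : SPre C) (F : FilteredComplex (AbSheaf J)) :
    (HLAF J X)ᵒᵖ ⥤ FilteredDerivedCategory AddCommGrpCat.{max u v} :=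
  liftHLAF X (totHomFil.flip.obj F ⋙ FilteredDerivedCategory.Q) (isInvertedBy_totHomFil F)

/-- The hyper-Ext group `Ext^p(ℤX, F)`, the group of morphisms `ℤX ⟶ F[p]` in the derived category
of sheaves of abelian groups. -/
abbrev hyperExt [HasDerivedCategory.{w'} (AbSheaf J)] (X : SPre C)
    (F : CochainComplex (AbSheaf J) ℤ) (p : ℤ) : AddCommGrpCat.{w'} :=
  AddCommGrpCat.of
    (ShiftedHom (DerivedCategory.Q.obj ((freeComplex J).obj X)) (DerivedCategory.Q.obj F) p)

/-- The class in `H^p(Tot Hom(ℤK, F))` of a cocycle of degree `p`, that is, of a morphism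
`ℤK ⟶ F[p]` of complexes. -/
def cechClass {X : SPre C} (K : LAF J X) {F : CochainComplex (AbSheaf J) ℤ} {p : ℤ}
    (z : (freeComplex J).obj K.obj.left ⟶ F⟦p⟧) :
    (cechCohomology J X F p).obj (op ((CategoryTheory.Quotient.functor _).obj K)) :=
  (CochainComplex.HomComplex.homologyAddEquiv ((freeComplex J).obj K.obj.left) F p).symm
    (CochainComplex.HomComplex.CohomologyClass.mk
      (CochainComplex.HomComplex.Cocycle.equivHomShift z))

/-- For a filtered injective resolution `I` of `F` and `K ∈ D(X)`, the morphism
`RHom(ℤX, F) = Tot Hom(ℤX, I) ⟶ Tot Hom(ℤK, I)` of filtered complexes induced by `ℤK ⟶ ℤX`. -/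
def rHomToTotHom {X : SPre C} {F : FilteredComplex (AbSheaf J)} (I : FilteredInjectiveResolution F)
    (K : LAF J X) :
    I.rHom ((freeComplex J).obj X) ⟶ I.rHom ((freeComplex J).obj K.obj.left) :=
  (totHomFil.map ((freeComplex J).map K.obj.hom).op).app I.I

/-- For a filtered injective resolution `I` of `F` and `K ∈ D(X)`, the morphism
`Tot Hom(ℤK, F) ⟶ Tot Hom(ℤK, I)` in the filtered derived category induced by `F ⟶ I`. -/
def cechToTotHom {X : SPre C} {F : FilteredComplex (AbSheaf J)} (I : FilteredInjectiveResolution F)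
    (K : LAF J X) :
    (cechIndObject J X F).obj (op ((CategoryTheory.Quotient.functor _).obj K)) ⟶
      FilteredDerivedCategory.Q.obj (I.rHom ((freeComplex J).obj K.obj.left)) :=
  FilteredDerivedCategory.Q.map ((totHomFil.obj (op ((freeComplex J).obj K.obj.left))).map I.φ)

end Site

end CechExt

end

noncomputable section

namespace CechExt

/-! ### Local lifting properties -/

section LocalLifting

variable {C : Type u} [Category.{v} C] (J : GrothendieckTopology C)

/-! The theorem rests on two facts about a local acyclic fibration `K ⟶ X`.

First, `ℤK ⟶ ℤX` is a quasi-isomorphism (`IsLocalAcyclicFibration.quasiIso_freeComplex`): chains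
have finite support, finite subcomplexes of `X(U)` lift locally to `K`, and two such lifts are
locally homotopic. So for a bounded below complex `I` of injectives, `Tot Hom(ℤX, I) ⟶ Tot Hom(ℤK,
I)` is a quasi-isomorphism; both sides compute maps out of `ℤX` in the derived category.

Second, `ℤK_n` is projective up to refinement (`exists_lift_freeAbSheaf`): a map from it to a
quotient sheaf lifts after pullback along some local acyclic fibration `K' ⟶ K`. As `ℤK` lives in
degrees `≤ 0`, a cocycle on `ℤK` with values in a bounded below acyclic complex becomes a coboundary
after finitely many refinements (`exists_refinement_δ_eq`). Applied to the cone of a resolution `F ⟶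
I`, this makes `H^p Tot Hom(ℤK, F) ⟶ H^p Tot Hom(ℤK, I)` bijective in the colimit over `K`. By the
first fact the target does not depend on `K`, and it is `Ext^p(ℤX, F)`.

The first fact and the cofilteredness of `hD(X)` use that lifting against `∂Δ[k] ⟶ Δ[k]` implies
lifting against every monomorphism to a finite simplicial set (`HasLocalLift.of_mono`), hence
relative lifting of homotopies. Fibre products over `X` dominate pairs of objects, and two parallel
arrows become homotopic on their homotopy equalizer.

In the filtered statement the same argument is applied to `F ⟶ I`, to each step and to each graded
piece. Graded pieces commute with `Tot Hom` because both filtrations are split in each degree. A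
filtered injective resolution of the filtration bête is the limit of a tower that resolves the
quotients `F / σ_{≥ n} F`, each stage being an extension of the previous one by a complex of
injectives; in each degree the tower is eventually constant. -/

lemma res_comp {U V W : Cᵒᵖ} (g : U ⟶ V) (h : V ⟶ W) (L : SPre C) :
    (res (g ≫ h)).app L = (res g).app L ≫ (res h).app L := by
  ext n x
  exact ConcreteCategory.congr_hom ((L.obj n).map_comp g h) x

lemma res_id (U : Cᵒᵖ) (L : SPre C) : (res (𝟙 U)).app L = 𝟙 _ := by
  ext n x
  exact ConcreteCategory.congr_hom ((L.obj n).map_id U) x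

lemma res_naturality {U V : Cᵒᵖ} (g : U ⟶ V) {L K : SPre C} (f : L ⟶ K) :
    (sections U).map f ≫ (res g).app K = (res g).app L ≫ (sections V).map f :=
  (res g).naturality f

/-- The sieve of the morphisms `V ⟶ U` such that a lifting problem over `U` has a solution
over `V`. -/
def liftSieve {L K : SPre C} (f : L ⟶ K) {A B : SSet.{max u v}} (i : A ⟶ B) {U : C}
    (a : A ⟶ (sections (op U)).obj L) (b : B ⟶ (sections (op U)).obj K) : Sieve U where
  arrows V g := ∃ l : B ⟶ (sections (op V)).obj L,
    i ≫ l = a ≫ (res g.op).app L ∧ l ≫ (sections (op V)).map f = b ≫ (res g.op).app K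
  downward_closed := by
    rintro V W g ⟨l, h₁, h₂⟩ h
    refine ⟨l ≫ (res h.op).app L, ?_, ?_⟩
    · rw [op_comp, res_comp, reassoc_of% h₁]
    · rw [op_comp, res_comp, Category.assoc, ← res_naturality, reassoc_of% h₂]

/-- The local right lifting property of a morphism `f` of simplicial presheaves with respect to a
morphism `i` of simplicial sets. -/
def HasLocalLift {A B : SSet.{max u v}} (i : A ⟶ B) {L K : SPre C} (f : L ⟶ K) : Prop :=
  ∀ ⦃U : C⦄ (a : A ⟶ (sections (op U)).obj L) (b : B ⟶ (sections (op U)).obj K),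
    a ≫ (sections (op U)).map f = i ≫ b → liftSieve f i a b ∈ J U

lemma isLocalAcyclicFibration_iff {L K : SPre C} (f : L ⟶ K) :
    IsLocalAcyclicFibration J f ↔ ∀ k : ℕ, HasLocalLift J (∂Δ[k] : SSet.Subcomplex.{max u v} _).ι f := by
  constructor
  · intro h k U a b hab
    obtain ⟨R, hR, h'⟩ := h U k a b hab
    exact J.superset_covering (fun V g hg => h' g hg) hR
  · intro h U k a b hab
    exact ⟨_, h k a b hab, fun V g hg => hg⟩

variable {J}

namespace HasLocalLift

variable {L K : SPre C} {f : L ⟶ K}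

lemma of_isIso {A B : SSet.{max u v}} (i : A ⟶ B) [IsIso i] : HasLocalLift J i f := by
  intro U a b hab
  refine J.superset_covering (fun V g _ => ?_) (J.top_mem U)
  refine ⟨inv i ≫ a ≫ (res g.op).app L, by simp, ?_⟩
  rw [Category.assoc, Category.assoc, ← res_naturality, reassoc_of% hab, IsIso.inv_hom_id_assoc]

lemma comp {A B B' : SSet.{max u v}} {i : A ⟶ B} {j : B ⟶ B'} (hi : HasLocalLift J i f)
    (hj : HasLocalLift J j f) : HasLocalLift J (i ≫ j) f := by
  intro U a b hab
  refine J.transitive (hi a (j ≫ b) (by simpa using hab)) _ ?_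
  rintro V g ⟨l, h₁, h₂⟩
  refine J.superset_covering ?_ (hj l (b ≫ (res g.op).app K) (by simpa using h₂))
  rintro W h ⟨m, h₃, h₄⟩
  exact ⟨m, by rw [op_comp, res_comp, Category.assoc, h₃, reassoc_of% h₁],
    by rw [op_comp, res_comp, h₄, Category.assoc]⟩

lemma of_isPushout {A B A' B' : SSet.{max u v}} {t : A ⟶ A'} {i : A ⟶ B} {i' : A' ⟶ B'} {b : B ⟶ B'}
    (sq : IsPushout t i i' b) (hi : HasLocalLift J i f) : HasLocalLift J i' f := by
  intro U x y hxy
  refine J.superset_covering ?_ (hi (t ≫ x) (b ≫ y) (by rw [Category.assoc, hxy, sq.w_assoc]))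
  rintro V g ⟨l, h₁, h₂⟩
  refine ⟨sq.desc (x ≫ (res g.op).app L) l (by simp [h₁]), by simp, ?_⟩
  apply sq.hom_ext
  · rw [IsPushout.inl_desc_assoc, Category.assoc, ← res_naturality, reassoc_of% hxy]
  · rw [IsPushout.inr_desc_assoc, h₂, Category.assoc]

/-- Finiteness of the index set is essential: the covering sieves that solve the separate problems
are intersected. -/
lemma sigmaMap {T : Type*} [Finite T] {A B : T → SSet.{max u v}} [HasCoproduct A] [HasCoproduct B]
    (i : ∀ t, A t ⟶ B t) (hi : ∀ t, HasLocalLift J (i t) f) :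
    HasLocalLift J (Limits.Sigma.map i) f := by
  intro U x y hxy
  have h (t : T) := hi t (Sigma.ι A t ≫ x) (Sigma.ι B t ≫ y) (by
    rw [Category.assoc, hxy]; simp)
  have hS : (⨅ t, liftSieve f (i t) (Sigma.ι A t ≫ x) (Sigma.ι B t ≫ y)) ∈ J U := by
    have := Fintype.ofFinite T
    rw [← Finset.inf_univ_eq_iInf]
    refine Finset.inf_induction (J.top_mem U) (fun _ h _ h' => J.intersection_covering h h')
      (fun t _ => h t)
  refine J.superset_covering ?_ hS
  intro V g hg
  replace hg (t : T) : liftSieve f (i t) (Sigma.ι A t ≫ x) (Sigma.ι B t ≫ y) g :=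
    (iInf_le (fun t => liftSieve f (i t) (Sigma.ι A t ≫ x) (Sigma.ι B t ≫ y)) t) _ hg
  choose l h₁ h₂ using hg
  refine ⟨Sigma.desc l, ?_, ?_⟩
  · ext t : 1
    simp [h₁]
  · ext t : 1
    simp [h₂]

/-- The local lifting property with respect to the inclusions of the boundaries of simplices implies
the one with respect to monomorphisms to finite simplicial sets. -/
lemma of_mono (hf : IsLocalAcyclicFibration J f) {A B : SSet.{max u v}} (i : A ⟶ B) [Mono i]
    [B.Finite] : HasLocalLift J i f := by
  rw [isLocalAcyclicFibration_iff] at hf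
  -- The simplices of `B` outside `A` are attached dimension by dimension. Each stage is a pushout
  -- of a coproduct of boundary inclusions, finite because `B` has finitely many nondegenerate
  -- simplices.
  have h (n : ℕ) : HasLocalLift J (SSet.Subcomplex.homOfLE
      ((SSet.skeletonOfMono i).monotone (Nat.zero_le n))) f := by
    induction n with
    | zero =>
      exact of_isIso (J := J) (f := f) (𝟙 (SSet.skeletonOfMono i 0 : SSet))
    | succ n hn =>
      have : Finite (SSet.relativeCellComplexOfMono.Cell i n) :=
        Finite.of_injective (β := B.nonDegenerate n) (fun c => ⟨c.simplex, c.nonDegenerate⟩)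
          (fun c c' h => SSet.relativeCellComplexOfMono.Cell.ext (Subtype.ext_iff.1 h))
      exact hn.comp (of_isPushout (SSet.relativeCellComplexOfMono.isPushout i n)
        (sigmaMap _ (fun _ => hf n)))
  obtain ⟨d, hd⟩ := B.hasDimensionLT_of_finite
  -- The filtration stops: all nondegenerate simplices of `B` have dimension `< d`.
  have htop : SSet.skeletonOfMono i d = ⊤ := by
    rw [← top_le_iff, SSet.Subcomplex.le_iff_contains_nonDegenerate]
    intro n x _
    rw [SSet.mem_skeletonOfMono_obj_iff_of_nonDegenerate]
    exact Or.inr (B.dim_lt_of_nonDegenerate x d)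
  have : IsIso (SSet.skeletonOfMono i d).ι := by
    rw [htop]
    exact inferInstanceAs (IsIso (SSet.Subcomplex.topIso B).hom)
  -- Stage `0` is the image of `i`, a copy of `A`.
  let e : A ⟶ (SSet.skeletonOfMono i 0 : SSet) :=
    SSet.Subcomplex.lift i (by simp)
  have : IsIso e := by
    have : IsIso (e ≫ (SSet.Subcomplex.eqToIso (SSet.skeletonOfMono_zero i)).hom) := by
      convert! (inferInstance : IsIso (SSet.Subcomplex.toRange i))
    exact IsIso.of_isIso_comp_right e (SSet.Subcomplex.eqToIso (SSet.skeletonOfMono_zero i)).hom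
  have : i = e ≫ SSet.Subcomplex.homOfLE
      ((SSet.skeletonOfMono i).monotone (Nat.zero_le d)) ≫ (SSet.skeletonOfMono i d).ι := rfl
  rw [this]
  exact (of_isIso e).comp ((h d).comp (of_isIso _))

end HasLocalLift

end LocalLifting

end CechExt

namespace CechExt

/-! ### Local acyclic fibrations: stability, and lifting of homotopies -/

section Stability

variable {C : Type u} [Category.{v} C] {J : GrothendieckTopology C}

instance (U : Cᵒᵖ) : PreservesLimitsOfShape WalkingCospan (sections (C := C) U) :=
  inferInstanceAs (PreservesLimitsOfShape WalkingCospan ((Functor.whiskeringRight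
    SimplexCategoryᵒᵖ _ _).obj ((evaluation Cᵒᵖ (Type (max u v))).obj U)))

lemma HasLocalLift.comp_right {A B : SSet.{max u v}} {i : A ⟶ B} {L K M : SPre C} {f : L ⟶ K}
    {g : K ⟶ M} (hf : HasLocalLift J i f) (hg : HasLocalLift J i g) : HasLocalLift J i (f ≫ g) := by
  intro U a b hab
  refine J.transitive (hg (a ≫ (sections _).map f) b (by simpa using hab)) _ ?_
  rintro V p ⟨l, h₁, h₂⟩
  refine J.superset_covering ?_ (hf (a ≫ (res p.op).app L) l (by
    rw [h₁, Category.assoc, Category.assoc, res_naturality]))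
  rintro W q ⟨m, h₃, h₄⟩
  exact ⟨m, by rw [op_comp, res_comp, h₃, Category.assoc],
    by rw [op_comp, res_comp, Functor.map_comp, reassoc_of% h₄, ← res_naturality, reassoc_of% h₂]⟩

lemma HasLocalLift.of_isPullback {A B : SSet.{max u v}} {i : A ⟶ B} {L K L' K' : SPre C} {t : L' ⟶ L}
    {f' : L' ⟶ K'} {f : L ⟶ K} {b : K' ⟶ K} (sq : IsPullback t f' f b) (hf : HasLocalLift J i f) :
    HasLocalLift J i f' := by
  intro U x y hxy
  refine J.superset_covering ?_ (hf (x ≫ (sections _).map t) (y ≫ (sections _).map b) (by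
    rw [Category.assoc, ← Functor.map_comp, sq.w, Functor.map_comp, reassoc_of% hxy]))
  rintro V g ⟨l, h₁, h₂⟩
  have sq' := sq.map (sections (op V))
  refine ⟨sq'.lift l (y ≫ (res g.op).app K') (by rw [h₂, Category.assoc, Category.assoc,
    res_naturality]), ?_, by simp⟩
  apply sq'.hom_ext
  · rw [Category.assoc, IsPullback.lift_fst, h₁, Category.assoc, Category.assoc, res_naturality]
  · rw [Category.assoc, IsPullback.lift_snd, Category.assoc, ← res_naturality, reassoc_of% hxy]

namespace IsLocalAcyclicFibration

lemma of_isIso {L K : SPre C} (f : L ⟶ K) [IsIso f] : IsLocalAcyclicFibration J f := by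
  rw [isLocalAcyclicFibration_iff]
  intro k U a b hab
  refine J.superset_covering (fun V g _ => ?_) (J.top_mem U)
  refine ⟨b ≫ (res g.op).app K ≫ (sections (op V)).map (inv f), ?_, ?_⟩
  · rw [← Category.assoc, ← hab, Category.assoc, ← res_naturality, ← Functor.map_comp_assoc]
    simp
  · simp

lemma comp {L K M : SPre C} {f : L ⟶ K} {g : K ⟶ M} (hf : IsLocalAcyclicFibration J f)
    (hg : IsLocalAcyclicFibration J g) : IsLocalAcyclicFibration J (f ≫ g) := by
  rw [isLocalAcyclicFibration_iff] at *
  exact fun k => (hf k).comp_right (hg k)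

lemma of_isPullback {L K L' K' : SPre C} {t : L' ⟶ L} {f' : L' ⟶ K'} {f : L ⟶ K} {b : K' ⟶ K}
    (sq : IsPullback t f' f b) (hf : IsLocalAcyclicFibration J f) :
    IsLocalAcyclicFibration J f' := by
  rw [isLocalAcyclicFibration_iff] at *
  exact fun k => (hf k).of_isPullback sq

end IsLocalAcyclicFibration

end Stability

/-! ### Gluing maps on a subcomplex of a cylinder -/

section Gluing

/-- A single-valued relation stable under the simplicial operators is the graph of a map on the
subcomplex where it is defined. Maps given on overlapping pieces are thus glued by taking the union
of their graphs. -/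
lemma exists_hom_of_relation {S Y : SSet.{u}}
    (r : ∀ (n : SimplexCategoryᵒᵖ), S.obj n → Y.obj n → Prop)
    (hr : ∀ {n m : SimplexCategoryᵒᵖ} (φ : n ⟶ m) (s : S.obj n) (y : Y.obj n), r n s y →
      r m (S.map φ s) (Y.map φ y))
    (hr' : ∀ (n : SimplexCategoryᵒᵖ) (s : S.obj n) (y y' : Y.obj n), r n s y → r n s y' → y = y') :
    ∃ (W : S.Subcomplex) (G : (W : SSet.{u}) ⟶ Y),
    (∀ (n : SimplexCategoryᵒᵖ) (s : S.obj n), s ∈ W.obj n → ∃ y, r n s y) ∧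
      ∀ (n : SimplexCategoryᵒᵖ) (s : S.obj n) (y : Y.obj n), r n s y →
        ∃ h : s ∈ W.obj n, G.app n ⟨s, h⟩ = y := by
  let W : S.Subcomplex :=
    { obj := fun n => { s | ∃ y, r n s y }
      map := by
        rintro n m φ s ⟨y, hy⟩
        exact ⟨_, hr φ s y hy⟩ }
  let G : (W : SSet.{u}) ⟶ Y :=
    { app := fun n => TypeCat.ofHom (fun s => s.2.choose)
      naturality := fun n m φ => by
        ext s
        exact hr' m _ _ _ ((W : SSet.{u}).map φ s).2.choose_spec (hr φ _ _ s.2.choose_spec) }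
  exact ⟨W, G, fun _ _ h => h, fun n s y hy => ⟨⟨y, hy⟩, hr' _ _ _ _ (Exists.choose_spec _) hy⟩⟩

/-- The ends of the cylinder are disjoint, so maps prescribed on both ends need no compatibility.
The `Δ[1]`-coordinates differ at the vertex `0`. -/
lemma ι₀_app_ne_ι₁_app {B : SSet.{u}} {n : SimplexCategoryᵒᵖ} (b b' : B.obj n) :
    (SSet.ι₀.app n b : (B ⊗ Δ[1] : SSet.{u}).obj n) ≠ SSet.ι₁.app n b' := by
  obtain ⟨n⟩ := n
  induction n using SimplexCategory.rec with | _ n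
  intro h
  have h' := congr_arg (fun p : (B ⊗ Δ[1] : SSet.{u}) _⦋n⦌ => p.2 0) h
  have h₀ := SSet.ι₀_app_snd_apply (X := B) b 0
  have h₁ := SSet.ι₁_app_snd_apply (X := B) b' 0
  exact zero_ne_one (h₀.symm.trans (h'.trans h₁))

/-- Homotopies on a subcomplex of `B` together with morphisms at both ends of `B ⊗ Δ[1]` glue. -/
lemma exists_glue_homotopy {B Y : SSet.{u}} (A : B.Subcomplex) (H : (A : SSet.{u}) ⊗ Δ[1] ⟶ Y)
    (x y : B ⟶ Y) (hx : SSet.ι₀ ≫ H = A.ι ≫ x) (hy : SSet.ι₁ ≫ H = A.ι ≫ y) :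
    ∃ (W : (B ⊗ Δ[1] : SSet.{u}).Subcomplex) (G : (W : SSet.{u}) ⟶ Y)
      (i₀ i₁ : B ⟶ W) (j : (A : SSet.{u}) ⊗ Δ[1] ⟶ W),
      i₀ ≫ W.ι = SSet.ι₀ ∧ i₁ ≫ W.ι = SSet.ι₁ ∧ j ≫ W.ι = A.ι ▷ Δ[1] ∧
      i₀ ≫ G = x ∧ i₁ ≫ G = y ∧ j ≫ G = H ∧
      ∀ {Z : SSet.{u}} (p q : (W : SSet.{u}) ⟶ Z), i₀ ≫ p = i₀ ≫ q → i₁ ≫ p = i₁ ≫ q →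
        j ≫ p = j ≫ q → p = q := by
  -- The union of the graphs of `x`, `y` and `H`.
  let r (n : SimplexCategoryᵒᵖ) (s : (B ⊗ Δ[1] : SSet.{u}).obj n) (t : Y.obj n) : Prop :=
    (∃ b, s = SSet.ι₀.app n b ∧ t = x.app n b) ∨ (∃ b, s = SSet.ι₁.app n b ∧ t = y.app n b) ∨
      (∃ a : ((A : SSet.{u}) ⊗ Δ[1] : SSet.{u}).obj n, s = (A.ι ▷ Δ[1]).app n a ∧ t = H.app n a)
  have hι₀ (n) (b b' : B.obj n) (h : (SSet.ι₀.app n b : (B ⊗ Δ[1] : SSet.{u}).obj n) =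
      SSet.ι₀.app n b') : b = b' := congr_arg Prod.fst h
  have hι₁ (n) (b b' : B.obj n) (h : (SSet.ι₁.app n b : (B ⊗ Δ[1] : SSet.{u}).obj n) =
      SSet.ι₁.app n b') : b = b' := congr_arg Prod.fst h
  have h₀ (n) (b : B.obj n) (a : ((A : SSet.{u}) ⊗ Δ[1] : SSet.{u}).obj n)
      (h : SSet.ι₀.app n b = (A.ι ▷ Δ[1]).app n a) : x.app n b = H.app n a := by
    obtain ⟨a, t⟩ := a
    have e₁ : b = a.1 := congr_arg Prod.fst h
    have e₂ : (a, t) = (SSet.ι₀ : (A : SSet.{u}) ⟶ _).app n a :=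
      Prod.ext rfl (congr_arg Prod.snd h).symm
    rw [e₂, e₁]
    exact (ConcreteCategory.congr_hom (NatTrans.congr_app hx n) a).symm
  have h₁ (n) (b : B.obj n) (a : ((A : SSet.{u}) ⊗ Δ[1] : SSet.{u}).obj n)
      (h : SSet.ι₁.app n b = (A.ι ▷ Δ[1]).app n a) : y.app n b = H.app n a := by
    obtain ⟨a, t⟩ := a
    have e₁ : b = a.1 := congr_arg Prod.fst h
    have e₂ : (a, t) = (SSet.ι₁ : (A : SSet.{u}) ⟶ _).app n a :=
      Prod.ext rfl (congr_arg Prod.snd h).symm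
    rw [e₂, e₁]
    exact (ConcreteCategory.congr_hom (NatTrans.congr_app hy n) a).symm
  have hA (n) (a a' : ((A : SSet.{u}) ⊗ Δ[1] : SSet.{u}).obj n)
      (h : (A.ι ▷ Δ[1]).app n a = (A.ι ▷ Δ[1]).app n a') : a = a' :=
    Prod.ext (Subtype.ext (congr_arg (fun p => p.1) h)) (congr_arg (fun p => p.2) h)
  obtain ⟨W, G, hW, hG⟩ := exists_hom_of_relation r (by
      rintro n m φ s t (⟨b, rfl, rfl⟩ | ⟨b, rfl, rfl⟩ | ⟨a, rfl, rfl⟩)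
      · exact Or.inl ⟨B.map φ b, (NatTrans.naturality_apply _ _ _).symm,
          (NatTrans.naturality_apply _ _ _).symm⟩
      · exact Or.inr (Or.inl ⟨B.map φ b, (NatTrans.naturality_apply _ _ _).symm,
          (NatTrans.naturality_apply _ _ _).symm⟩)
      · exact Or.inr (Or.inr ⟨((A : SSet.{u}) ⊗ Δ[1] : SSet.{u}).map φ a,
          (NatTrans.naturality_apply _ _ _).symm, (NatTrans.naturality_apply _ _ _).symm⟩)) (by
      -- Nine overlaps: each piece is embedded, the ends are disjoint, and an end meets `A ⊗ Δ[1]`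
      -- in a copy of `A`, where `hx` and `hy` apply.
      rintro n s t t' (⟨b, rfl, rfl⟩ | ⟨b, rfl, rfl⟩ | ⟨a, rfl, rfl⟩)
        (⟨b', h, rfl⟩ | ⟨b', h, rfl⟩ | ⟨a', h, rfl⟩)
      · rw [hι₀ _ _ _ h]
      · exact (ι₀_app_ne_ι₁_app _ _ h).elim
      · exact h₀ _ _ _ h
      · exact (ι₀_app_ne_ι₁_app _ _ h.symm).elim
      · rw [hι₁ _ _ _ h]
      · exact h₁ _ _ _ h
      · exact (h₀ _ _ _ h.symm).symm
      · exact (h₁ _ _ _ h.symm).symm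
      · rw [hA _ _ _ h])
  have r₀ (n) (b : B.obj n) : r n (SSet.ι₀.app n b) (x.app n b) := Or.inl ⟨b, rfl, rfl⟩
  have r₁ (n) (b : B.obj n) : r n (SSet.ι₁.app n b) (y.app n b) := Or.inr (Or.inl ⟨b, rfl, rfl⟩)
  have rA (n) (a : ((A : SSet.{u}) ⊗ Δ[1] : SSet.{u}).obj n) :
      r n ((A.ι ▷ Δ[1]).app n a) (H.app n a) := Or.inr (Or.inr ⟨a, rfl, rfl⟩)
  refine ⟨W, G, SSet.Subcomplex.lift SSet.ι₀ ?_, SSet.Subcomplex.lift SSet.ι₁ ?_,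
    SSet.Subcomplex.lift (A.ι ▷ Δ[1]) ?_, rfl, rfl, rfl, ?_, ?_, ?_, ?_⟩
  · rintro n _ ⟨b, rfl⟩
    exact (hG _ _ _ (r₀ n b)).1
  · rintro n _ ⟨b, rfl⟩
    exact (hG _ _ _ (r₁ n b)).1
  · rintro n _ ⟨b, rfl⟩
    exact (hG _ _ _ (rA n b)).1
  · ext n b
    exact (hG _ _ _ (r₀ n b)).2
  · ext n b
    exact (hG _ _ _ (r₁ n b)).2
  · ext n b
    exact (hG _ _ _ (rA n b)).2
  · intro Z p q e₀ e₁ eA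
    ext n ⟨s, hs⟩
    obtain ⟨t, (⟨b, rfl, _⟩ | ⟨b, rfl, _⟩ | ⟨a, rfl, _⟩)⟩ := hW _ _ hs
    · exact ConcreteCategory.congr_hom (NatTrans.congr_app e₀ n) b
    · exact ConcreteCategory.congr_hom (NatTrans.congr_app e₁ n) b
    · exact ConcreteCategory.congr_hom (NatTrans.congr_app eA n) a

end Gluing

/-! ### Local lifting of homotopies -/

section Homotopies

variable {C : Type u} [Category.{v} C] {J : GrothendieckTopology C}

/-- The local lifting of homotopies relative to a subcomplex. -/
lemma IsLocalAcyclicFibration.homotopyLift_mem {L K : SPre C} {f : L ⟶ K}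
    (hf : IsLocalAcyclicFibration J f) {B : SSet.{max u v}} [B.Finite] (A : B.Subcomplex) {U : C}
    (x y : B ⟶ (sections (op U)).obj L) (H : (A : SSet.{max u v}) ⊗ Δ[1] ⟶ (sections (op U)).obj L)
    (hx : SSet.ι₀ ≫ H = A.ι ≫ x) (hy : SSet.ι₁ ≫ H = A.ι ≫ y)
    (k : B ⊗ Δ[1] ⟶ (sections (op U)).obj K)
    (hxk : x ≫ (sections _).map f = SSet.ι₀ ≫ k) (hyk : y ≫ (sections _).map f = SSet.ι₁ ≫ k)
    (hHk : H ≫ (sections _).map f = A.ι ▷ Δ[1] ≫ k) :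
    ∃ R ∈ J U, ∀ ⦃V : C⦄ (g : V ⟶ U), R g → ∃ l : B ⊗ Δ[1] ⟶ (sections (op V)).obj L,
      SSet.ι₀ ≫ l = x ≫ (res g.op).app L ∧ SSet.ι₁ ≫ l = y ≫ (res g.op).app L ∧
      A.ι ▷ Δ[1] ≫ l = H ≫ (res g.op).app L ∧
      l ≫ (sections _).map f = k ≫ (res g.op).app K := by
  obtain ⟨W, G, i₀, i₁, j, e₀, e₁, ej, f₀, f₁, fj, hext⟩ := exists_glue_homotopy A H x y hx hy
  -- `W` is the union of both ends of `B ⊗ Δ[1]` and of `A ⊗ Δ[1]`; the lifting property applies to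
  -- its inclusion because `B ⊗ Δ[1]` is finite.
  refine ⟨_, HasLocalLift.of_mono hf W.ι G k ?_, ?_⟩
  · apply hext
    · rw [reassoc_of% f₀, reassoc_of% e₀, hxk]
    · rw [reassoc_of% f₁, reassoc_of% e₁, hyk]
    · rw [reassoc_of% fj, reassoc_of% ej, hHk]
  · rintro V g ⟨l, h₁, h₂⟩
    refine ⟨l, ?_, ?_, ?_, h₂⟩
    · rw [← e₀, Category.assoc, h₁, reassoc_of% f₀]
    · rw [← e₁, Category.assoc, h₁, reassoc_of% f₁]
    · rw [← ej, Category.assoc, h₁, reassoc_of% fj]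

end Homotopies

end CechExt

namespace CechExt

/-! ### The category `hD(X)` is cofiltered -/

/-! ### The homotopy equalizer of two parallel arrows -/

section HomotopyEqualizer

variable {C : Type u} [Category.{v} C] {X : SPre C} {K L : Over X}

/-- The `n`-simplices over `U` of the homotopy equalizer of `f` and `g` over `X`: an `n`-simplex of
`K(U)` together with a homotopy over `X` between its images. -/
@[ext]
structure HomotopyEqualizerSimplex (f g : K ⟶ L) (n : SimplexCategory) (U : Cᵒᵖ) :
    Type (max u v) where
  base : SSet.stdSimplex.obj n ⟶ (sections U).obj K.left
  homotopy : SSet.stdSimplex.obj n ⊗ Δ[1] ⟶ (sections U).obj L.left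
  h₀ : SSet.ι₀ ≫ homotopy = base ≫ (sections U).map f.left
  h₁ : SSet.ι₁ ≫ homotopy = base ≫ (sections U).map g.left
  h_over : homotopy ≫ (sections U).map L.hom =
    SemiCartesianMonoidalCategory.fst _ _ ≫ base ≫ (sections U).map K.hom

namespace HomotopyEqualizerSimplex

variable {f g : K ⟶ L}

/-- The simplicial structure. -/
@[simps]
def precomp {n m : SimplexCategory} (φ : m ⟶ n) {U : Cᵒᵖ} (κ : HomotopyEqualizerSimplex f g n U) :
    HomotopyEqualizerSimplex f g m U where
  base := SSet.stdSimplex.map φ ≫ κ.base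
  homotopy := SSet.stdSimplex.map φ ▷ Δ[1] ≫ κ.homotopy
  h₀ := by rw [SSet.ι₀_comp_assoc, κ.h₀, Category.assoc]
  h₁ := by rw [SSet.ι₁_comp_assoc, κ.h₁, Category.assoc]
  h_over := by
    rw [Category.assoc, κ.h_over]
    simp

/-- The restriction maps. -/
@[simps]
def restrict {n : SimplexCategory} {U V : Cᵒᵖ} (i : U ⟶ V) (κ : HomotopyEqualizerSimplex f g n U) :
    HomotopyEqualizerSimplex f g n V where
  base := κ.base ≫ (res i).app K.left
  homotopy := κ.homotopy ≫ (res i).app L.left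
  h₀ := by rw [reassoc_of% κ.h₀, res_naturality, Category.assoc]
  h₁ := by rw [reassoc_of% κ.h₁, res_naturality, Category.assoc]
  h_over := by
    rw [Category.assoc, ← res_naturality, reassoc_of% κ.h_over, res_naturality, Category.assoc]

lemma precomp_id {n : SimplexCategory} {U : Cᵒᵖ} (κ : HomotopyEqualizerSimplex f g n U) :
    κ.precomp (𝟙 n) = κ := by
  have h : SSet.stdSimplex.map (𝟙 n) = 𝟙 (SSet.stdSimplex.obj n) := SSet.stdSimplex.map_id n
  apply HomotopyEqualizerSimplex.ext
  · rw [precomp_base, h, Category.id_comp]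
  · rw [precomp_homotopy, h, MonoidalCategory.id_whiskerRight,
      Category.id_comp]

lemma precomp_comp {n m p : SimplexCategory} (φ : m ⟶ n) (ψ : p ⟶ m) {U : Cᵒᵖ}
    (κ : HomotopyEqualizerSimplex f g n U) : κ.precomp (ψ ≫ φ) = (κ.precomp φ).precomp ψ := by
  have h : SSet.stdSimplex.map (ψ ≫ φ) = SSet.stdSimplex.map ψ ≫ SSet.stdSimplex.map φ :=
    SSet.stdSimplex.map_comp ψ φ
  apply HomotopyEqualizerSimplex.ext
  · rw [precomp_base, precomp_base, precomp_base, h, Category.assoc]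
  · rw [precomp_homotopy, precomp_homotopy, precomp_homotopy, h,
      MonoidalCategory.comp_whiskerRight, Category.assoc]

end HomotopyEqualizerSimplex

variable (f g : K ⟶ L)

/-- The homotopy equalizer of `f` and `g` over `X`. -/
def homotopyEqualizer : SPre C where
  obj n :=
    { obj := fun U => HomotopyEqualizerSimplex f g n.unop U
      map := fun i => TypeCat.ofHom (fun κ => κ.restrict i)
      map_id := fun U => by
        ext κ : 3
        apply HomotopyEqualizerSimplex.ext <;> simp [res_id]
      map_comp := fun i j => by
        ext κ : 3
        apply HomotopyEqualizerSimplex.ext <;> simp [res_comp] }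
  map φ :=
    { app := fun U => TypeCat.ofHom (fun κ => κ.precomp φ.unop)
      naturality := fun U V i => by
        ext κ : 3
        apply HomotopyEqualizerSimplex.ext <;> simp }
  map_id n := by
    ext U κ : 5
    exact HomotopyEqualizerSimplex.precomp_id κ
  map_comp φ ψ := by
    ext U κ : 5
    exact HomotopyEqualizerSimplex.precomp_comp φ.unop ψ.unop κ

namespace homotopyEqualizer

/-- The projection to `K`. -/
def proj : homotopyEqualizer f g ⟶ K.left where
  app n :=
    { app := fun U => TypeCat.ofHom (fun κ => SSet.yonedaEquiv κ.base)
      naturality := fun U V i => by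
        ext κ
        exact SSet.yonedaEquiv_comp κ.base ((res i).app K.left) }
  naturality n m φ := by
    ext U κ
    exact (SSet.yonedaEquiv_naturality φ.unop κ.base).symm

variable {f g} in
/-- The morphism from a standard simplex given by a simplex of the homotopy equalizer. -/
def simplexMap {U : Cᵒᵖ} {n : SimplexCategory} (κ : HomotopyEqualizerSimplex f g n U) :
    SSet.stdSimplex.obj n ⟶ (sections U).obj (homotopyEqualizer f g) :=
  SSet.yonedaEquiv.symm (show ((sections U).obj (homotopyEqualizer f g)).obj (op n) from κ)

lemma comp_eq_simplexMap {U : Cᵒᵖ} {A : SSet.{max u v}} {n : SimplexCategory}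
    (s : A.obj (op n)) (p : A ⟶ (sections U).obj (homotopyEqualizer f g)) :
    SSet.yonedaEquiv.symm s ≫ p = simplexMap (p.app (op n) s) :=
  SSet.yonedaEquiv_symm_comp s p

/-- The universal homotopy. -/
def ev (U : Cᵒᵖ) : (sections U).obj (homotopyEqualizer f g) ⊗ Δ[1] ⟶ (sections U).obj L.left where
  app n := TypeCat.ofHom (fun (p : HomotopyEqualizerSimplex f g n.unop U × (Δ[1] : SSet.{max u v}).obj n) =>
    -- Evaluation at the tautological simplex of the standard simplex, as in the Yoneda lemma.
    p.1.homotopy.app n (SSet.stdSimplex.objEquiv.symm (𝟙 n.unop), p.2))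
  naturality n m φ := by
    ext ⟨κ, t⟩
    let s : (SSet.stdSimplex.obj n.unop ⊗ Δ[1] : SSet.{max u v}).obj n :=
      ⟨SSet.stdSimplex.objEquiv.symm (𝟙 n.unop), t⟩
    exact NatTrans.naturality_apply (HomotopyEqualizerSimplex.homotopy κ) φ s

/-- Every simplex of a standard simplex is the image of a tautological one under a simplicial
operator, so `ev` recovers the whole homotopy from its values there. -/
lemma simplexMap_ev {U : Cᵒᵖ} {n : SimplexCategory} (κ : HomotopyEqualizerSimplex f g n U) :
    simplexMap κ ▷ Δ[1] ≫ ev f g U =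
      κ.homotopy := by
  ext m ⟨s, t⟩
  have h : (SSet.stdSimplex.map (SSet.stdSimplex.objEquiv s)).app m
      (SSet.stdSimplex.objEquiv.symm (𝟙 m.unop)) = s :=
    SSet.stdSimplex.objEquiv.injective (Category.id_comp (SSet.stdSimplex.objEquiv s))
  let s' : (SSet.stdSimplex.obj n ⊗ Δ[1] : SSet.{max u v}).obj m :=
    ⟨(SSet.stdSimplex.map (SSet.stdSimplex.objEquiv s)).app m
      (SSet.stdSimplex.objEquiv.symm (𝟙 m.unop)), t⟩
  have h' : s' = ⟨s, t⟩ := Prod.ext h rfl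
  exact congr_arg (κ.homotopy.app m) h'

lemma simplexMap_proj {U : Cᵒᵖ} {n : SimplexCategory} (κ : HomotopyEqualizerSimplex f g n U) :
    simplexMap κ ≫
      (sections U).map (proj f g) = κ.base := by
  rw [simplexMap, SSet.yonedaEquiv_symm_comp]
  exact SSet.yonedaEquiv.symm_apply_apply κ.base

variable {f g} in
-- The uniqueness half of the universal property: a map to the homotopy equalizer amounts to a map
-- to `K` and a homotopy, as one sees simplex by simplex.
lemma hom_ext {U : Cᵒᵖ} {A : SSet.{max u v}} {p q : A ⟶ (sections U).obj (homotopyEqualizer f g)}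
    (h₁ : p ≫ (sections U).map (proj f g) = q ≫ (sections U).map (proj f g))
    (h₂ : p ▷ Δ[1] ≫ ev f g U = q ▷ Δ[1] ≫ ev f g U) : p = q := by
  ext ⟨n⟩ s
  have h₁' (r : A ⟶ (sections U).obj (homotopyEqualizer f g)) :
      HomotopyEqualizerSimplex.base (f := f) (g := g) (r.app (op n) s) =
        SSet.yonedaEquiv.symm s ≫ r ≫ (sections U).map (proj f g) := by
    rw [← Category.assoc, comp_eq_simplexMap]
    exact (simplexMap_proj _ _ _).symm
  have h₂' (r : A ⟶ (sections U).obj (homotopyEqualizer f g)) :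
      HomotopyEqualizerSimplex.homotopy (f := f) (g := g) (r.app (op n) s) =
        SSet.yonedaEquiv.symm s ▷ Δ[1] ≫ r ▷ Δ[1] ≫ ev f g U := by
    rw [← Category.assoc, ← MonoidalCategory.comp_whiskerRight, comp_eq_simplexMap]
    exact (simplexMap_ev _ _ _).symm
  apply HomotopyEqualizerSimplex.ext
  · exact (h₁' p).trans (Eq.trans (by rw [h₁]) (h₁' q).symm)
  · exact (h₂' p).trans (Eq.trans (by rw [h₂]) (h₂' q).symm)

lemma ι₀_ev (U : Cᵒᵖ) : SSet.ι₀ ≫ ev f g U = (sections U).map (proj f g) ≫ (sections U).map f.left := by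
  ext ⟨n⟩ κ
  exact congr_arg SSet.yonedaEquiv (HomotopyEqualizerSimplex.h₀ κ)

lemma ι₁_ev (U : Cᵒᵖ) : SSet.ι₁ ≫ ev f g U = (sections U).map (proj f g) ≫ (sections U).map g.left := by
  ext ⟨n⟩ κ
  exact congr_arg SSet.yonedaEquiv (HomotopyEqualizerSimplex.h₁ κ)

lemma ev_hom (U : Cᵒᵖ) : ev f g U ≫ (sections U).map L.hom =
    SemiCartesianMonoidalCategory.fst _ _ ≫ (sections U).map (proj f g) ≫ (sections U).map K.hom := by
  ext ⟨n⟩ ⟨κ, t⟩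
  let s : (SSet.stdSimplex.obj n ⊗ Δ[1] : SSet.{max u v}).obj (op n) :=
    ⟨SSet.stdSimplex.objEquiv.symm (𝟙 n), t⟩
  exact ConcreteCategory.congr_hom (NatTrans.congr_app (HomotopyEqualizerSimplex.h_over κ) (op n)) s

lemma ev_res {U V : Cᵒᵖ} (i : U ⟶ V) : ev f g U ≫ (res i).app L.left =
    (res i).app (homotopyEqualizer f g) ▷ Δ[1] ≫ ev f g V := rfl

/-- The universal homotopy, as a simplicial homotopy over `X`. -/
def simplicialHomotopyOver :
    SimplicialHomotopyOver (K := Over.mk (proj f g ≫ K.hom)) (Over.homMk (proj f g) ≫ f)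
      (Over.homMk (proj f g) ≫ g) where
  h U := ev f g U
  naturality i := rfl
  h₀ U := by rw [ι₀_ev, ← Functor.map_comp]; rfl
  h₁ U := by rw [ι₁_ev, ← Functor.map_comp]; rfl
  h_over U := by rw [ev_hom, ← Functor.map_comp]; rfl

variable {J : GrothendieckTopology C}

/-- A lifting problem for `∂Δ[k] ⟶ Δ[k]` against the projection asks to extend a homotopy from
`∂Δ[k]` to `Δ[k]`, over `X` and with prescribed ends. This is relative homotopy lifting for `L ⟶ X`.
-/
lemma isLocalAcyclicFibration_proj (hL : IsLocalAcyclicFibration J L.hom) :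
    IsLocalAcyclicFibration J (proj f g) := by
  intro U k a b hab
  have hf : (sections (op U)).map f.left ≫ (sections (op U)).map L.hom =
      (sections (op U)).map K.hom := by rw [← Functor.map_comp, Over.w]
  have hg : (sections (op U)).map g.left ≫ (sections (op U)).map L.hom =
      (sections (op U)).map K.hom := by rw [← Functor.map_comp, Over.w]
  obtain ⟨R, hR, h⟩ := hL.homotopyLift_mem (B := Δ[k]) (∂Δ[k])
    (b ≫ (sections _).map f.left) (b ≫ (sections _).map g.left) (a ▷ Δ[1] ≫ ev f g (op U))
    (by rw [SSet.ι₀_comp_assoc, ι₀_ev, reassoc_of% hab])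
    (by rw [SSet.ι₁_comp_assoc, ι₁_ev, reassoc_of% hab])
    -- The homotopy to be lifted is constant: `f` and `g` agree after projection to `X`.
    (SemiCartesianMonoidalCategory.fst _ _ ≫ b ≫ (sections _).map K.hom)
    (by rw [SSet.ι₀_fst_assoc, Category.assoc, hf])
    (by rw [SSet.ι₁_fst_assoc, Category.assoc, hg])
    (by simp [ev_hom, reassoc_of% hab])
  refine ⟨R, hR, fun V i hi => ?_⟩
  obtain ⟨l, h₀, h₁, hl, h_over⟩ := h i hi
  let κ : HomotopyEqualizerSimplex f g ⦋k⦌ (op V) :=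
    { base := b ≫ (res i.op).app K.left
      homotopy := l
      h₀ := by rw [h₀, Category.assoc, Category.assoc, res_naturality]
      h₁ := by rw [h₁, Category.assoc, Category.assoc, res_naturality]
      h_over := by rw [h_over, Category.assoc, Category.assoc, Category.assoc, res_naturality] }
  refine ⟨simplexMap κ, ?_,
    simplexMap_proj f g κ⟩
  apply hom_ext
  · rw [Category.assoc, Category.assoc, simplexMap_proj, ← res_naturality, reassoc_of% hab]
  · rw [MonoidalCategory.comp_whiskerRight, Category.assoc, simplexMap_ev,
      MonoidalCategory.comp_whiskerRight, Category.assoc, ← ev_res, hl, Category.assoc]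

end homotopyEqualizer

end HomotopyEqualizer

/-! ### Cones over pairs of objects and over parallel arrows -/

section Cofiltered

variable {C : Type u} [Category.{v} C] {J : GrothendieckTopology C} {X : SPre C}

/-- The object of `D(X)` given by a local acyclic fibration over an object of `D(X)`. -/
abbrev LAF.over (K : LAF J X) {K' : SPre C} (f : K' ⟶ K.obj.left)
    (hf : IsLocalAcyclicFibration J f) : LAF J X :=
  ⟨Over.mk (f ≫ K.obj.hom), hf.comp K.property⟩

/-- The morphism to an object of `D(X)` given by a local acyclic fibration. -/
abbrev LAF.overHom (K : LAF J X) {K' : SPre C} (f : K' ⟶ K.obj.left)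
    (hf : IsLocalAcyclicFibration J f) : K.over f hf ⟶ K :=
  ObjectProperty.homMk (Over.homMk f)

lemma LAF.exists_pullback (K L : LAF J X) : ∃ (M : LAF J X) (_ : M ⟶ K) (_ : M ⟶ L), True := by
  have sq := IsPullback.of_hasPullback L.obj.hom K.obj.hom
  have h := IsLocalAcyclicFibration.of_isPullback sq L.property
  exact ⟨K.over _ h, K.overHom _ h, ObjectProperty.homMk (Over.homMk (pullback.fst _ _) sq.w), trivial⟩

/-- This is where passage to the homotopy category is needed: the strict equalizer of `f` and `g`
need not be a local acyclic fibration over `X`, while the homotopy equalizer is one. -/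
lemma LAF.exists_equalizing {K L : LAF J X} (f g : K ⟶ L) :
    ∃ (M : LAF J X) (p : M ⟶ K), homotopyRel J X (p ≫ f) (p ≫ g) := by
  have h := homotopyEqualizer.isLocalAcyclicFibration_proj f.hom g.hom L.property
  exact ⟨K.over _ h, K.overHom _ h, ⟨homotopyEqualizer.simplicialHomotopyOver f.hom g.hom⟩⟩

variable (J X) in
lemma isCofiltered_HLAF : IsCofiltered (HLAF J X) := by
  have h : IsCofilteredOrEmpty (HLAF J X) :=
    { cone_objs := fun K L => by
        obtain ⟨M, p, q, _⟩ := LAF.exists_pullback K.as L.as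
        exact ⟨⟨M⟩, (CategoryTheory.Quotient.functor _).map p,
          (CategoryTheory.Quotient.functor _).map q, trivial⟩
      cone_maps := fun K L f g => by
        obtain ⟨f, rfl⟩ := (CategoryTheory.Quotient.functor (homotopyRel J X)).map_surjective f
        obtain ⟨g, rfl⟩ := (CategoryTheory.Quotient.functor (homotopyRel J X)).map_surjective g
        obtain ⟨M, p, h⟩ := LAF.exists_equalizing f g
        refine ⟨⟨M⟩, (CategoryTheory.Quotient.functor _).map p, ?_⟩
        rw [← Functor.map_comp, ← Functor.map_comp]
        exact CategoryTheory.Quotient.sound _ h }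
  exact { toIsCofilteredOrEmpty := h
          nonempty := ⟨⟨⟨Over.mk (𝟙 X), IsLocalAcyclicFibration.of_isIso (𝟙 X)⟩⟩⟩ }

end Cofiltered

end CechExt

namespace CechExt

/-! ### Quasi-isomorphisms of complexes of sheaves from local conditions on presheaves -/

section LocalHomology

variable {C : Type u} [Category.{v} C] {J : GrothendieckTopology C} {T : Type*} {c : ComplexShape T}

lemma exact_apply {S : ShortComplex (Cᵒᵖ ⥤ AddCommGrpCat.{w})} (hS : S.Exact) {U : Cᵒᵖ}
    (x : S.X₂.obj U) (hx : S.g.app U x = 0) : ∃ y, S.f.app U y = x :=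
  (ShortComplex.ab_exact_iff _).1 (hS.map ((evaluation _ _).obj U)) x hx

open HomologicalComplex in
-- Sheafification inverts the locally bijective maps. Here local bijectivity on homology is
-- expressed with cycles and boundaries; `hsurj` asks for equality of cycles and not only of
-- classes, which is what lifting along a local acyclic fibration gives.
lemma W_homologyMap {K L : HomologicalComplex (Cᵒᵖ ⥤ AddCommGrpCat.{max u v}) c} (φ : K ⟶ L) (n : T)
    (hinj : ∀ (U : C) (z : (K.X n).obj (op U)) (b : (L.X (c.prev n)).obj (op U)),
      (K.d n (c.next n)).app _ z = 0 → (φ.f n).app _ z = (L.d (c.prev n) n).app _ b →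
      ∃ R ∈ J U, ∀ ⦃V : C⦄ (g : V ⟶ U), R g →
        ∃ b', (K.d (c.prev n) n).app _ b' = (K.X n).map g.op z)
    (hsurj : ∀ (U : C) (y : (L.X n).obj (op U)), (L.d n (c.next n)).app _ y = 0 →
      ∃ R ∈ J U, ∀ ⦃V : C⦄ (g : V ⟶ U), R g →
        ∃ z, (K.d n (c.next n)).app _ z = 0 ∧ (φ.f n).app _ z = (L.X n).map g.op y) :
    J.W (homologyMap φ n) := by
  have ex₁ (K : HomologicalComplex (Cᵒᵖ ⥤ AddCommGrpCat.{max u v}) c) :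
      (ShortComplex.mk (K.toCycles (c.prev n) n) (K.homologyπ n) (by simp)).Exact :=
    ShortComplex.exact_of_g_is_cokernel _ (K.homologyIsCokernel _ n rfl)
  have ex₂ (K : HomologicalComplex (Cᵒᵖ ⥤ AddCommGrpCat.{max u v}) c) :
      (ShortComplex.mk (K.iCycles n) (K.d n (c.next n)) (by simp)).Exact :=
    ShortComplex.exact_of_f_is_kernel _ (K.cyclesIsKernel n _ rfl)
  have sur (K : HomologicalComplex (Cᵒᵖ ⥤ AddCommGrpCat.{max u v}) c) (U : Cᵒᵖ) :
      Function.Surjective ((K.homologyπ n).app U) :=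
    (AddCommGrpCat.epi_iff_surjective _).1 inferInstance
  have inj (K : HomologicalComplex (Cᵒᵖ ⥤ AddCommGrpCat.{max u v}) c) (U : Cᵒᵖ) :
      Function.Injective ((K.iCycles n).app U) :=
    (AddCommGrpCat.mono_iff_injective _).1 inferInstance
  have n₁ (U : Cᵒᵖ) (z : (K.cycles n).obj U) :
      (homologyMap φ n).app U ((K.homologyπ n).app U z) =
        (L.homologyπ n).app U ((cyclesMap φ n).app U z) :=
    ConcreteCategory.congr_hom (NatTrans.congr_app (homologyπ_naturality φ n) U) z
  have n₂ (U : Cᵒᵖ) (z : (K.cycles n).obj U) :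
      (L.iCycles n).app U ((cyclesMap φ n).app U z) = (φ.f n).app U ((K.iCycles n).app U z) :=
    ConcreteCategory.congr_hom (NatTrans.congr_app (cyclesMap_i φ n) U) z
  have n₃ (K : HomologicalComplex (Cᵒᵖ ⥤ AddCommGrpCat.{max u v}) c) (U : Cᵒᵖ)
      (b : (K.X (c.prev n)).obj U) : (K.iCycles n).app U ((K.toCycles _ n).app U b) =
        (K.d _ n).app U b :=
    ConcreteCategory.congr_hom (NatTrans.congr_app (K.toCycles_i _ n) U) b
  have n₄ (K : HomologicalComplex (Cᵒᵖ ⥤ AddCommGrpCat.{max u v}) c) (U : Cᵒᵖ)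
      (z : (K.cycles n).obj U) : (K.d n (c.next n)).app U ((K.iCycles n).app U z) = 0 :=
    ConcreteCategory.congr_hom (NatTrans.congr_app (K.iCycles_d n (c.next n)) U) z
  have n₅ (K : HomologicalComplex (Cᵒᵖ ⥤ AddCommGrpCat.{max u v}) c) (U : Cᵒᵖ)
      (b : (K.X (c.prev n)).obj U) : (K.homologyπ n).app U ((K.toCycles _ n).app U b) = 0 :=
    ConcreteCategory.congr_hom (NatTrans.congr_app (K.toCycles_comp_homologyπ _ n) U) b
  rw [GrothendieckTopology.W_iff_isLocallyBijective]
  constructor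
  · refine ⟨fun {U} x y h => ?_⟩
    obtain ⟨z, hz⟩ := sur K _ (x - y)
    have h' : (homologyMap φ n).app U (x - y) = 0 := (map_sub _ _ _).trans (sub_eq_zero.2 h)
    rw [← hz, n₁] at h'
    obtain ⟨b, hb⟩ := exact_apply (ex₁ L) _ h'
    obtain ⟨R, hR, hR'⟩ := hinj U.unop ((K.iCycles n).app _ z) b (n₄ _ _ _) (by
      rw [← n₂, ← n₃]
      exact congrArg _ hb.symm)
    refine J.superset_covering (fun V g hg => ?_) hR
    obtain ⟨b', hb'⟩ := hR' g hg
    have hz' : (K.toCycles _ n).app _ b' = (K.cycles n).map g.op z := by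
      apply inj K
      rw [n₃, hb']
      exact (NatTrans.naturality_apply (K.iCycles n) g.op z).symm
    refine sub_eq_zero.1 ((map_sub _ _ _).symm.trans ?_)
    have := NatTrans.naturality_apply (K.homologyπ n) g.op z
    rw [← hz', n₅] at this
    exact (congrArg _ hz.symm).trans this.symm
  · refine ⟨fun {U} s => ?_⟩
    obtain ⟨y, rfl⟩ := sur L _ s
    obtain ⟨R, hR, h⟩ := hsurj U ((L.iCycles n).app _ y) (n₄ _ _ _)
    refine J.superset_covering (fun V g hg => ?_) hR
    obtain ⟨z, hz, hz'⟩ := h g hg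
    obtain ⟨z, rfl⟩ := exact_apply (ex₂ K) z hz
    refine ⟨(K.homologyπ n).app _ z, ?_⟩
    rw [n₁, ← NatTrans.naturality_apply (L.homologyπ n)]
    congr 1
    apply inj L
    rw [n₂, hz', NatTrans.naturality_apply]

/-- Sheafification is exact, so it commutes with homology. -/
lemma quasiIso_sheafify {K L : HomologicalComplex (Cᵒᵖ ⥤ AddCommGrpCat.{max u v}) c} (φ : K ⟶ L)
    (h : ∀ n, J.W (HomologicalComplex.homologyMap φ n)) :
    QuasiIso (((presheafToSheaf J AddCommGrpCat.{max u v}).mapHomologicalComplex c).map φ) where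
  quasiIsoAt n := by
    rw [quasiIsoAt_iff_isIso_homologyMap]
    have := (J.W_iff _).1 (h n)
    let F := presheafToSheaf J AddCommGrpCat.{max u v}
    have e := ShortComplex.mapHomologyIso_hom_naturality
      ((HomologicalComplex.shortComplexFunctor _ c n).map φ) F
    exact ((MorphismProperty.isomorphisms _).arrow_mk_iso_iff
      (Arrow.isoMk _ _ e.symm)).2 this

end LocalHomology

end CechExt

namespace CechExt

/-! ### The complex of free abelian groups of a simplicial set -/

section FreeChain

/-- The chain complex of free abelian groups of a simplicial set. -/
def freeChain : SSet.{w} ⥤ ChainComplex AddCommGrpCat.{w} ℕ :=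
  (SimplicialObject.whiskering _ _).obj AddCommGrpCat.free ⋙
    AlgebraicTopology.alternatingFaceMapComplex _

lemma freeChain_map_injective {A B : SSet.{w}} (i : A ⟶ B) [Mono i] (n : ℕ) :
    Function.Injective ((freeChain.map i).f n) :=
  (AddCommGrpCat.mono_iff_injective _).1
    (inferInstanceAs (Mono (AddCommGrpCat.free.map (i.app (op ⦋n⦌)))))

lemma freeChain_map_comp_apply {A B D : SSet.{w}} (i : A ⟶ B) (j : B ⟶ D) (n : ℕ)
    (x : (freeChain.obj A).X n) :
    (freeChain.map (i ≫ j)).f n x = (freeChain.map j).f n ((freeChain.map i).f n x) := by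
  rw [Functor.map_comp]
  rfl

lemma freeChain_map_d {A B : SSet.{w}} (f : A ⟶ B) (i j : ℕ) (x : (freeChain.obj A).X i) :
    (freeChain.map f).f j ((freeChain.obj A).d i j x) =
      (freeChain.obj B).d i j ((freeChain.map f).f i x) :=
  (ConcreteCategory.congr_hom ((freeChain.map f).comm i j) x).symm

/-- A chain is a finite combination of simplices, each of which generates a finite subcomplex. This
reduces questions on chains to lifting problems for finite simplicial sets. -/
lemma exists_finite_support {A : SSet.{w}} {n : ℕ} (x : (freeChain.obj A).X n) :
    ∃ (S : A.Subcomplex) (_ : (S : SSet.{w}).Finite) (x' : (freeChain.obj S).X n),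
      (freeChain.map S.ι).f n x' = x := by
  have hle {S S' : A.Subcomplex} (h : S ≤ S') (x : (freeChain.obj S).X n) :
      (freeChain.map S'.ι).f n ((freeChain.map (SSet.Subcomplex.homOfLE h)).f n x) =
        (freeChain.map S.ι).f n x := by
    rw [← freeChain_map_comp_apply]
    rfl
  refine FreeAbelianGroup.induction_on (α := A.obj (op ⦋n⦌))
    (motive := fun x => ∃ (S : A.Subcomplex) (_ : (S : SSet.{w}).Finite)
      (x' : (freeChain.obj S).X n), (freeChain.map S.ι).f n x' = x) x ?_ ?_ ?_ ?_
  · have : ((⊥ : A.Subcomplex) : SSet.{w}).Finite := by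
      rw [← iSup_of_empty (fun e : Empty => e.elim), SSet.finite_iSup_iff]
      exact fun e => e.elim
    exact ⟨⊥, this, 0, map_zero _⟩
  · intro a
    exact ⟨SSet.Subcomplex.ofSimplex a, inferInstance,
      FreeAbelianGroup.of ⟨a, SSet.Subcomplex.mem_ofSimplex_obj a⟩, rfl⟩
  · rintro a ⟨S, hS, x', hx'⟩
    exact ⟨S, hS, -x', (map_neg _ _).trans (congrArg _ hx')⟩
  · rintro a b ⟨S, hS, x, hx⟩ ⟨S', hS', x', hx'⟩
    have : ((S ⊔ S' : A.Subcomplex) : SSet.{w}).Finite := by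
      rw [sup_eq_iSup, SSet.finite_iSup_iff]
      rintro (_ | _) <;> assumption
    refine ⟨S ⊔ S', this, (freeChain.map (SSet.Subcomplex.homOfLE le_sup_left)).f n x +
      (freeChain.map (SSet.Subcomplex.homOfLE le_sup_right)).f n x', ?_⟩
    refine (map_add _ _ _).trans ?_
    rw [hle, hle]
    exact congrArg₂ _ hx hx'

/-- The chain homotopy formula loses one of its terms on a cycle. In degree `0` the complex shape
gives `next 0 = 0` and the differential is zero, so `hx` then holds automatically. -/
lemma exists_freeChain_d_eq_sub {A B : SSet.{w}} {f g : A ⟶ B} (H : A ⊗ Δ[1] ⟶ B)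
    (h₀ : SSet.ι₀ ≫ H = f) (h₁ : SSet.ι₁ ≫ H = g) {n : ℕ} (x : (freeChain.obj A).X n)
    (hx : (freeChain.obj A).d n ((ComplexShape.down ℕ).next n) x = 0) :
    ∃ y, (freeChain.obj B).d ((ComplexShape.down ℕ).prev n) n y =
      (freeChain.map f).f n x - (freeChain.map g).f n x := by
  let H' : SSet.Homotopy f g := SSet.RelativeMorphism.Homotopy.mk H h₀ h₁ (by
    ext n ⟨x, y⟩
    exact x.2.elim)
  let h : Homotopy (freeChain.map f) (freeChain.map g) :=
    (H'.toSimplicialObjectHomotopy.whiskerRight AddCommGrpCat.free).toChainHomotopy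
  refine ⟨h.hom n _ x, ?_⟩
  have e : (dNext n h.hom) x = 0 := (congrArg (h.hom _ n) hx).trans (map_zero _)
  let P : (freeChain.obj A).X n ⟶ (freeChain.obj B).X n := prevD n h.hom
  have e' : (freeChain.map f).f n x = dNext n h.hom x + P x + (freeChain.map g).f n x :=
    ConcreteCategory.congr_hom (h.comm n) x
  rw [e', e]
  exact ((add_sub_cancel_right _ _).trans (zero_add _)).symm

end FreeChain

/-! ### Local acyclic fibrations induce quasi-isomorphisms -/

section LocalAcyclicFibration

variable {C : Type u} [Category.{v} C] {J : GrothendieckTopology C}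

lemma exists_covering_trans {U : C} {P : ∀ ⦃V : C⦄, (V ⟶ U) → Prop} {R : Sieve U} (hR : R ∈ J U)
    (h : ∀ ⦃V : C⦄ (g : V ⟶ U), R g → ∃ R' ∈ J V, ∀ ⦃W : C⦄ (g' : W ⟶ V), R' g' → P (g' ≫ g)) :
    ∃ R ∈ J U, ∀ ⦃V : C⦄ (g : V ⟶ U), R g → P g := by
  choose R' hR' h' using h
  refine ⟨Sieve.bind R R', J.bind_covering hR (fun V g hg => hR' g hg), ?_⟩
  rintro V g ⟨W, i, j, hj, hi, rfl⟩
  exact h' j hj i hi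

/-- The chain complex of presheaves of free abelian groups of a simplicial presheaf. -/
def freePreChain : SPre C ⥤ ChainComplex (Cᵒᵖ ⥤ AddCommGrpCat.{max u v}) ℕ :=
  (SimplicialObject.whiskering _ _).obj ((Functor.whiskeringRight _ _ _).obj AddCommGrpCat.free) ⋙
    AlgebraicTopology.alternatingFaceMapComplex _

lemma freePreChain_d_apply (K : SPre C) (U : Cᵒᵖ) (i j : ℕ)
    (x : (freeChain.obj ((sections U).obj K)).X i) :
    ((freePreChain.obj K).d i j).app U x = (freeChain.obj ((sections U).obj K)).d i j x := by
  by_cases h : j + 1 = i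
  · subst h
    have : ((freePreChain.obj K).d (j + 1) j).app U = (freeChain.obj ((sections U).obj K)).d (j + 1) j := by
      dsimp [freePreChain, freeChain]
      rw [AlgebraicTopology.alternatingFaceMapComplex_obj_d,
        AlgebraicTopology.alternatingFaceMapComplex_obj_d]
      simp only [AlgebraicTopology.AlternatingFaceMapComplex.objD, NatTrans.app_sum, NatTrans.app_zsmul]
      rfl
    exact ConcreteCategory.congr_hom this x
  · rw [HomologicalComplex.shape _ _ _ h, HomologicalComplex.shape _ _ _ h]
    rfl

/-- Surjectivity: the finite support of a cycle of `X(U)` lifts locally along `f`, and the lift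
carries the cycle. Injectivity: if `f z = d b`, a local lift `s` of a finite subcomplex supporting
`b` and `f z` gives `s (f z) = d (s b)`; moreover `z` and `s (f z)` are homologous, because the
inclusion of the support of `z` and its composite with `f` and `s` have the same image in `X` and
are therefore locally homotopic. -/
lemma W_homologyMap_freePreChain {K X : SPre C} {f : K ⟶ X} (hf : IsLocalAcyclicFibration J f) (n : ℕ) :
    J.W (HomologicalComplex.homologyMap (freePreChain.map f) n) := by
  refine W_homologyMap _ n (fun U z b hz hb => ?_) (fun U y hy => ?_)
  · replace hz := (freePreChain_d_apply K (op U) _ _ z).symm.trans hz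
    replace hb := hb.trans (freePreChain_d_apply X (op U) _ _ b)
    change (freeChain.map ((sections (op U)).map f)).f n z = _ at hb
    obtain ⟨A, _, z, rfl⟩ := exists_finite_support (A := (sections (op U)).obj K) z
    obtain ⟨B₀, hB₀, b₀, rfl⟩ := exists_finite_support (A := (sections (op U)).obj X) b
    -- `B` must contain the support of `b` and the image of `A`, so that `f z = d b` holds already
    -- in the chains of `B`.
    let B := B₀ ⊔ SSet.Subcomplex.range (A.ι ≫ (sections (op U)).map f)
    have : (B : SSet.{max u v}).Finite := by
      dsimp [B]
      rw [sup_eq_iSup, SSet.finite_iSup_iff]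
      rintro (_ | _)
      · exact inferInstanceAs (SSet.Subcomplex.range _ : SSet.{max u v}).Finite
      · exact hB₀
    let p : (A : SSet.{max u v}) ⟶ B := SSet.Subcomplex.lift (A.ι ≫ (sections (op U)).map f) le_sup_right
    have hp : p ≫ B.ι = A.ι ≫ (sections (op U)).map f := rfl
    let b := (freeChain.map (SSet.Subcomplex.homOfLE (show B₀ ≤ B from le_sup_left))).f _ b₀
    have hb' : (freeChain.map p).f n z = (freeChain.obj B).d _ n b := by
      apply freeChain_map_injective B.ι
      rw [← freeChain_map_comp_apply, hp, freeChain_map_comp_apply, freeChain_map_d]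
      refine hb.trans (congrArg _ ?_)
      rw [← freeChain_map_comp_apply]
      rfl
    have hz' : (freeChain.obj A).d n ((ComplexShape.down ℕ).next n) z = 0 := by
      apply freeChain_map_injective A.ι
      rw [freeChain_map_d, hz]
      exact (map_zero _).symm
    refine exists_covering_trans (HasLocalLift.of_mono hf (⊥ : (B : SSet.{max u v}).Subcomplex).ι
      (SSet.Subcomplex.isInitialBot.to _) B.ι (SSet.Subcomplex.isInitialBot.hom_ext _ _)) ?_
    rintro V g ⟨s, -, hs⟩
    -- Lifting the constant homotopy in `X`, relative to the empty subcomplex, joins the two lifts.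
    obtain ⟨R', hR', h⟩ := hf.homotopyLift_mem (⊥ : (A : SSet.{max u v}).Subcomplex)
      (A.ι ≫ (res g.op).app K) (p ≫ s)
      (SemiCartesianMonoidalCategory.fst _ _ ≫ SSet.Subcomplex.isInitialBot.to _)
      (SSet.Subcomplex.isInitialBot.hom_ext _ _) (SSet.Subcomplex.isInitialBot.hom_ext _ _)
      (SemiCartesianMonoidalCategory.fst _ _ ≫ A.ι ≫ (sections _).map f ≫ (res g.op).app X)
      (by rw [Category.assoc, ← res_naturality]; rfl)
      (by rw [Category.assoc, hs, reassoc_of% hp]; rfl)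
      (by
        ext n ⟨x, _⟩
        exact x.2.elim)
    refine ⟨R', hR', fun W g' hg' => ?_⟩
    obtain ⟨l, h₀, h₁, -⟩ := h g' hg'
    obtain ⟨y, hy⟩ := exists_freeChain_d_eq_sub l h₀ h₁ z hz'
    -- `y` bounds the difference of `z` and `s (f z)`; the image of `b` under `s` bounds `s (f z)`.
    refine ⟨y + (freeChain.map (s ≫ (res g'.op).app K)).f _ b, ?_⟩
    refine (freePreChain_d_apply K _ _ _ _).trans ?_
    have e : (freeChain.obj ((sections (op W)).obj K)).d _ n
        (y + (freeChain.map (s ≫ (res g'.op).app K)).f _ b) =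
          (freeChain.map (A.ι ≫ (res (g' ≫ g).op).app K)).f n z := by
      rw [map_add, hy, ← freeChain_map_d, ← hb', ← freeChain_map_comp_apply, Category.assoc,
        Category.assoc, sub_add_cancel, op_comp, res_comp]
    refine e.trans ?_
    rw [freeChain_map_comp_apply]
    rfl
  · replace hy := (freePreChain_d_apply X (op U) _ _ y).symm.trans hy
    obtain ⟨B, _, y, rfl⟩ := exists_finite_support (A := (sections (op U)).obj X) y
    have hy' : (freeChain.obj B).d n ((ComplexShape.down ℕ).next n) y = 0 := by
      apply freeChain_map_injective B.ι
      rw [freeChain_map_d, hy]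
      exact (map_zero _).symm
    refine ⟨_, HasLocalLift.of_mono hf (⊥ : (B : SSet.{max u v}).Subcomplex).ι
      (SSet.Subcomplex.isInitialBot.to _) B.ι (SSet.Subcomplex.isInitialBot.hom_ext _ _), ?_⟩
    rintro V g ⟨s, -, hs⟩
    refine ⟨(freeChain.map s).f n y, ?_, ?_⟩
    · refine (freePreChain_d_apply K _ _ _ _).trans ?_
      rw [← freeChain_map_d, hy']
      exact map_zero _
    · change (freeChain.map ((sections _).map f)).f n _ = (freeChain.map ((res g.op).app X)).f n _
      rw [← freeChain_map_comp_apply, hs, freeChain_map_comp_apply]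

lemma IsLocalAcyclicFibration.quasiIso_freeComplex {K X : SPre C} {f : K ⟶ X}
    (hf : IsLocalAcyclicFibration J f) : QuasiIso ((freeComplex J).map f) := by
  have h : freePreChain ⋙ (presheafToSheaf J AddCommGrpCat.{max u v}).mapHomologicalComplex _ =
      (SimplicialObject.whiskering _ _).obj (freeAbSheaf J) ⋙
        AlgebraicTopology.alternatingFaceMapComplex _ :=
    congrArg (fun G => (SimplicialObject.whiskering _ _).obj ((Functor.whiskeringRight _ _ _).obj
      AddCommGrpCat.free) ⋙ G) (AlgebraicTopology.map_alternatingFaceMapComplex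
        (presheafToSheaf J AddCommGrpCat.{max u v}))
  have := quasiIso_sheafify _ (W_homologyMap_freePreChain hf)
  have : QuasiIso (((SimplicialObject.whiskering _ _).obj (freeAbSheaf J) ⋙
        AlgebraicTopology.alternatingFaceMapComplex _).map f) := by
    rw [← h]
    exact this
  exact (HomologicalComplex.quasiIso_extendMap_iff _ _).2 this

end LocalAcyclicFibration

end CechExt

namespace CechExt

/-! ### Refinements by local acyclic fibrations -/

section Refinement

variable {C : Type u} [Category.{v} C]

/-- The right adjoint of the evaluation in degree `n` of simplicial presheaves. -/
def coevaluation (n : ℕ) : (Cᵒᵖ ⥤ Type (max u v)) ⥤ SPre C where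
  obj T :=
    { obj := fun m =>
        { obj := fun U => (⦋n⦌ ⟶ m.unop) → T.obj U
          map := fun g => TypeCat.ofHom fun a α => T.map g (a α)
          map_id := fun U => by ext a; simp
          map_comp := fun g g' => by ext a; simp }
      map := fun φ => { app := fun U => TypeCat.ofHom fun a α => a (α ≫ φ.unop) } }
  map t := { app := fun m => { app := fun U => TypeCat.ofHom fun a α => t.app U (a α)
                               naturality := fun U V g => by
                                ext a α
                                exact NatTrans.naturality_apply t g (a α) } }

/-- The counit of the adjunction between evaluation and `coevaluation`. -/
def coevaluationCounit (n : ℕ) (T : Cᵒᵖ ⥤ Type (max u v)) :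
    ((coevaluation n).obj T).obj (op ⦋n⦌) ⟶ T where
  app U := TypeCat.ofHom fun a => a (𝟙 _)

/-- The unit of the adjunction between evaluation and `coevaluation`. -/
def coevaluationUnit (n : ℕ) (K : SPre C) :
    K ⟶ (coevaluation n).obj (K.obj (op ⦋n⦌)) where
  app m := { app := fun U => TypeCat.ofHom fun x α => (K.map α.op).app U x
             naturality := fun U V g => by
              ext a
              funext α
              exact NatTrans.naturality_apply (K.map α.op) g _ }
  naturality m m' φ := by
    ext U a
    funext α
    exact (ConcreteCategory.congr_hom (NatTrans.congr_app (K.map_comp φ α.op) U) a).symm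

lemma coevaluationUnit_counit (n : ℕ) (K : SPre C) :
    (coevaluationUnit n K).app _ ≫ coevaluationCounit n _ = 𝟙 _ := by
  ext U a
  exact ConcreteCategory.congr_hom (NatTrans.congr_app (K.map_id (op ⦋n⦌)) U) a

variable {J : GrothendieckTopology C}

/-- By adjunction, a lift consists of preimages under `t` of sections indexed by the `n`-simplices
of `Δ[k]`, prescribed on the boundary. No compatibility links these choices, and there are finitely
many, so they exist over one covering sieve. -/
lemma isLocalAcyclicFibration_coevaluation (n : ℕ) {T T' : Cᵒᵖ ⥤ Type (max u v)} (t : T ⟶ T')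
    [Presheaf.IsLocallySurjective J t] : IsLocalAcyclicFibration J ((coevaluation n).map t) := by
  classical
  intro U k a b hab
  let y (x : (Δ[k] : SSet.{max u v}).obj (op ⦋n⦌)) : T'.obj (op U) := b.app (op ⦋n⦌) x (𝟙 _)
  have hR : (⨅ x, Presheaf.imageSieve t (y x)) ∈ J U := by
    have : Finite ((Δ[k] : SSet.{max u v}).obj (op ⦋n⦌)) := inferInstance
    have := Fintype.ofFinite ((Δ[k] : SSet.{max u v}).obj (op ⦋n⦌))
    rw [← Finset.inf_univ_eq_iInf]
    exact Finset.inf_induction (J.top_mem U) (fun _ h _ h' => J.intersection_covering h h')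
      (fun x _ => Presheaf.imageSieve_mem J t (y x))
  refine ⟨_, hR, fun V g hg => ?_⟩
  have hg' (x) : ∃ s, t.app (op V) s = T'.map g.op (y x) :=
    (iInf_le (fun x => Presheaf.imageSieve t (y x)) x) _ hg
  choose s hs using hg'
  -- On the boundary the preimage is forced by `a`; elsewhere any choice will do.
  let h (x : (Δ[k] : SSet.{max u v}).obj (op ⦋n⦌)) : T.obj (op V) :=
    if hx : x ∈ (∂Δ[k] : SSet.Subcomplex.{max u v} _).obj _ then
      T.map g.op (a.app _ ⟨x, hx⟩ (𝟙 _)) else s x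
  have hh (x) : t.app _ (h x) = T'.map g.op (y x) := by
    dsimp only [h]
    split_ifs with hx
    · rw [NatTrans.naturality_apply]
      congr 1
      exact congrFun (ConcreteCategory.congr_hom (NatTrans.congr_app hab (op ⦋n⦌)) ⟨x, hx⟩) (𝟙 _)
    · exact hs x
  refine ⟨{ app := fun m => TypeCat.ofHom fun x α => h ((Δ[k] : SSet.{max u v}).map α.op x)
            naturality := fun m m' φ => ?_ }, ?_, ?_⟩
  · ext x
    funext α
    exact congrArg h (ConcreteCategory.congr_hom ((Δ[k] : SSet.{max u v}).map_comp φ α.op) x).symm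
  · ext m x
    funext α
    refine (dif_pos (((∂Δ[k] : SSet.Subcomplex.{max u v} _)).map α.op x.2)).trans (congrArg (T.map g.op) ?_)
    refine (congrFun (NatTrans.naturality_apply a α.op x) (𝟙 _)).trans ?_
    exact congrArg (a.app m x) (Category.id_comp α)
  · ext m x
    funext α
    refine (hh _).trans (congrArg (T'.map g.op) ?_)
    refine (congrFun (NatTrans.naturality_apply b α.op x) (𝟙 _)).trans ?_
    exact congrArg (b.app m x) (Category.id_comp α)

/-- `K'` is the base change of `(coevaluation n).map t` along the unit `K ⟶ (coevaluation n).obj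
K_n`: by construction an `n`-simplex of `K'` carries a lift to `T` of its image in `K_n`. -/
lemma exists_refinement (K : SPre C) (n : ℕ) {T : Cᵒᵖ ⥤ Type (max u v)} (t : T ⟶ K.obj (op ⦋n⦌))
    [Presheaf.IsLocallySurjective J t] : ∃ (K' : SPre C) (f : K' ⟶ K)
      (s : K'.obj (op ⦋n⦌) ⟶ T), IsLocalAcyclicFibration J f ∧ s ≫ t = f.app _ := by
  have sq := IsPullback.of_hasPullback ((coevaluation n).map t) (coevaluationUnit n K)
  refine ⟨_, pullback.snd ((coevaluation n).map t) (coevaluationUnit n K),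
    NatTrans.app (pullback.fst ((coevaluation n).map t) (coevaluationUnit n K)) _ ≫ coevaluationCounit n T,
    .of_isPullback sq (isLocalAcyclicFibration_coevaluation n t), ?_⟩
  have h := congrArg (fun φ => NatTrans.app φ (op ⦋n⦌) ≫ coevaluationCounit n _) sq.w
  dsimp at h
  rw [Category.assoc, Category.assoc, coevaluationUnit_counit, Category.comp_id] at h
  rw [← h]
  rfl

end Refinement

/-! ### Projectivity of `ℤK_n` up to refinement -/

section FreeComplex

variable {C : Type u} [Category.{v} C] (J : GrothendieckTopology C)

/-- The adjunction between the free abelian sheaf functor and the forgetful functor. -/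
def freeAbSheafAdjunction : freeAbSheaf J ⊣
    sheafToPresheaf J _ ⋙ (Functor.whiskeringRight _ _ _).obj (forget AddCommGrpCat.{max u v}) :=
  (AddCommGrpCat.adj.whiskerRight Cᵒᵖ).comp (sheafificationAdjunction J _)

/-- The term of degree `-n` of `ℤK`. -/
def freeComplexXIso (K : SPre C) (n : ℕ) :
    ((freeComplex J).obj K).X (-n) ≅ (freeAbSheaf J).obj (K.obj (op ⦋n⦌)) :=
  HomologicalComplex.extendXIso _ _ rfl

lemma freeComplex_map_f {K K' : SPre C} (f : K ⟶ K') (n : ℕ) :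
    ((freeComplex J).map f).f (-n) = (freeComplexXIso J K n).hom ≫ (freeAbSheaf J).map (f.app _) ≫
      (freeComplexXIso J K' n).inv :=
  HomologicalComplex.extendMap_f _ _ _

lemma isZero_freeComplex_X (K : SPre C) (n : ℤ) (hn : 0 < n) : IsZero (((freeComplex J).obj K).X n) :=
  HomologicalComplex.isZero_extend_X _ _ _ (fun i h => by
    have : -(i : ℤ) = n := h
    lia)

variable {J}

/-- By adjunction `b` is a map from `K_n` to the presheaf of sets underlying `B`. Epimorphisms of
sheaves are locally surjective, hence so is the base change of `q` to `K_n`, and `exists_refinement`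
applies to it. -/
lemma exists_lift_freeAbSheaf (K : SPre C) (n : ℕ) {A B : AbSheaf J} (q : A ⟶ B) [Epi q]
    (b : (freeAbSheaf J).obj (K.obj (op ⦋n⦌)) ⟶ B) :
    ∃ (K' : SPre C) (f : K' ⟶ K) (_ : IsLocalAcyclicFibration J f)
      (a : (freeAbSheaf J).obj (K'.obj (op ⦋n⦌)) ⟶ A), a ≫ q = (freeAbSheaf J).map (f.app _) ≫ b := by
  let adj := freeAbSheafAdjunction J
  let G := sheafToPresheaf J _ ⋙ (Functor.whiskeringRight _ _ _).obj (forget AddCommGrpCat.{max u v})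
  have sq := IsPullback.of_hasPullback (G.map q) (adj.homEquiv _ _ b)
  have : Presheaf.IsLocallySurjective J (pullback.snd (G.map q) (adj.homEquiv _ _ b)) := by
    have : Sheaf.IsLocallySurjective q := (Sheaf.isLocallySurjective_iff_epi' _ q).2 inferInstance
    refine ⟨fun {U} s => ?_⟩
    refine J.superset_covering (fun V g => ?_) (Presheaf.imageSieve_mem J q.hom
      ((adj.homEquiv _ _ b).app _ s))
    rintro ⟨t, ht⟩
    obtain ⟨x, -, hx⟩ := Types.exists_of_isPullback (sq.map ((evaluation _ _).obj (op V)))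
      t ((K.obj (op ⦋n⦌)).map g.op s) (ht.trans (NatTrans.naturality_apply (adj.homEquiv _ _ b) g.op s).symm)
    exact ⟨x, hx⟩
  obtain ⟨K', f, s, hf, hs⟩ := exists_refinement (J := J) K n (pullback.snd (G.map q) (adj.homEquiv _ _ b))
  refine ⟨K', f, hf, (adj.homEquiv _ _).symm (s ≫ pullback.fst _ _), ?_⟩
  apply (adj.homEquiv _ _).injective
  rw [adj.homEquiv_naturality_right, adj.homEquiv_naturality_left, Equiv.apply_symm_apply, ← hs,
    Category.assoc, Category.assoc, ← sq.w]

lemma exists_lift_freeComplex (K : SPre C) (n : ℕ) {A B : AbSheaf J} (q : A ⟶ B) [Epi q]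
    (b : ((freeComplex J).obj K).X (-n) ⟶ B) :
    ∃ (K' : SPre C) (f : K' ⟶ K) (_ : IsLocalAcyclicFibration J f)
      (a : ((freeComplex J).obj K').X (-n) ⟶ A), a ≫ q = ((freeComplex J).map f).f (-n) ≫ b := by
  obtain ⟨K', f, hf, a, h⟩ := exists_lift_freeAbSheaf K n q ((freeComplexXIso J K n).inv ≫ b)
  refine ⟨K', f, hf, (freeComplexXIso J K' n).hom ≫ a, ?_⟩
  rw [Category.assoc, h, freeComplex_map_f]
  simp

end FreeComplex

end CechExt

namespace CechExt

/-! ### Cochains on free complexes, up to refinement -/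

section Cochains

open CochainComplex CochainComplex.HomComplex

variable {C : Type u} [Category.{v} C] {J : GrothendieckTopology C}

lemma epi_toCycles {A : Type*} [Category* A] [Abelian A] {Q : CochainComplex A ℤ} {n : ℤ}
    (hQ : Q.ExactAt n) (m : ℤ) (hm : m + 1 = n) : Epi (Q.toCycles m n) := by
  obtain rfl := (ComplexShape.up ℤ).prev_eq' (show (ComplexShape.up ℤ).Rel m n from hm)
  exact hQ.epi_toCycles

open HomotopyCategory in
lemma quasiIso_iff_exactAt_mappingCone {A : Type*} [Category* A] [Abelian A]
    {F G : CochainComplex A ℤ} (φ : F ⟶ G) : QuasiIso φ ↔ ∀ n, (mappingCone φ).ExactAt n := by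
  rw [← quotient_obj_mem_subcategoryAcyclic_iff_exactAt, ← HomologicalComplex.mem_quasiIso_iff,
    ← HomotopyCategory.quotient_map_mem_quasiIso_iff,
    quasiIso_eq_trW_subcategoryAcyclic]
  exact (subcategoryAcyclic A).trW_iff_of_distinguished _ (mappingCone_triangleh_distinguished φ)

/-- The cochain `y` is built one degree at a time, downwards from `0`. If `z - δ y` vanishes above
degree `-m`, its component there takes values in cycles, which are boundaries since `Q` is exact.
After a refinement this component lifts through the differential of `Q`, and the lift is added to
`y`. -/
lemma exists_refinement_v_eq_zero {Q : CochainComplex (AbSheaf J) ℤ} (hQ : ∀ n, Q.ExactAt n)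
    {K : SPre C} {p r : ℤ} (hr : r + 1 = p) (z : Cocycle ((freeComplex J).obj K) Q p) (m : ℕ) :
    ∃ (K' : SPre C) (f : K' ⟶ K) (_ : IsLocalAcyclicFibration J f)
      (y : Cochain ((freeComplex J).obj K') Q r), ∀ (j q : ℤ) (hj : j + p = q), -m < j →
        ((z.precomp ((freeComplex J).map f)).1 - δ r p y).v j q hj = 0 := by
  induction m with
  | zero =>
    exact ⟨K, 𝟙 K, .of_isIso _, 0, fun j q hj h =>
      (isZero_freeComplex_X J K j (by simpa using h)).eq_of_src _ _⟩
  | succ m hm =>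
    obtain ⟨K', f, hf, y, hy⟩ := hm
    let z' : Cochain ((freeComplex J).obj K') Q p := (z.precomp ((freeComplex J).map f)).1 - δ r p y
    have hz' : δ p (p + 1) z' = 0 := by
      simp only [z', δ_sub, Cocycle.δ_eq_zero, δ_δ, sub_zero]
    let c := z'.v (-m) (-m + p) rfl
    -- The cocycle condition has two terms; the other one involves the component in degree `-m + 1`,
    -- already zero.
    have hc : c ≫ Q.d _ (-m + p + 1) = 0 := by
      have h := Cochain.congr_v hz' (-m) (-m + p + 1) (by lia)
      rw [δ_v p (p + 1) rfl z' _ _ _ (-m + p) (-m + 1) (by lia) rfl] at h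
      have h' : z'.v (-m + 1) (-m + p + 1) (by lia) = 0 := hy _ _ _ (by simp)
      simpa [h'] using h
    have := epi_toCycles (hQ (-m + p)) (-m + p - 1) (by lia)
    obtain ⟨K'', g, hg, a, ha⟩ := exists_lift_freeComplex K' m (Q.toCycles (-m + p - 1) (-m + p))
      (Q.liftCycles c (-m + p + 1) (by simp) hc)
    replace ha := congrArg (fun t => t ≫ Q.iCycles _) ha
    simp only [Category.assoc, HomologicalComplex.toCycles_i, HomologicalComplex.liftCycles_i] at ha
    refine ⟨K'', g ≫ f, hg.comp hf, (Cochain.ofHom ((freeComplex J).map g)).comp y (zero_add r) +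
      Cochain.single a r, fun j q hj hjm => ?_⟩
    have e : (z.precomp ((freeComplex J).map (g ≫ f))).1 -
        δ r p ((Cochain.ofHom ((freeComplex J).map g)).comp y (zero_add r) + Cochain.single a r) =
        (Cochain.ofHom ((freeComplex J).map g)).comp z' (zero_add p) - δ r p (Cochain.single a r) := by
      simp [z', Cochain.comp_sub, Functor.map_comp, sub_sub]
    -- The coboundary of the new term lives in degrees `-m` and `-m - 1`: the first part cancels
    -- `c`, the second is below the range considered.
    rw [e, Cochain.δ_single a r p hr (-m - 1) (-m + p) (by lia) (by lia), Cochain.sub_v, Cochain.add_v,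
      Cochain.units_smul_v, Cochain.zero_cochain_comp_v, Cochain.ofHom_v,
      Cochain.single_v_eq_zero (_ ≫ a) _ _ _ _ (by push_cast at hjm; lia), smul_zero, add_zero]
    by_cases h : j = -m
    · subst h
      subst hj
      rw [Cochain.single_v, ha, sub_self]
    · rw [Cochain.single_v_eq_zero _ _ _ _ _ h, hy _ _ _ (by push_cast at hjm; lia), comp_zero,
        sub_zero]

/-- Cocycles with values in a bounded below acyclic complex become coboundaries after
refinement. -/
lemma exists_refinement_δ_eq {Q : CochainComplex (AbSheaf J) ℤ} (hQ : ∀ n, Q.ExactAt n)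
    (N : ℤ) [Q.IsStrictlyGE N] {K : SPre C} {p r : ℤ} (hr : r + 1 = p)
    (z : Cocycle ((freeComplex J).obj K) Q p) :
    ∃ (K' : SPre C) (f : K' ⟶ K) (_ : IsLocalAcyclicFibration J f)
      (y : Cochain ((freeComplex J).obj K') Q r),
        δ r p y = (Cochain.ofHom ((freeComplex J).map f)).comp z.1 (zero_add p) := by
  -- In degrees `j ≤ -((p - N).toNat + 1)` one has `j + p < N`, where `Q` vanishes, so finitely many
  -- refinements suffice.
  obtain ⟨K', f, hf, y, hy⟩ := exists_refinement_v_eq_zero hQ hr z ((p - N).toNat + 1)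
  refine ⟨K', f, hf, y, (sub_eq_zero.1 ?_).symm⟩
  refine Cochain.ext _ _ fun j q hj => ?_
  by_cases h : -(((p - N).toNat + 1 : ℕ) : ℤ) < j
  · exact hy j q hj h
  · exact (Q.isZero_of_isStrictlyGE N q (by push_cast at h; lia)).eq_of_tgt _ _

variable {F G : CochainComplex (AbSheaf J) ℤ} (φ : F ⟶ G) [QuasiIso φ]

/-- A cocycle with values in the target of a quasi-isomorphism comes from its source, after
refinement and up to a coboundary. -/
lemma exists_refinement_postcomp_eq (N : ℤ) [F.IsStrictlyGE N] [G.IsStrictlyGE N]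
    {K : SPre C} {p r : ℤ} (hr : r + 1 = p)
    (z : Cocycle ((freeComplex J).obj K) G p) :
    ∃ (K' : SPre C) (f : K' ⟶ K) (_ : IsLocalAcyclicFibration J f)
      (x : Cocycle ((freeComplex J).obj K') F p) (y : Cochain ((freeComplex J).obj K') G r),
        x.1.comp (Cochain.ofHom φ) (add_zero p) + δ r p y =
          (Cochain.ofHom ((freeComplex J).map f)).comp z.1 (zero_add p) := by
  -- The cone contains `F` shifted by one, so it starts in degree `N - 1`.
  have := isStrictlyGE_mappingCone φ N N (N - 1)
  obtain ⟨K', f, hf, y, hy⟩ := exists_refinement_δ_eq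
    ((quasiIso_iff_exactAt_mappingCone φ).1 inferInstance) (N - 1) hr
    (z.postcomp (mappingCone.inr φ))
  -- A cochain to the cone is a pair: `α` of degree `p` to `F` and `β` of degree `r` to `G`. The
  -- equation for `y` says that `α` is a cocycle whose image under `φ` is the refined `z` up to `δ
  -- β`.
  obtain ⟨α, β, rfl⟩ : ∃ α β, y = mappingCone.liftCochain φ α β hr :=
    ⟨y.comp (mappingCone.fst φ).1 hr, y.comp (mappingCone.snd φ) (add_zero r), by
      simp [mappingCone.ext_cochain_to_iff φ _ _ hr]⟩
  rw [mappingCone.δ_liftCochain _ _ _ _ (p + 1) rfl,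
    mappingCone.ext_cochain_to_iff φ p (p + 1) rfl] at hy
  obtain ⟨h₁, h₂⟩ := hy
  simp at h₁ h₂
  refine ⟨K', f, hf, Cocycle.mk α (p + 1) rfl h₁, β, ?_⟩
  rw [add_comm]
  exact h₂

/-- A cocycle that becomes a coboundary in the target of a quasi-isomorphism is
a coboundary after refinement. -/
lemma exists_refinement_eq_δ (N : ℤ) [F.IsStrictlyGE N] [G.IsStrictlyGE N]
    {K : SPre C} {p r : ℤ} (hr : r + 1 = p)
    (z : Cocycle ((freeComplex J).obj K) F p) (w : Cochain ((freeComplex J).obj K) G r)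
    (hw : δ r p w = z.1.comp (Cochain.ofHom φ) (add_zero p)) :
    ∃ (K' : SPre C) (f : K' ⟶ K) (_ : IsLocalAcyclicFibration J f)
      (y : Cochain ((freeComplex J).obj K') F r),
        δ r p y = (Cochain.ofHom ((freeComplex J).map f)).comp z.1 (zero_add p) := by
  have := isStrictlyGE_mappingCone φ N N (N - 1)
  -- The pair `(-z, w)` is a cocycle of degree `r` with values in the cone; the sign is that of the
  -- differential of the cone. The component to `F` of a cochain bounding it bounds `z`.
  obtain ⟨K', f, hf, y, hy⟩ := exists_refinement_δ_eq
    ((quasiIso_iff_exactAt_mappingCone φ).1 inferInstance) (N - 1)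
    (sub_add_cancel r 1) (mappingCone.liftCocycle φ (-z) w hr (by simp [hw]))
  obtain ⟨α, β, rfl⟩ : ∃ α β, y = mappingCone.liftCochain φ α β (sub_add_cancel r 1) :=
    ⟨y.comp (mappingCone.fst φ).1 (by lia), y.comp (mappingCone.snd φ) (add_zero _), by
      simp [mappingCone.ext_cochain_to_iff φ _ _ (sub_add_cancel r 1)]⟩
  rw [mappingCone.δ_liftCochain _ _ _ _ p hr,
    mappingCone.ext_cochain_to_iff φ r p hr] at hy
  obtain ⟨h₁, h₂⟩ := hy
  simp at h₁ h₂
  exact ⟨K', f, hf, α, h₁⟩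

end Cochains

end CechExt

namespace CechExt

/-! ### Cohomology classes of the complex of homomorphisms -/

section CohomologyClasses

open CochainComplex CochainComplex.HomComplex

variable {A : Type u} [Category.{v} A] [Preadditive A]

/-- The map on cocycles induced by `f : K' ⟶ K` and `g : L ⟶ L'`. -/
def cocycleMap {K K' L L' : CochainComplex A ℤ} (f : K' ⟶ K) (g : L ⟶ L') (n : ℤ) :
    Cocycle K L n →+ Cocycle K' L' n where
  toFun z := (z.postcomp g).precomp f
  map_zero' := by ext; simp
  map_add' := by intros; ext; simp

lemma δ_cochainMap {K K' L L' : CochainComplex A ℤ} (f : K' ⟶ K) (g : L ⟶ L') (n m : ℤ)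
    (z : Cochain K L n) : δ n m (cochainMap f g n z) = cochainMap f g m (δ n m z) := by
  simp [cochainMap]

/-- The class of a cocycle in the cohomology of `Tot Hom(K, L)`. -/
def homClass {K L : CochainComplex A ℤ} {n : ℤ} (z : Cocycle K L n) : (HomComplex K L).homology n :=
  (homologyAddEquiv K L n).symm (CohomologyClass.mk z)

section

variable {K L : CochainComplex A ℤ} {n : ℤ}

lemma homClass_surjective (x : (HomComplex K L).homology n) : ∃ z : Cocycle K L n, homClass z = x := by
  obtain ⟨z, hz⟩ := (homologyAddEquiv K L n x).mk_surjective
  exact ⟨z, by rw [homClass, hz, AddEquiv.symm_apply_apply]⟩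

lemma homClass_sub (z z' : Cocycle K L n) : homClass (z - z') = homClass z - homClass z' := by
  simp [homClass]

lemma homClass_eq_zero_iff (z : Cocycle K L n) (m : ℤ) (hm : m + 1 = n) :
    homClass z = 0 ↔ ∃ y : Cochain K L m, δ m n y = z.1 := by
  rw [homClass, EmbeddingLike.map_eq_zero_iff, CohomologyClass.mk_eq_zero_iff, mem_coboundaries_iff _ _ hm]

lemma homClass_eq_iff (z z' : Cocycle K L n) (m : ℤ) (hm : m + 1 = n) :
    homClass z = homClass z' ↔ ∃ y : Cochain K L m, z'.1 + δ m n y = z.1 := by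
  rw [← sub_eq_zero, ← homClass_sub, homClass_eq_zero_iff _ m hm]
  exact exists_congr fun y => by
    rw [add_comm, ← eq_sub_iff_add_eq]
    rfl

end

/-- This formula allows every later computation in homology to be made on representing cocycles. -/
lemma homologyMap_totHomMap_homClass {K K' L L' : CochainComplex A ℤ} (f : K' ⟶ K) (g : L ⟶ L') (n : ℤ)
    (z : Cocycle K L n) :
    HomologicalComplex.homologyMap (totHomMap f g) n (homClass z) = homClass (cocycleMap f g n z) := by
  let γ : ShortComplex.LeftHomologyMapData
      ((HomologicalComplex.shortComplexFunctor _ _ n).map (totHomMap f g))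
      (leftHomologyData K L n) (leftHomologyData K' L' n) :=
    { φK := AddCommGrpCat.ofHom (cocycleMap f g n)
      φH := AddCommGrpCat.ofHom (CohomologyClass.descAddMonoidHom
        ((CohomologyClass.mkAddMonoidHom K' L' n).comp (cocycleMap f g n)) (by
          rintro z hz
          rw [mem_coboundaries_iff _ (n - 1) (by lia)] at hz
          obtain ⟨y, hy⟩ := hz
          refine (CohomologyClass.mk_eq_zero_iff _).2 ?_
          rw [mem_coboundaries_iff _ (n - 1) (by lia)]
          exact ⟨cochainMap f g _ y, by rw [δ_cochainMap, hy]; rfl⟩))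
      commi := rfl
      commf' := by
        rw [← cancel_mono (leftHomologyData K' L' n).i, Category.assoc,
          ShortComplex.LeftHomologyData.f'_i]
        refine (Category.assoc _ _ _).trans
          (((leftHomologyData K L n).f'_i_assoc ((HomologicalComplex.shortComplexFunctor _ _ n).map
            (totHomMap f g)).τ₂).trans ?_)
        exact ((HomologicalComplex.shortComplexFunctor _ _ n).map (totHomMap f g)).comm₁₂.symm
      commπ := rfl }
  have h := γ.homologyMap_eq
  have h' : (leftHomologyData K L n).homologyIso.hom (homClass z) = CohomologyClass.mk z :=
    (homologyAddEquiv K L n).apply_symm_apply _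
  refine (ConcreteCategory.congr_hom h (homClass z)).trans ?_
  change (leftHomologyData K' L' n).homologyIso.inv (γ.φH ((leftHomologyData K L n).homologyIso.hom (homClass z))) = _
  rw [h']
  rfl

lemma quasiIso_of_bijective {K L : CochainComplex AddCommGrpCat.{w} ℤ} (φ : K ⟶ L)
    (h : ∀ n, Function.Bijective (HomologicalComplex.homologyMap φ n)) : QuasiIso φ where
  quasiIsoAt n := by
    rw [quasiIsoAt_iff_isIso_homologyMap]
    exact (ConcreteCategory.isIso_iff_bijective _).2 (h n)

end CohomologyClasses

/-! ### Cochains with values in K-injective complexes -/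

section KInjective

open CochainComplex CochainComplex.HomComplex

variable {A : Type u} [Category.{v} A] [Abelian A] {T Q L : CochainComplex A ℤ} (φ : T ⟶ Q)
  [QuasiIso φ] [L.IsKInjective]

/-- The cone of `φ` is acyclic, so the cocycle on it given by `z` on the shifted copy of `T` bounds
some `w`. Up to sign, the restriction of `w` to `Q` is the cocycle `x` and its restriction to `T` is
the correction `y`. -/
lemma exists_precomp_eq {n m : ℤ} (hm : m + 1 = n) (z : Cocycle T L n) :
    ∃ (x : Cocycle Q L n) (y : Cochain T L m),
      (Cochain.ofHom φ).comp x.1 (zero_add n) = z.1 + δ m n y := by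
  obtain ⟨w, hw⟩ := IsKInjective.eq_δ_of_cocycle (L := L)
    (Cocycle.mk ((mappingCone.fst φ).1.comp z.1 rfl) (1 + n + 1) rfl (by
      rw [δ_comp _ _ _ 2 (n + 1) _ rfl rfl rfl]
      simp)) ((quasiIso_iff_exactAt_mappingCone φ).1 inferInstance) n (by lia)
  obtain ⟨α, β, rfl⟩ : ∃ α β, w = mappingCone.descCochain φ α β (show m + 1 = n from hm) :=
    ⟨(mappingCone.inl φ).comp w (by lia), (Cochain.ofHom (mappingCone.inr φ)).comp w (zero_add n), by
      simp [mappingCone.ext_cochain_from_iff φ m n hm]⟩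
  rw [mappingCone.δ_descCochain φ α β hm (1 + n) (by lia),
    mappingCone.ext_cochain_from_iff φ n (1 + n) (by lia)] at hw
  obtain ⟨h₁, h₂⟩ := hw
  simp at h₁ h₂
  refine ⟨Cocycle.mk ((1 + n).negOnePow • β) (1 + n) (by lia) (by simp [h₂]), -α, ?_⟩
  simp [← h₁]

/-- By `hy`, the cochains `y` and `z` form, up to sign, a cocycle on the acyclic cone of `φ`. It is
a coboundary, and a cochain bounding it restricts to `Q` as required. -/
lemma exists_eq_δ_of_precomp {n m : ℤ} (hm : m + 1 = n) (z : Cocycle Q L n) (y : Cochain T L m)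
    (hy : δ m n y = (Cochain.ofHom φ).comp z.1 (zero_add n)) : ∃ w : Cochain Q L m, δ m n w = z.1 := by
  obtain ⟨w, hw⟩ := IsKInjective.eq_δ_of_cocycle (L := L)
    (Cocycle.mk (mappingCone.descCochain φ (n := n) ((n + 1).negOnePow • -y) z.1 hm) (n + 1) rfl (by
      rw [mappingCone.δ_descCochain _ _ _ _ _ rfl]
      simp [hy])) ((quasiIso_iff_exactAt_mappingCone φ).1 inferInstance) m hm
  refine ⟨(Cochain.ofHom (mappingCone.inr φ)).comp w (zero_add m), ?_⟩
  rw [δ_ofHom_comp, hw]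
  simp

lemma quasiIso_totHomMap_of_isKInjective : QuasiIso (totHomMap φ (𝟙 L)) := by
  refine quasiIso_of_bijective _ fun n => ⟨?_, fun x => ?_⟩
  · rw [injective_iff_map_eq_zero]
    intro x hx
    obtain ⟨z, rfl⟩ := homClass_surjective x
    rw [homologyMap_totHomMap_homClass, homClass_eq_zero_iff _ (n - 1) (by lia)] at hx
    obtain ⟨y, hy⟩ := hx
    rw [homClass_eq_zero_iff _ (n - 1) (by lia)]
    exact exists_eq_δ_of_precomp φ (by lia) z y (hy.trans (by simp [cocycleMap]))
  · obtain ⟨z, rfl⟩ := homClass_surjective x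
    obtain ⟨x, y, h⟩ := exists_precomp_eq φ (show n - 1 + 1 = n by lia) z
    refine ⟨homClass x, ?_⟩
    rw [homologyMap_totHomMap_homClass, homClass_eq_iff _ _ (n - 1) (by lia)]
    exact ⟨y, by simp [cocycleMap, h]⟩

end KInjective

end CechExt

namespace CechExt

/-! ### Quasi-isomorphisms of short exact sequences of complexes -/

section ShortExact

open HomologicalComplex HomologicalComplex.HomologySequence ComposableArrows

variable {A : Type u} [Category.{v} A] [Abelian A] {S₁ S₂ : ShortComplex (CochainComplex A ℤ)}
  (φ : S₁ ⟶ S₂)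

/-- The five lemma in the long exact homology sequence, obtained from the two four lemmas. -/
lemma quasiIso_τ₂ (hS₁ : S₁.ShortExact) (hS₂ : S₂.ShortExact)
    (h₁ : QuasiIso φ.τ₁) (h₃ : QuasiIso φ.τ₃) : QuasiIso φ.τ₂ where
  quasiIsoAt i := by
    rw [quasiIsoAt_iff_isIso_homologyMap]
    have hi : (ComplexShape.up ℤ).Rel (i - 1) i := by simp
    have hi' : (ComplexShape.up ℤ).Rel i (i + 1) := by simp
    have : Mono (homologyMap φ.τ₂ i) := by
      apply Abelian.mono_of_epi_of_mono_of_mono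
        ((δ₀Functor ⋙ δ₀Functor).map (mapComposableArrows₅ φ hS₁ hS₂ _ _ hi))
      · exact (composableArrows₅_exact hS₁ _ _ hi).δ₀.δ₀
      · exact (composableArrows₅_exact hS₂ _ _ hi).δ₀.δ₀
      · exact inferInstanceAs (Epi (homologyMap φ.τ₃ (i - 1)))
      · exact inferInstanceAs (Mono (homologyMap φ.τ₁ i))
      · exact inferInstanceAs (Mono (homologyMap φ.τ₃ i))
    have : Epi (homologyMap φ.τ₂ i) := by
      apply Abelian.epi_of_epi_of_epi_of_mono
        ((δlastFunctor ⋙ δlastFunctor).map (mapComposableArrows₅ φ hS₁ hS₂ _ _ hi'))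
      · exact (composableArrows₅_exact hS₁ _ _ hi').δlast.δlast
      · exact (composableArrows₅_exact hS₂ _ _ hi').δlast.δlast
      · exact inferInstanceAs (Epi (homologyMap φ.τ₁ i))
      · exact inferInstanceAs (Epi (homologyMap φ.τ₃ i))
      · exact inferInstanceAs (Mono (homologyMap φ.τ₁ (i + 1)))
    exact isIso_of_mono_of_epi _

lemma quasiIso_τ₁ (hS₁ : S₁.ShortExact) (hS₂ : S₂.ShortExact)
    (h₂ : QuasiIso φ.τ₂) (h₃ : QuasiIso φ.τ₃) : QuasiIso φ.τ₁ where
  quasiIsoAt i := by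
    rw [quasiIsoAt_iff_isIso_homologyMap]
    have hi : (ComplexShape.up ℤ).Rel (i - 1) i := by simp
    have : Mono (homologyMap φ.τ₁ i) := by
      apply Abelian.mono_of_epi_of_mono_of_mono
        ((δ₀Functor ⋙ δlastFunctor).map (mapComposableArrows₅ φ hS₁ hS₂ _ _ hi))
      · exact (composableArrows₅_exact hS₁ _ _ hi).δ₀.δlast
      · exact (composableArrows₅_exact hS₂ _ _ hi).δ₀.δlast
      · exact inferInstanceAs (Epi (homologyMap φ.τ₂ (i - 1)))
      · exact inferInstanceAs (Mono (homologyMap φ.τ₃ (i - 1)))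
      · exact inferInstanceAs (Mono (homologyMap φ.τ₂ i))
    have : Epi (homologyMap φ.τ₁ i) := by
      apply Abelian.epi_of_epi_of_epi_of_mono
        ((δ₀Functor ⋙ δ₀Functor).map (mapComposableArrows₅ φ hS₁ hS₂ _ _ hi))
      · exact (composableArrows₅_exact hS₁ _ _ hi).δ₀.δ₀
      · exact (composableArrows₅_exact hS₂ _ _ hi).δ₀.δ₀
      · exact inferInstanceAs (Epi (homologyMap φ.τ₃ (i - 1)))
      · exact inferInstanceAs (Epi (homologyMap φ.τ₂ i))
      · exact inferInstanceAs (Mono (homologyMap φ.τ₃ i))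
    exact isIso_of_mono_of_epi _

end ShortExact

/-! ### Extensions of complexes -/

section Extensions

open CochainComplex CochainComplex.HomComplex Preadditive

variable {A : Type u} [Category.{v} A] [Abelian A]

section

variable {K L M : CochainComplex A ℤ} (e : Cocycle K L 1)

/-- The extension of `K` by `L` given by a cocycle of degree `1`. -/
def twistedSum : CochainComplex A ℤ where
  X m := K.X m ⊞ L.X m
  d i j := biprod.desc (biprod.lift (K.d i j) (if h : i + 1 = j then e.1.v i j h else 0))
    (biprod.lift 0 (L.d i j))
  shape i j hij := by
    have hij' : ¬ i + 1 = j := hij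
    ext <;> simp [K.shape i j hij, L.shape i j hij, dif_neg hij']
  d_comp_d' i j k hij hjk := by
    have hij' : i + 1 = j := hij
    have hjk' : j + 1 = k := hjk
    -- The off-diagonal entry of the squared differential is the coboundary of `e`.
    have h := Cochain.congr_v (e.δ_eq_zero 2) i k (by lia)
    rw [δ_v 1 2 rfl _ i k (by lia) j j (by lia) hij'] at h
    have h' : K.d i j ≫ e.1.v j k hjk' + e.1.v i j hij' ≫ L.d j k = 0 := by
      rw [add_comm]
      simpa [Int.negOnePow_even 2 (by decide)] using h
    ext <;> simp [h', dif_pos hij', dif_pos hjk']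

/-- The inclusion of the first summand of the extension given by a cocycle. -/
def twistedSumInl (m : ℤ) : K.X m ⟶ (twistedSum e).X m := biprod.inl

/-- The projection on the second summand of the extension given by a cocycle. -/
def twistedSumSnd (m : ℤ) : (twistedSum e).X m ⟶ L.X m := biprod.snd

/-- The inclusion of `L` in the extension of `K` by `L` given by a cocycle. -/
def twistedSumInr : L ⟶ twistedSum e where
  f m := biprod.inr
  comm' i j _ := by
    change biprod.inr ≫ biprod.desc _ _ = _ ≫ (biprod.inr : L.X j ⟶ K.X j ⊞ L.X j)
    ext <;> simp

/-- The projection to `K` of the extension of `K` by `L` given by a cocycle. -/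
def twistedSumFst : twistedSum e ⟶ K where
  f m := biprod.fst
  comm' i j _ := by
    change (biprod.fst : K.X i ⊞ L.X i ⟶ K.X i) ≫ _ = biprod.desc _ _ ≫ biprod.fst
    ext <;> simp

@[simp]
lemma twistedSumInl_fst (m : ℤ) : twistedSumInl e m ≫ (twistedSumFst e).f m = 𝟙 _ := biprod.inl_fst

@[simp]
lemma twistedSumInl_snd (m : ℤ) : twistedSumInl e m ≫ twistedSumSnd e m = 0 := biprod.inl_snd

@[simp]
lemma twistedSumInr_fst_f (m : ℤ) : (twistedSumInr e).f m ≫ (twistedSumFst e).f m = 0 := biprod.inr_fst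

@[simp]
lemma twistedSumInr_snd (m : ℤ) : (twistedSumInr e).f m ≫ twistedSumSnd e m = 𝟙 _ := biprod.inr_snd

lemma twistedSumInr_fst : twistedSumInr e ≫ twistedSumFst e = 0 := by
  ext m
  simp

lemma twistedSum_total (m : ℤ) : (twistedSumFst e).f m ≫ twistedSumInl e m +
    twistedSumSnd e m ≫ (twistedSumInr e).f m = 𝟙 _ := biprod.total

lemma twistedSum_hom_ext {X : A} {m : ℤ} {f g : X ⟶ (twistedSum e).X m}
    (h₁ : f ≫ (twistedSumFst e).f m = g ≫ (twistedSumFst e).f m)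
    (h₂ : f ≫ twistedSumSnd e m = g ≫ twistedSumSnd e m) : f = g :=
  biprod.hom_ext _ _ h₁ h₂

lemma twistedSum_d_snd (i j : ℤ) (h : i + 1 = j) : (twistedSum e).d i j ≫ twistedSumSnd e j =
    (twistedSumFst e).f i ≫ e.1.v i j h + twistedSumSnd e i ≫ L.d i j := by
  change biprod.desc _ _ ≫ biprod.snd =
    (biprod.fst : K.X i ⊞ L.X i ⟶ K.X i) ≫ _ + (biprod.snd : K.X i ⊞ L.X i ⟶ L.X i) ≫ _
  rw [dif_pos h]
  ext
  · refine Eq.trans ?_ (comp_add _ _ _ _ _ _).symm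
    simp
  · refine Eq.trans ?_ (comp_add _ _ _ _ _ _).symm
    simp

/-- Lifting `a` to the extension means trivializing the pullback of its class along `a`: the
components of a lift to `L` form a cochain with coboundary `-(a ≫ e)`. -/
lemma exists_twistedSum_lift (a : M ⟶ K) (b : Cochain M L 0)
    (h : δ 0 1 b = -(Cochain.ofHom a).comp e.1 (zero_add 1)) :
    ∃ c : M ⟶ twistedSum e, c ≫ twistedSumFst e = a ∧
      ∀ m, c.f m ≫ twistedSumSnd e m = b.v m m (add_zero m) := by
  let c (m : ℤ) : M.X m ⟶ (twistedSum e).X m := a.f m ≫ twistedSumInl e m +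
    b.v m m (add_zero m) ≫ (twistedSumInr e).f m
  have hc₁ (m : ℤ) : c m ≫ (twistedSumFst e).f m = a.f m := by simp [c]
  have hc₂ (m : ℤ) : c m ≫ twistedSumSnd e m = b.v m m (add_zero m) := by simp [c]
  refine ⟨{ f := c, comm' := fun i j hij => ?_ }, by ext m; exact hc₁ m, hc₂⟩
  have hij' : i + 1 = j := hij
  have h' := Cochain.congr_v h i j hij'
  rw [δ_v 0 1 rfl _ i j hij' i j (by lia) hij'] at h'
  apply twistedSum_hom_ext
  · rw [Category.assoc, Category.assoc, ← (twistedSumFst e).comm, hc₁, reassoc_of% (hc₁ i), a.comm]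
  · rw [Category.assoc, Category.assoc, twistedSum_d_snd e i j hij', hc₂, comp_add,
      reassoc_of% (hc₁ i), reassoc_of% (hc₂ i), ← sub_eq_zero]
    simp at h'
    rw [← sub_eq_zero] at h'
    rw [← h']
    abel

lemma shortExact_twistedSum : (ShortComplex.mk _ _ (twistedSumInr_fst e)).ShortExact :=
  HomologicalComplex.shortExact_of_degreewise_shortExact _ fun m =>
    ShortComplex.Splitting.shortExact
      { r := twistedSumSnd e m
        s := twistedSumInl e m
        f_r := twistedSumInr_snd e m
        s_g := twistedSumInl_fst e m
        id := (add_comm _ _).trans (twistedSum_total e m) }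

end

/-- A morphism of extensions of complexes that is a quasi-isomorphism and has given components
on the subobject and on the quotient. -/
lemma exists_extension {S : ShortComplex (CochainComplex A ℤ)} (hS : S.ShortExact)
    {Q J : CochainComplex A ℤ} (q : S.X₃ ⟶ Q) [QuasiIso q] (j : S.X₁ ⟶ J) [QuasiIso j]
    [∀ n, Injective (J.X n)] [J.IsKInjective] :
    ∃ (Q' : CochainComplex A ℤ) (a : S.X₂ ⟶ Q') (ι : J ⟶ Q') (π : Q' ⟶ Q) (w : ι ≫ π = 0),
      QuasiIso a ∧ a ≫ π = S.g ≫ q ∧ (ShortComplex.mk ι π w).ShortExact := by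
  have hS' (n : ℤ) := hS.map_of_exact (HomologicalComplex.eval A _ n)
  have (n : ℤ) : Mono (S.f.f n) := (hS' n).mono_f
  have (n : ℤ) : Epi (S.g.f n) := (hS' n).epi_g
  have (n : ℤ) : Epi (S.map (HomologicalComplex.eval A (ComplexShape.up ℤ) n)).g := (hS' n).epi_g
  -- Injectivity extends `j` to `S.X₂` degree by degree, not compatibly with differentials. The
  -- defect `δ b` vanishes on `S.X₁`, hence descends to a cocycle `e₀` on `S.X₃`.
  let b : Cochain S.X₂ J 0 := Cochain.ofHoms (fun p => Injective.factorThru (j.f p) (S.f.f p))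
  have hb : (Cochain.ofHom S.f).comp b (zero_add 0) = Cochain.ofHom j := by
    ext p
    simp [b]
  have hδb : (Cochain.ofHom S.f).comp (δ 0 1 b) (zero_add 1) = 0 := by
    rw [← δ_ofHom_comp, hb, δ_ofHom]
  have hv (p q : ℤ) (h : p + 1 = q) : S.f.f p ≫ (δ 0 1 b).v p q h = 0 := by
    simpa using Cochain.congr_v hδb p q h
  let e₀ : Cochain S.X₃ J 1 := Cochain.mk fun p q h => (hS' p).exact.desc _ (hv p q h)
  have he₀ : (Cochain.ofHom S.g).comp e₀ (zero_add 1) = δ 0 1 b := by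
    ext p q h
    rw [Cochain.zero_cochain_comp_v, Cochain.ofHom_v]
    exact (hS' p).exact.g_desc _ (hv p q h)
  have hδe₀ : δ 1 2 e₀ = 0 := by
    ext p q h
    rw [← cancel_epi (S.g.f p)]
    have h' : (Cochain.ofHom S.g).comp (δ 1 2 e₀) (zero_add 2) = 0 := by
      rw [← δ_ofHom_comp, he₀, δ_δ]
    simpa using Cochain.congr_v h' p q h
  -- As `q` is a quasi-isomorphism and `J` is K-injective, `-e₀` comes, up to `δ y`, from a cocycle
  -- `x` on `Q`; it defines the extension.
  obtain ⟨x, y, hxy⟩ := exists_precomp_eq (m := 0) q (zero_add 1) (-(Cocycle.mk e₀ 2 rfl hδe₀))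
  replace hxy : (Cochain.ofHom q).comp x.1 (zero_add 1) = -e₀ + δ 0 1 y := hxy
  -- Subtracting the pullback of `y` from `b` absorbs the coboundary in `hxy`.
  obtain ⟨a, ha, ha'⟩ := exists_twistedSum_lift x (S.g ≫ q)
    (b - (Cochain.ofHom S.g).comp y (zero_add 0)) (by
      rw [Cochain.ofHom_comp, Cochain.comp_assoc_of_first_is_zero_cochain, hxy, δ_sub, δ_ofHom_comp, ← he₀]
      simp only [Cochain.comp_add, Cochain.comp_neg]
      abel)
  have hj : S.f ≫ a = j ≫ twistedSumInr x := by
    ext p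
    apply twistedSum_hom_ext
    · have h₀ : S.f.f p ≫ S.g.f p = 0 := HomologicalComplex.congr_hom S.zero p
      have h₁ := HomologicalComplex.congr_hom ha p
      simp only [HomologicalComplex.comp_f] at h₁
      simp [h₁, reassoc_of% h₀]
    · have h₀ : S.f.f p ≫ S.g.f p = 0 := HomologicalComplex.congr_hom S.zero p
      simp [ha', b, reassoc_of% h₀]
  refine ⟨twistedSum x, a, twistedSumInr x, twistedSumFst x, twistedSumInr_fst x, ?_, ha,
    shortExact_twistedSum x⟩
  let ψ : S ⟶ ShortComplex.mk _ _ (twistedSumInr_fst x) :=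
    { τ₁ := j
      τ₂ := a
      τ₃ := q
      comm₁₂ := hj.symm
      comm₂₃ := ha }
  exact quasiIso_τ₂ ψ hS (shortExact_twistedSum x)
    (inferInstanceAs (QuasiIso j)) (inferInstanceAs (QuasiIso q))

end Extensions

end CechExt

namespace CechExt

/-! ### Filtered injective resolutions of the filtration bête -/

section Resolution

open scoped ZeroObject

variable {A : Type u} [Category.{v} A] [Abelian A] (F : CochainComplex A ℤ)

lemma sigmaGEMap_ι {n n' : ℤ} (h : n ≤ n') : sigmaGEMap F h ≫ sigmaGEι F n = sigmaGEι F n' :=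
  ((bete F).ι.naturality (homOfLE h).op).trans (Category.comp_id _)

instance (n : ℤ) : Mono (sigmaGEι F n) := (bete F).mono_ι (op n)

lemma isIso_sigmaGEι_f {n m : ℤ} (h : n ≤ m) : IsIso ((sigmaGEι F n).f m) := by
  have : (sigmaGEι F n).f m = (sigmaGEXIso F h).hom := by simp [sigmaGEι, dif_pos h]
  rw [this]
  infer_instance

/-- The quotient of `F` by `σ_{≥ n} F`. -/
abbrev sigmaLT (n : ℤ) : CochainComplex A ℤ := cokernel (sigmaGEι F n)

lemma shortExact_sigmaGE (n : ℤ) :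
    (ShortComplex.mk (sigmaGEι F n) (cokernel.π _) (cokernel.condition _)).ShortExact where
  exact := ShortComplex.exact_cokernel _
  mono_f := inferInstanceAs (Mono (sigmaGEι F n))
  epi_g := inferInstanceAs (Epi (cokernel.π _))

lemma isIso_sigmaLT_π_f {n m : ℤ} (h : m < n) : IsIso ((cokernel.π (sigmaGEι F n)).f m) := by
  have hS := (shortExact_sigmaGE F n).map_of_exact (HomologicalComplex.eval A _ m)
  exact (hS.isIso_g_iff).2 (isZero_sigmaGE_X F (by lia))

lemma isZero_sigmaLT_X {n m : ℤ} (h : n ≤ m ∨ IsZero (F.X m)) : IsZero ((sigmaLT F n).X m) := by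
  have hS := (shortExact_sigmaGE F n).map_of_exact (HomologicalComplex.eval A _ m)
  obtain h | h := h
  · exact hS.isIso_f_iff.1 (isIso_sigmaGEι_f F h)
  · have : Epi ((cokernel.π (sigmaGEι F n)).f m) := hS.epi_g
    exact h.of_epi ((cokernel.π (sigmaGEι F n)).f m)

/-- The projection between the quotients of `F` by the complexes `σ_{≥ n} F`. -/
def sigmaLTMap {n n' : ℤ} (h : n ≤ n') : sigmaLT F n' ⟶ sigmaLT F n :=
  cokernel.desc _ (cokernel.π _) (by rw [← sigmaGEMap_ι F h, Category.assoc, cokernel.condition, comp_zero])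

@[simp]
lemma π_sigmaLTMap {n n' : ℤ} (h : n ≤ n') :
    cokernel.π (sigmaGEι F n') ≫ sigmaLTMap F h = cokernel.π (sigmaGEι F n) :=
  cokernel.π_desc _ _ _

instance {n n' : ℤ} (h : n ≤ n') : Epi (sigmaLTMap F h) :=
  epi_of_epi_fac (π_sigmaLTMap F h)

/-- Injective resolutions of these kernels can therefore start in degree `n`, which makes the tower
eventually constant in each degree. -/
lemma isZero_kernel_sigmaLTMap_X {n n' : ℤ} (h : n ≤ n') {m : ℤ} (hm : m < n) :
    IsZero ((kernel (sigmaLTMap F h)).X m) := by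
  have hS : (ShortComplex.mk (kernel.ι (sigmaLTMap F h)) _ (kernel.condition _)).ShortExact :=
    { exact := ShortComplex.exact_kernel _
      mono_f := inferInstanceAs (Mono (kernel.ι _))
      epi_g := inferInstanceAs (Epi (sigmaLTMap F h)) }
  refine (hS.map_of_exact (HomologicalComplex.eval A _ m)).isIso_g_iff.1 ?_
  exact @IsIso.of_isIso_fac_left _ _ _ _ _ _ _ _ (isIso_sigmaLT_π_f F (hm.trans_le h))
    (isIso_sigmaLT_π_f F hm) (HomologicalComplex.congr_hom (π_sigmaLTMap F h) m)

/-- A tower of quasi-isomorphisms `F / σ_{≥ N + k} F ⟶ Q k` such that the kernels of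
`Q (k + 1) ⟶ Q k` are complexes of injective objects in degrees `≥ N + k`. -/
structure InjectiveTower (N : ℤ) where
  Q : ℕᵒᵖ ⥤ CochainComplex A ℤ
  a (k : ℕ) : sigmaLT F (N + k) ⟶ Q.obj (op k)
  quasiIso (k : ℕ) : QuasiIso (a k)
  isZero : IsZero (Q.obj (op 0))
  comm (k : ℕ) : a (k + 1) ≫ Q.map (homOfLE (Nat.le_add_right k 1)).op =
    sigmaLTMap F (by simp) ≫ a k
  J : ℕ → CochainComplex A ℤ
  ι (k : ℕ) : J k ⟶ Q.obj (op (k + 1))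
  w (k : ℕ) : ι k ≫ Q.map (homOfLE (Nat.le_add_right k 1)).op = 0
  shortExact (k : ℕ) : (ShortComplex.mk _ _ (w k)).ShortExact
  injective (k : ℕ) (m : ℤ) : Injective ((J k).X m)
  isStrictlyGE (k : ℕ) : (J k).IsStrictlyGE (N + k)

/-- Recursion from the zero complex, which resolves `F / σ_{≥ N} F = 0`. The next quotient is an
extension of the current one by a kernel living in degrees `≥ N + k`; an injective resolution of
this kernel is spliced to the current stage by `exists_extension`. -/
lemma nonempty_injectiveTower [EnoughInjectives A] (N : ℤ) [F.IsStrictlyGE N] :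
    Nonempty (InjectiveTower F N) := by
  let Stage (k : ℕ) := { p : Σ Q, (sigmaLT F (N + k) ⟶ Q) // QuasiIso p.2 }
  have next (k : ℕ) (s : Stage k) : ∃ (s' : Stage (k + 1)) (π : s'.1.1 ⟶ s.1.1)
      (_ : s'.1.2 ≫ π = sigmaLTMap F (by simp) ≫ s.1.2) (J : CochainComplex A ℤ) (ι : J ⟶ s'.1.1)
      (w : ι ≫ π = 0), (ShortComplex.mk _ _ w).ShortExact ∧ (∀ m, Injective (J.X m)) ∧
        J.IsStrictlyGE (N + k) := by
    obtain ⟨⟨Q, a⟩, ha⟩ := s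
    have hle : N + (k : ℤ) ≤ N + ((k + 1 : ℕ) : ℤ) := by simp
    have : (kernel (sigmaLTMap F hle)).IsStrictlyGE (N + k) := by
      rw [CochainComplex.isStrictlyGE_iff]
      exact fun m hm => isZero_kernel_sigmaLTMap_X F hle hm
    have hS : (ShortComplex.mk (kernel.ι (sigmaLTMap F hle)) _ (kernel.condition _)).ShortExact :=
      { exact := ShortComplex.exact_kernel _
        mono_f := inferInstanceAs (Mono (kernel.ι _))
        epi_g := inferInstanceAs (Epi (sigmaLTMap F hle)) }
    obtain ⟨J, j, hj, hJ, hJ'⟩ :=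
      CochainComplex.Plus.modelCategoryQuillen.exists_quasiIso_injective (kernel (sigmaLTMap F hle)) (N + k)
    have := CochainComplex.isKInjective_of_injective J (N + k)
    obtain ⟨Q', a', ι, π, w, ha', h, hS'⟩ := exists_extension hS a j
    exact ⟨⟨⟨Q', a'⟩, ha'⟩, π, h, J, ι, w, hS', hJ, hJ'⟩
  choose s' π h J ι w hw hJ hJ' using next
  have h₀ : QuasiIso (0 : sigmaLT F (N + (0 : ℕ)) ⟶ 0) := by
    have : IsZero (sigmaLT F (N + (0 : ℕ))) := by
      rw [IsZero.iff_id_eq_zero]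
      ext m
      refine (isZero_sigmaLT_X F ?_).eq_of_src _ _
      by_cases hm : N ≤ m
      · exact Or.inl (by simpa using hm)
      · exact Or.inr (F.isZero_of_isStrictlyGE N m (by lia))
    have : IsIso (0 : sigmaLT F (N + (0 : ℕ)) ⟶ 0) :=
      ⟨0, this.eq_of_src _ _, (isZero_zero _).eq_of_src _ _⟩
    infer_instance
  let s (k : ℕ) : Stage k := Nat.rec ⟨⟨0, 0⟩, h₀⟩ s' k
  let Q : ℕ → CochainComplex A ℤ := fun k => (s k).1.1
  let q (k : ℕ) : Q (k + 1) ⟶ Q k := π k (s k)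
  have key (k : ℕ) : (Functor.ofOpSequence q).map (homOfLE (Nat.le_add_right k 1)).op = q k :=
    Functor.ofOpSequence_map_homOfLE_succ _ _
  have shortExact_congr {X₁ X₂ X₃ : CochainComplex A ℤ} {f : X₁ ⟶ X₂} {g g' : X₂ ⟶ X₃}
      (h : g' = g) (w : f ≫ g = 0) (w' : f ≫ g' = 0) (hS : (ShortComplex.mk f g w).ShortExact) :
      (ShortComplex.mk f g' w').ShortExact := by
    subst h
    exact hS
  have w' (k : ℕ) : (show J k (s k) ⟶ Q (k + 1) from ι k (s k)) ≫
      (Functor.ofOpSequence q).map (homOfLE (Nat.le_add_right k 1)).op = 0 :=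
    (congrArg _ (key k)).trans (w k (s k))
  exact ⟨{
    Q := Functor.ofOpSequence q
    a := fun k => (s k).1.2
    quasiIso := fun k => (s k).2
    isZero := isZero_zero _
    comm := fun k => (congrArg _ (key k)).trans (h k (s k))
    J := fun k => J k (s k)
    ι := fun k => ι k (s k)
    w := w'
    shortExact := fun k => shortExact_congr (key k) (w k (s k)) (w' k) (hw k (s k))
    injective := fun k => hJ k (s k)
    isStrictlyGE := fun k => hJ' k (s k) }⟩

end Resolution

end CechExt

namespace CechExt

/-! ### The limit of the tower and its filtration -/

section Limit

variable {A : Type u} [Category.{v} A] [Abelian A]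

lemma quasiIsoAt_of_isIso_f {K L : CochainComplex A ℤ} (f : K ⟶ L) (m : ℤ)
    (h : ∀ i ≤ m + 1, IsIso (f.f i)) : QuasiIsoAt f m := by
  rw [quasiIsoAt_iff' _ (m - 1) m (m + 1) (by simp) (by simp)]
  let φ := (HomologicalComplex.shortComplexFunctor' A (ComplexShape.up ℤ) (m - 1) m (m + 1)).map f
  have : IsIso φ.τ₁ := h _ (by lia)
  have : IsIso φ.τ₂ := h _ (by lia)
  have : IsIso φ.τ₃ := h _ (by lia)
  exact ShortComplex.quasiIso_of_epi_of_isIso_of_mono φ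

section

variable (F : CochainComplex A ℤ) (N : ℤ)

/-- The filtration is indexed by `ℤ`, the tower by `ℕ`: step `n` corresponds to stage `(n -
N).toNat`, so that `n` is replaced by `max n N`. This is harmless since `F` vanishes below `N`. -/
lemma isZero_sigmaLT_X_toNat [F.IsStrictlyGE N] {n m : ℤ} (h : n ≤ m) :
    IsZero ((sigmaLT F (N + (n - N).toNat)).X m) := by
  refine isZero_sigmaLT_X F ?_
  by_cases hm : N ≤ m
  · exact Or.inl (by lia)
  · exact Or.inr (F.isZero_of_isStrictlyGE N m (by lia))

lemma sigmaGEι_π_toNat [F.IsStrictlyGE N] (n : ℤ) :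
    sigmaGEι F n ≫ cokernel.π (sigmaGEι F (N + (n - N).toNat)) = 0 := by
  ext m
  by_cases h : n ≤ m
  · exact (isZero_sigmaLT_X_toNat F N h).eq_of_tgt _ _
  · exact (isZero_sigmaGE_X F h).eq_of_src _ _

lemma shortExact_sigmaGE_toNat [F.IsStrictlyGE N] (n : ℤ) :
    (ShortComplex.mk _ _ (sigmaGEι_π_toNat F N n)).ShortExact := by
  refine HomologicalComplex.shortExact_of_degreewise_shortExact _ fun m => ?_
  by_cases h : n ≤ m
  · let e := @asIso _ _ _ _ _ (isIso_sigmaGEι_f F h)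
    exact ShortComplex.Splitting.shortExact
      { r := e.inv
        s := 0
        f_r := e.hom_inv_id
        s_g := (isZero_sigmaLT_X_toNat F N h).eq_of_src _ _
        id := (congrArg (_ + ·) comp_zero).trans ((add_zero _).trans e.inv_hom_id) }
  · let e := @asIso _ _ _ _ _ (isIso_sigmaLT_π_f F (n := N + (n - N).toNat) (m := m) (by lia))
    exact ShortComplex.Splitting.shortExact
      { r := 0
        s := e.inv
        f_r := (isZero_sigmaGE_X F h).eq_of_src _ _
        s_g := e.inv_hom_id
        id := (congrArg (· + _) zero_comp).trans ((zero_add _).trans e.hom_inv_id) }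

end

namespace InjectiveTower

variable {F : CochainComplex A ℤ} {N : ℤ} (T : InjectiveTower F N)

/-- The transition maps of the tower. -/
abbrev map {k l : ℕ} (h : k ≤ l) : T.Q.obj (op l) ⟶ T.Q.obj (op k) := T.Q.map (homOfLE h).op

lemma isIso_map_succ_f {k : ℕ} {m : ℤ} (h : m < N + k) : IsIso ((T.map (Nat.le_add_right k 1)).f m) := by
  have := T.isStrictlyGE k
  exact ((T.shortExact k).map_of_exact (HomologicalComplex.eval A _ m)).isIso_g_iff.2
    ((T.J k).isZero_of_isStrictlyGE (N + k) m h)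

lemma map_induction {P : MorphismProperty (CochainComplex A ℤ)} [P.IsMultiplicative] {k l : ℕ}
    (hP : ∀ i, k ≤ i → P (T.map (Nat.le_add_right i 1))) (h : k ≤ l) : P (T.map h) := by
  induction l, h using Nat.le_induction with
  | base =>
    have : T.map (le_refl k) = 𝟙 _ := T.Q.map_id (op k)
    exact this ▸ P.id_mem _
  | succ l h hl =>
    have : T.map (Nat.le_succ_of_le h) = T.map (Nat.le_add_right l 1) ≫ T.map h := by
      rw [← T.Q.map_comp]
      rfl
    exact this ▸ P.comp_mem _ _ (hP l h) hl

instance epi_map {k l : ℕ} (h : k ≤ l) : Epi (T.map h) :=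
  T.map_induction (P := .epimorphisms _) (fun i _ => (T.shortExact i).epi_g) h

lemma isIso_map_f {k l : ℕ} (h : k ≤ l) {m : ℤ} (hm : m < N + k) : IsIso ((T.map h).f m) :=
  T.map_induction (P := (MorphismProperty.isomorphisms A).inverseImage
    (HomologicalComplex.eval A (ComplexShape.up ℤ) m))
    (fun i _ => T.isIso_map_succ_f (by lia)) h

variable [HasLimitsOfShape ℕᵒᵖ A]

/-- The limit of the tower. -/
abbrev lim : CochainComplex A ℤ := limit T.Q

/-- The projections of the limit of the tower. -/
abbrev p (k : ℕ) : T.lim ⟶ T.Q.obj (op k) := limit.π T.Q (op k)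

lemma p_map {k l : ℕ} (h : k ≤ l) : T.p l ≫ T.map h = T.p k :=
  limit.w T.Q (homOfLE h).op

/-- In a fixed degree the tower is constant from some stage on, so its limit is attained there and
no exactness of infinite limits is needed. -/
lemma isIso_p_f {k : ℕ} {m : ℤ} (hm : m < N + k) : IsIso ((T.p k).f m) :=
  HomologicalComplex.isIso_π_f_of_isLimit_of_isEventuallyConstantTo _ (limit.isLimit _) _ _
    (fun _ φ => T.isIso_map_f (leOfHom φ.unop) hm)

instance (k : ℕ) : Epi (T.p k) := by
  have (m : ℤ) : Epi ((T.p k).f m) := by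
    -- A stage beyond `k` with `m < N + l`, at which the limit is attained in degree `m`.
    let l := k + (m + 1 - N).toNat
    have hl : k ≤ l := by simp [l]
    have := T.isIso_p_f (k := l) (m := m) (by simp only [l]; lia)
    have h : (T.p l).f m ≫ (T.map hl).f m = (T.p k).f m :=
      HomologicalComplex.congr_hom (T.p_map hl) m
    have : Epi ((T.map hl).f m) :=
      inferInstanceAs (Epi ((HomologicalComplex.eval A _ m).map (T.map hl)))
    rw [← h]
    exact epi_comp _ _
  exact HomologicalComplex.epi_of_epi_f _ this

/-- The morphism from `F` to the limit of the tower. -/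
def toLim : F ⟶ T.lim :=
  limit.lift T.Q (Cone.mk F (NatTrans.ofOpSequence
    (fun k => (cokernel.π (sigmaGEι F (N + k)) ≫ T.a k : F ⟶ T.Q.obj (op k)))
    (fun k => by
      have h : cokernel.π (sigmaGEι F (N + ((k + 1 : ℕ) : ℤ))) ≫ sigmaLTMap F (by simp) =
        cokernel.π (sigmaGEι F (N + k)) := π_sigmaLTMap F _
      refine (Category.id_comp _).trans ?_
      rw [Category.assoc, T.comm, ← Category.assoc, h])))

lemma toLim_p (k : ℕ) : T.toLim ≫ T.p k = cokernel.π (sigmaGEι F (N + k)) ≫ T.a k :=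
  limit.lift_π _ _

instance : QuasiIso T.toLim where
  quasiIsoAt m := by
    -- Homology in degree `m` involves degrees up to `m + 1`; this `k` gives `m + 1 < N + k`.
    let k := (m + 2 - N).toNat
    have := T.quasiIso k
    have : QuasiIsoAt (T.p k) m :=
      quasiIsoAt_of_isIso_f _ _ fun i hi => T.isIso_p_f (by simp only [k]; lia)
    have : QuasiIsoAt (cokernel.π (sigmaGEι F (N + k))) m :=
      quasiIsoAt_of_isIso_f _ _ fun i hi => isIso_sigmaLT_π_f F (by simp only [k]; lia)
    have : QuasiIsoAt (T.toLim ≫ T.p k) m := by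
      rw [toLim_p]
      infer_instance
    exact quasiIsoAt_of_comp_right T.toLim (T.p k) m

lemma kernel_ι_p {k l : ℕ} (h : k ≤ l) : kernel.ι (T.p l) ≫ T.p k = 0 := by
  rw [← T.p_map h, kernel.condition_assoc, zero_comp]

/-- The limit of the tower, filtered by the kernels of the projections. -/
def filteredComplex : FilteredComplex A where
  X := T.lim
  fil :=
    { obj := fun n => kernel (T.p (n.unop - N).toNat)
      map := fun f => kernel.lift _ (kernel.ι _) (T.kernel_ι_p (by have := leOfHom f.unop; lia))
      map_id := fun n => by
        rw [← cancel_mono (kernel.ι _)]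
        simp
      map_comp := fun f g => by
        rw [← cancel_mono (kernel.ι _)]
        simp }
  ι :=
    { app := fun n => kernel.ι (T.p (n.unop - N).toNat)
      naturality := fun n n' f => (kernel.lift_ι _ _ _).trans (Category.comp_id _).symm }
  mono_ι n := by exact (inferInstance : Mono (kernel.ι (T.p (n.unop - N).toNat)))

lemma sigmaGEι_toLim_p [F.IsStrictlyGE N] (n : ℤ) :
    (sigmaGEι F n ≫ T.toLim) ≫ T.p (n - N).toNat = 0 := by
  rw [Category.assoc, toLim_p, ← Category.assoc, sigmaGEι_π_toNat, zero_comp]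

/-- The morphism from the filtration bête to the filtered limit of the tower. -/
def toFilteredComplex [F.IsStrictlyGE N] : bete F ⟶ T.filteredComplex where
  hom := T.toLim
  fil :=
    { app := fun n => kernel.lift _ (sigmaGEι F n.unop ≫ T.toLim) (T.sigmaGEι_toLim_p n.unop)
      naturality := fun n n' f => by
        refine (cancel_mono (kernel.ι (T.p (n'.unop - N).toNat))).1 ?_
        have h₁ : sigmaGEMap F (leOfHom f.unop) ≫ sigmaGEι F n'.unop ≫ T.toLim =
            sigmaGEι F n.unop ≫ T.toLim := by
          rw [← Category.assoc, sigmaGEMap_ι]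
        refine (Category.assoc _ _ _).trans ((congrArg _ (kernel.lift_ι _ _ _)).trans
          (h₁.trans ((kernel.lift_ι _ _ (T.sigmaGEι_toLim_p n.unop)).symm.trans ?_)))
        refine (congrArg _ ?_).trans (Category.assoc _ _ _).symm
        exact (kernel.lift_ι _ _ _).symm }
  comm n := kernel.lift_ι _ _ _

/-- The steps are the kernels of the projections to `F / σ_{≥ N + k} F` and to `Q k`, so they are
compared through the total complexes and the quotients. -/
lemma filteredQuasiIso_toFilteredComplex [F.IsStrictlyGE N] :
    FilteredComplex.filteredQuasiIso T.toFilteredComplex := by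
  refine ⟨inferInstanceAs (QuasiIso T.toLim), fun n => ?_⟩
  let k := (n - N).toNat
  have hS : (ShortComplex.mk (kernel.ι (T.p k)) _ (kernel.condition _)).ShortExact :=
    { exact := ShortComplex.exact_kernel _
      mono_f := inferInstanceAs (Mono (kernel.ι _))
      epi_g := inferInstanceAs (Epi (T.p k)) }
  let ψ : ShortComplex.mk _ _ (sigmaGEι_π_toNat F N n) ⟶
      ShortComplex.mk (kernel.ι (T.p k)) _ (kernel.condition _) :=
    { τ₁ := T.toFilteredComplex.fil.app (op n)
      τ₂ := T.toLim
      τ₃ := T.a k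
      comm₁₂ := T.toFilteredComplex.comm (op n)
      comm₂₃ := T.toLim_p k }
  exact quasiIso_τ₁ ψ (shortExact_sigmaGE_toNat F N n) hS (inferInstanceAs (QuasiIso T.toLim)) (T.quasiIso k)

end InjectiveTower

end Limit

end CechExt

namespace CechExt

/-! ### Graded pieces of the limit, and existence of the resolution -/

section Resolution

variable {A : Type u} [Category.{v} A] [Abelian A]


/-- For an epimorphism `p : K ⟶ L` and a short exact sequence `J ⟶ L ⟶ M`, the morphism from the
kernel of `K ⟶ M` to `J`. -/
def kernelCompToKernel {K L M J : A} (p : K ⟶ L) {q : L ⟶ M} {i : J ⟶ L} (w : i ≫ q = 0)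
    (hS : (ShortComplex.mk i q w).ShortExact) {r : K ⟶ M} (hr : p ≫ q = r) : kernel r ⟶ J :=
  hS.fIsKernel.lift (KernelFork.ofι (kernel.ι r ≫ p)
    (by rw [Category.assoc]; exact (congrArg _ hr).trans (kernel.condition r)))

lemma kernelCompToKernel_comp {K L M J : A} (p : K ⟶ L) {q : L ⟶ M} {i : J ⟶ L} (w : i ≫ q = 0)
    (hS : (ShortComplex.mk i q w).ShortExact) {r : K ⟶ M} (hr : p ≫ q = r) :
    kernelCompToKernel p w hS hr ≫ i = kernel.ι r ≫ p :=
  hS.fIsKernel.fac _ WalkingParallelPair.zero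

/-- For composable epimorphisms `p : K ⟶ L` and `q : L ⟶ M`, the quotient of the kernel of
`K ⟶ M` by the kernel of `p` is the kernel of `q`. -/
lemma nonempty_cokernel_iso {K L M J : A} (p : K ⟶ L) [Epi p] {q : L ⟶ M} {i : J ⟶ L}
    (w : i ≫ q = 0) (hS : (ShortComplex.mk i q w).ShortExact) {r : K ⟶ M} (hr : p ≫ q = r)
    (t : kernel p ⟶ kernel r) (ht : t ≫ kernel.ι r = kernel.ι p) : Nonempty (cokernel t ≅ J) := by
  have hi : Mono i := hS.mono_f
  have hw : t ≫ kernelCompToKernel p w hS hr = 0 := by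
    rw [← cancel_mono i, Category.assoc, kernelCompToKernel_comp, ← Category.assoc, ht,
      kernel.condition, zero_comp]
  have hT : (ShortComplex.mk t _ hw).ShortExact := by
    have : Mono (t ≫ kernel.ι r) := by
      rw [ht]
      infer_instance
    refine { exact := ?_, mono_f := mono_of_mono t (kernel.ι r), epi_g := ?_ }
    · rw [ShortComplex.exact_iff_exact_up_to_refinements]
      intro B x hx
      have hx' : (x ≫ kernel.ι r) ≫ p = 0 := by
        dsimp at hx
        rw [Category.assoc, ← kernelCompToKernel_comp p w hS hr, ← Category.assoc, hx, zero_comp]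
      refine ⟨B, 𝟙 B, inferInstance, kernel.lift p _ hx', ?_⟩
      dsimp
      rw [← cancel_mono (kernel.ι r), Category.assoc, Category.assoc, ht, kernel.lift_ι,
        Category.id_comp]
    · rw [epi_iff_surjective_up_to_refinements]
      intro B y
      obtain ⟨B', π, hπ, x, hx⟩ := surjective_up_to_refinements_of_epi p (y ≫ i)
      dsimp at y
      have hx' : x ≫ r = 0 := by
        rw [← hr, ← Category.assoc, ← hx, Category.assoc, Category.assoc, w, comp_zero, comp_zero]
      refine ⟨B', π, hπ, kernel.lift r x hx', ?_⟩
      dsimp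
      rw [← cancel_mono i, Category.assoc, Category.assoc, kernelCompToKernel_comp,
        kernel.lift_ι_assoc, hx]
  exact ⟨(colimit.isColimit _).coconePointUniqueUpToIso hT.gIsCokernel⟩

namespace InjectiveTower

variable {F : CochainComplex A ℤ} {N : ℤ} (T : InjectiveTower F N) [HasLimitsOfShape ℕᵒᵖ A]

lemma p_zero : T.p 0 = 0 := T.isZero.eq_of_tgt _ _

/-- Consecutive steps of the filtration correspond to equal stages (below `N`) or to consecutive
stages; the graded piece is zero or `J k` accordingly. -/
lemma injective_cokernel {k l : ℕ} (h : k ≤ l) (hl : l ≤ k + 1)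
    (t : kernel (T.p l) ⟶ kernel (T.p k)) (ht : t ≫ kernel.ι (T.p k) = kernel.ι (T.p l)) (m : ℤ) :
    Injective ((cokernel t).X m) := by
  obtain rfl | rfl : l = k ∨ l = k + 1 := by lia
  · have : t = 𝟙 _ := by
      rw [← cancel_mono (kernel.ι (T.p l)), ht, Category.id_comp]
    subst this
    have h₀ : IsZero (cokernel (𝟙 (kernel (T.p l)))) := isZero_cokernel_of_epi _
    exact Injective.of_iso ((HomologicalComplex.eval A _ m).map_isZero h₀).isoZero.symm inferInstance
  · obtain ⟨e⟩ := nonempty_cokernel_iso (T.p (k + 1)) (T.w k) (T.shortExact k)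
      (T.p_map (Nat.le_add_right k 1)) t ht
    exact Injective.of_iso ((HomologicalComplex.eval A _ m).mapIso e.symm) (T.injective k m)

/-- The filtered injective resolution of the filtration bête given by a tower. -/
def filteredInjectiveResolution [F.IsStrictlyGE N] : FilteredInjectiveResolution (bete F) where
  I := T.filteredComplex
  φ := T.toFilteredComplex
  quasiIso := T.filteredQuasiIso_toFilteredComplex
  bounded_below := ⟨N, fun m hm => by
    have := T.isIso_p_f (k := 0) (m := m) (by simpa using hm)
    exact IsZero.of_iso ((HomologicalComplex.eval A _ m).map_isZero T.isZero)
      (@asIso _ _ _ _ ((T.p 0).f m) this)⟩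
  exhaustive m := ⟨N, by
    -- Step `N` is the kernel of the projection to stage `0`, which is zero.
    have h : T.p (N - N).toNat = 0 := by
      rw [sub_self]
      exact T.p_zero
    have : IsIso (kernel.ι (T.p (N - N).toNat)) := by
      rw [h]
      infer_instance
    exact inferInstanceAs (IsIso ((HomologicalComplex.eval A _ m).map
      (kernel.ι (T.p (N - N).toNat))))⟩
  separated m := ⟨max (m + 1) N, by
    -- At this stage `m < N + k`, so the projection is an isomorphism in degree `m` and its kernel
    -- vanishes there.
    have := T.isIso_p_f (k := (max (m + 1) N - N).toNat) (m := m) (by lia)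
    have h₁ : (kernel.ι (T.p (max (m + 1) N - N).toNat)).f m ≫
        (T.p (max (m + 1) N - N).toNat).f m = 0 :=
      HomologicalComplex.congr_hom (kernel.condition _) m
    have h₂ : Mono ((kernel.ι (T.p (max (m + 1) N - N).toNat)).f m) :=
      inferInstanceAs (Mono ((HomologicalComplex.eval A _ m).map (kernel.ι _)))
    have h₃ := (cancel_mono ((T.p (max (m + 1) N - N).toNat).f m)).1 (h₁.trans zero_comp.symm)
    exact @IsZero.of_mono_eq_zero _ _ _ _ _ _ h₂ h₃⟩
  injective_gr n m := T.injective_cokernel (by lia) (by lia) _ (kernel.lift_ι _ _ _) m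

end InjectiveTower

/-- A bounded below complex has a filtered injective resolution. -/
lemma nonempty_filteredInjectiveResolution [EnoughInjectives A] [HasLimitsOfShape ℕᵒᵖ A]
    (F : CochainComplex A ℤ) (N : ℤ) [F.IsStrictlyGE N] :
    Nonempty (FilteredInjectiveResolution (bete F)) :=
  (nonempty_injectiveTower F N).map fun T => T.filteredInjectiveResolution

end Resolution

/-! ### Enough injective sheaves -/

section Sheaf

variable {C : Type u} [Category.{v} C] (J : GrothendieckTopology C)

instance : IsGrothendieckAbelian.{max u v} (AbSheaf J) := by
  have : EssentiallySmall.{max u v} C := inferInstance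
  exact Sheaf.isGrothendieckAbelian_of_essentiallySmall _ _

end Sheaf

end CechExt

namespace CechExt

/-! ### K-injectivity of the steps of a filtered injective resolution -/

section Filtered

variable {A : Type u} [Category.{v} A] [Abelian A]

namespace FilteredComplex

variable (F : FilteredComplex A)

lemma stepSucc_ι (n : ℤ) : F.stepSucc n ≫ F.ι.app (op n) = F.ι.app (op (n + 1)) :=
  (F.ι.naturality (homOfLE (show n ≤ n + 1 by lia)).op).trans (Category.comp_id _)

instance (n : ℤ) : Mono (F.ι.app (op n)) := F.mono_ι _

instance (n : ℤ) : Mono (F.stepSucc n) := by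
  have := F.mono_ι (op (n + 1))
  have h := F.stepSucc_ι n
  rw [← h] at this
  exact mono_of_mono (F.stepSucc n) (F.ι.app (op n))

lemma shortExact_gr (n : ℤ) :
    (ShortComplex.mk (F.stepSucc n) _ (cokernel.condition _)).ShortExact :=
  { exact := ShortComplex.exact_cokernel _
    mono_f := inferInstanceAs (Mono (F.stepSucc n))
    epi_g := inferInstanceAs (Epi (cokernel.π _)) }

lemma injective_step_X_succ {n m : ℤ} (h : Injective ((F.fil.obj (op (n + 1))).X m))
    (h' : Injective (((gr n).obj F).X m)) : Injective ((F.fil.obj (op n)).X m) := by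
  have hS := (F.shortExact_gr n).map_of_exact (HomologicalComplex.eval A _ m)
  have : Injective (((ShortComplex.mk (F.stepSucc n) _ (cokernel.condition _)).map
    (HomologicalComplex.eval A _ m)).X₁) := h
  exact Injective.of_iso hS.splittingOfInjective.isoBinaryBiproduct.symm
    (@Injective.instBiprod _ _ _ _ _ _ h h')

end FilteredComplex

namespace FilteredInjectiveResolution

open FilteredComplex

variable {F : FilteredComplex A} (I : FilteredInjectiveResolution F)

/-- Descending induction from a step that vanishes in degree `m`: each step is an extension of an
injective graded piece by the next step, and the extension splits. -/
lemma injective_fil_X (n m : ℤ) : Injective ((I.I.fil.obj (op n)).X m) := by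
  obtain ⟨b, hb⟩ := I.separated m
  have key (k : ℕ) (n : ℤ) (hn : b ≤ n + k) : Injective ((I.I.fil.obj (op n)).X m) := by
    induction k generalizing n with
    | zero =>
      have h : IsZero ((I.I.fil.obj (op n)).X m) := by
        have h₁ : I.I.fil.map (homOfLE (show b ≤ n by lia)).op ≫ I.I.ι.app (op b) =
            I.I.ι.app (op n) := (I.I.ι.naturality _).trans (Category.comp_id _)
        have h₂ : (I.I.ι.app (op n)).f m = 0 := by
          rw [← h₁]
          exact (congrArg (· ≫ _) (hb.eq_zero_of_tgt _)).trans zero_comp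
        have : Mono ((I.I.ι.app (op n)).f m) :=
          inferInstanceAs (Mono ((HomologicalComplex.eval A _ m).map (I.I.ι.app (op n))))
        exact IsZero.of_mono_eq_zero _ h₂
      exact Injective.of_iso h.isoZero.symm inferInstance
    | succ k hk =>
      exact I.I.injective_step_X_succ (hk _ (by push_cast at hn; lia)) (I.injective_gr n m)
  exact key (b - n).toNat n (by lia)

lemma injective_X_X (m : ℤ) : Injective (I.I.X.X m) := by
  obtain ⟨a, ha⟩ := I.exhaustive m
  exact Injective.of_iso (@asIso _ _ _ _ _ ha) (I.injective_fil_X a m)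

lemma exists_isStrictlyGE : ∃ N : ℤ, I.I.X.IsStrictlyGE N ∧
    ∀ n, (I.I.fil.obj (op n)).IsStrictlyGE N := by
  obtain ⟨N, hN⟩ := I.bounded_below
  refine ⟨N, (CochainComplex.isStrictlyGE_iff _ _).2 hN,
    fun n => (CochainComplex.isStrictlyGE_iff _ _).2 fun m hm => ?_⟩
  have : Mono ((I.I.ι.app (op n)).f m) :=
    inferInstanceAs (Mono ((HomologicalComplex.eval A _ m).map (I.I.ι.app (op n))))
  exact IsZero.of_mono_eq_zero _ ((hN m hm).eq_zero_of_tgt ((I.I.ι.app (op n)).f m))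

lemma isKInjective_X : I.I.X.IsKInjective := by
  obtain ⟨N, h, _⟩ := I.exists_isStrictlyGE
  have := I.injective_X_X
  exact CochainComplex.isKInjective_of_injective _ N

lemma isKInjective_fil (n : ℤ) : (I.I.fil.obj (op n)).IsKInjective := by
  obtain ⟨N, _, h⟩ := I.exists_isStrictlyGE
  have := h n
  have := I.injective_fil_X n
  exact CochainComplex.isKInjective_of_injective _ N

/-- Quasi-isomorphisms induce filtered quasi-isomorphisms on `RHom(-, F)`. -/
lemma filteredQuasiIso_totHomFil_map {K K' : CochainComplex A ℤ} (f : K' ⟶ K) [QuasiIso f] :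
    filteredQuasiIso ((totHomFil.map f.op).app I.I) := by
  have := I.isKInjective_X
  refine ⟨quasiIso_totHomMap_of_isKInjective f, fun n => ?_⟩
  have := I.isKInjective_fil n
  exact quasiIso_totHomMap_of_isKInjective f

end FilteredInjectiveResolution

end Filtered

section Site

variable {C : Type u} [Category.{v} C] {J : GrothendieckTopology C}

lemma filteredQuasiIso_rHomToTotHom {X : SPre C} {F : FilteredComplex (AbSheaf J)}
    (I : FilteredInjectiveResolution F) (K : LAF J X) :
    FilteredComplex.filteredQuasiIso (rHomToTotHom J I K) := by
  have := IsLocalAcyclicFibration.quasiIso_freeComplex K.property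
  exact I.filteredQuasiIso_totHomFil_map ((freeComplex J).map K.obj.hom)

end Site

end CechExt

namespace CechExt

/-! ### A criterion for filtered colimits of abelian groups -/

section Criterion

/-- A cocone on a filtered diagram of abelian groups is a colimit if its components are jointly
surjective and every element of their kernels dies in the diagram. -/
lemma nonempty_isColimit_of_isFiltered {I : Type u} [Category.{v} I] [IsFiltered I]
    {D : I ⥤ AddCommGrpCat.{w}} (c : Cocone D)
    (hsurj : ∀ x : c.pt, ∃ (i : I) (y : D.obj i), c.ι.app i y = x)
    (hinj : ∀ (i : I) (y : D.obj i), c.ι.app i y = 0 → ∃ (j : I) (f : i ⟶ j), D.map f y = 0) :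
    Nonempty (IsColimit c) := by
  have w {s : Cocone D} {i j : I} (f : i ⟶ j) (y : D.obj i) :
      s.ι.app j (D.map f y) = s.ι.app i y := ConcreteCategory.congr_hom (s.w f) y
  have compat (s : Cocone D) {i j : I} (y : D.obj i) (z : D.obj j) (h : c.ι.app i y = c.ι.app j z) :
      s.ι.app i y = s.ι.app j z := by
    let k := IsFiltered.max i j
    let f : i ⟶ k := IsFiltered.leftToMax i j
    let g : j ⟶ k := IsFiltered.rightToMax i j
    obtain ⟨l, t, ht⟩ := hinj k (D.map f y - D.map g z) (by
      rw [map_sub, w, w, h, sub_self])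
    have h' := w (s := s) t (D.map f y - D.map g z)
    rw [ht, map_zero, map_sub, w, w] at h'
    exact sub_eq_zero.1 h'.symm
  choose i y hy using hsurj
  exact ⟨{
    desc := fun s => AddCommGrpCat.ofHom (AddMonoidHom.mk' (fun x => s.ι.app (i x) (y x)) (by
      intro a b
      let k := IsFiltered.max (i a) (i b)
      let f : i a ⟶ k := IsFiltered.leftToMax _ _
      let g : i b ⟶ k := IsFiltered.rightToMax _ _
      rw [compat s (y (a + b)) (D.map f (y a) + D.map g (y b))
        (by rw [map_add, w, w, hy, hy, hy]), map_add, w, w]))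
    fac := fun s j => by
      ext z
      exact compat s _ _ (hy _)
    uniq := fun s m hm => by
      ext x
      refine (congrArg m (hy x).symm).trans ?_
      exact ConcreteCategory.congr_hom (hm (i x)) (y x) }⟩

end Criterion

/-! ### Colimits over `hD(X)` -/

section Site

open CochainComplex CochainComplex.HomComplex

variable {C : Type u} [Category.{v} C] {J : GrothendieckTopology C} {X : SPre C}

/-- The object of `hD(X)ᵒᵖ` given by an object of `D(X)`. -/
abbrev LAF.idx (K : LAF J X) : (HLAF J X)ᵒᵖ := op ((CategoryTheory.Quotient.functor _).obj K)

/-- The morphism of `hD(X)ᵒᵖ` given by a morphism of `D(X)`. -/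
abbrev LAF.idxMap {K K' : LAF J X} (f : K' ⟶ K) : K.idx ⟶ K'.idx :=
  ((CategoryTheory.Quotient.functor _).map f).op

lemma nonempty_isColimit_of_LAF {D : (HLAF J X)ᵒᵖ ⥤ AddCommGrpCat.{w}} (c : Cocone D)
    (hsurj : ∀ x : c.pt, ∃ (K : LAF J X) (y : D.obj K.idx), c.ι.app K.idx y = x)
    (hinj : ∀ (K : LAF J X) (y : D.obj K.idx), c.ι.app K.idx y = 0 →
      ∃ (K' : LAF J X) (f : K' ⟶ K), D.map (LAF.idxMap f) y = 0) :
    Nonempty (IsColimit c) := by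
  have := isCofiltered_HLAF J X
  refine nonempty_isColimit_of_isFiltered c (fun x => ?_) (fun K y h => ?_)
  · obtain ⟨K, y, h⟩ := hsurj x
    exact ⟨K.idx, y, h⟩
  · obtain ⟨K', f, h⟩ := hinj K.unop.as y h
    exact ⟨K'.idx, LAF.idxMap f, h⟩

/-- The morphism `ℤK ⟶ ℤX` for `K ∈ D(X)`. -/
abbrev LAF.augmentation (K : LAF J X) : (freeComplex J).obj K.obj.left ⟶ (freeComplex J).obj X :=
  (freeComplex J).map K.obj.hom

instance (K : LAF J X) : QuasiIso K.augmentation :=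
  IsLocalAcyclicFibration.quasiIso_freeComplex K.property

/-- Let `H` be a functor on the filtered derived category whose values on `Tot Hom(-, F)` and
`Tot Hom(-, I)` are the cohomology groups of `Tot Hom(-, P)` and `Tot Hom(-, S)`, where
`P ⟶ S` is a quasi-isomorphism of bounded below complexes. Then `H` takes a morphism of
ind-objects as in the theorem to a colimit cocone. -/
lemma nonempty_isColimit_mapCocone {F : FilteredComplex (AbSheaf J)}
    (I : FilteredInjectiveResolution F)
    (Φ : cechIndObject J X F ⟶ (Functor.const _).obj (FilteredDerivedCategory.Q.obj
      (I.rHom ((freeComplex J).obj X))))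
    (hΦ : ∀ K : LAF J X, Φ.app K.idx ≫ FilteredDerivedCategory.Q.map (rHomToTotHom J I K) =
      cechToTotHom J I K)
    (H : FilteredDerivedCategory AddCommGrpCat.{max u v} ⥤ AddCommGrpCat.{max u v}) (p : ℤ)
    {P S : CochainComplex (AbSheaf J) ℤ} (φ : P ⟶ S) [QuasiIso φ] (N : ℤ) [P.IsStrictlyGE N]
    [S.IsStrictlyGE N]
    (e : totHomFil.flip.obj F ⋙ FilteredDerivedCategory.Q ⋙ H ≅
      totHom.flip.obj P ⋙ HomologicalComplex.homologyFunctor _ _ p)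
    (e' : totHomFil.flip.obj I.I ⋙ FilteredDerivedCategory.Q ⋙ H ≅
      totHom.flip.obj S ⋙ HomologicalComplex.homologyFunctor _ _ p)
    (he : ∀ K, H.map (FilteredDerivedCategory.Q.map ((totHomFil.obj K).map I.φ)) ≫ e'.hom.app K =
      e.hom.app K ≫ HomologicalComplex.homologyMap (totHomMap (𝟙 _) φ) p) :
    Nonempty (IsColimit (H.mapCocone (Cocone.mk _ Φ))) := by
  have hr (K : LAF J X) : IsIso (H.map (FilteredDerivedCategory.Q.map (rHomToTotHom J I K))) := by
    have := Localization.inverts FilteredDerivedCategory.Q FilteredComplex.filteredQuasiIso _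
      (filteredQuasiIso_rHomToTotHom I K)
    infer_instance
  have inj {A B : AddCommGrpCat.{max u v}} (f : A ⟶ B) [IsIso f] : Function.Injective f :=
    ((ConcreteCategory.isIso_iff_bijective f).1 inferInstance).1
  have hΦ' (K : LAF J X) (y : H.obj ((cechIndObject J X F).obj K.idx)) :
      e'.hom.app (op ((freeComplex J).obj K.obj.left))
        (H.map (FilteredDerivedCategory.Q.map (rHomToTotHom J I K)) (H.map (Φ.app K.idx) y)) =
      HomologicalComplex.homologyMap (totHomMap (𝟙 _) φ) p
        (e.hom.app (op ((freeComplex J).obj K.obj.left)) y) := by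
    have h₁ := ConcreteCategory.congr_hom (congrArg H.map (hΦ K)) y
    have h₂ := ConcreteCategory.congr_hom (he (op ((freeComplex J).obj K.obj.left))) y
    rw [H.map_comp] at h₁
    exact (congrArg _ h₁).trans h₂
  have hnat (K : LAF J X) (x : H.obj (FilteredDerivedCategory.Q.obj (I.rHom ((freeComplex J).obj X)))) :
      e'.hom.app (op ((freeComplex J).obj K.obj.left))
        (H.map (FilteredDerivedCategory.Q.map (rHomToTotHom J I K)) x) =
      HomologicalComplex.homologyMap (totHomMap K.augmentation (𝟙 S)) p
        (e'.hom.app (op ((freeComplex J).obj X)) x) :=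
    ConcreteCategory.congr_hom (e'.hom.naturality K.augmentation.op) x
  refine nonempty_isColimit_of_LAF _ (fun x => ?_) (fun K y hy => ?_)
  -- Surjectivity: the given class is that of a cocycle `z` on `ℤX` with values in `S`, which after
  -- refinement comes from `P` up to a coboundary.
  · obtain ⟨z, hz⟩ := homClass_surjective (e'.hom.app (op ((freeComplex J).obj X)) x)
    obtain ⟨K', f, hf, x', y, h⟩ := exists_refinement_postcomp_eq φ N (show p - 1 + 1 = p by lia) z
    let K : LAF J X := ⟨Over.mk f, hf⟩
    refine ⟨K, e.inv.app (op ((freeComplex J).obj K')) (homClass x'), ?_⟩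
    -- Classes of `RHom(ℤX, F)` can be compared after pullback to `ℤK`, since this pullback is an
    -- isomorphism.
    have := hr K
    refine inj (H.map (FilteredDerivedCategory.Q.map (rHomToTotHom J I K)))
      (inj (e'.hom.app (op ((freeComplex J).obj K'))) ?_)
    refine (hΦ' K _).trans (Eq.trans ?_ (hnat K x).symm)
    refine (congrArg _ (ConcreteCategory.congr_hom (e.inv_hom_id_app
      (op ((freeComplex J).obj K'))) (homClass x'))).trans ?_
    refine Eq.trans ?_ (congrArg _ hz)
    refine (homologyMap_totHomMap_homClass _ _ _ _).trans
      (Eq.trans ?_ (homologyMap_totHomMap_homClass _ _ _ _).symm)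
    refine Eq.symm ((homClass_eq_iff _ _ (p - 1) (by lia)).2 ⟨y, ?_⟩)
    refine Eq.trans ?_ (h.trans ?_)
    · simp [cocycleMap]
    · simp [cocycleMap, K]
      rfl
  -- Injectivity: the image of `z` in `S` is a coboundary, so `z` itself becomes one after
  -- refinement.
  · obtain ⟨z, hz⟩ := homClass_surjective (e.hom.app (op ((freeComplex J).obj K.obj.left)) y)
    have h := hΦ' K y
    have hy' : H.map (Φ.app K.idx) y = 0 := hy
    rw [hy', map_zero, map_zero, ← hz, homologyMap_totHomMap_homClass] at h
    obtain ⟨w, hw⟩ := (homClass_eq_zero_iff _ (p - 1) (by lia)).1 h.symm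
    obtain ⟨K', f, hf, y', h'⟩ := exists_refinement_eq_δ φ N (show p - 1 + 1 = p by lia) z w
      (hw.trans (by simp [cocycleMap]))
    refine ⟨K.over f hf, K.overHom f hf, ?_⟩
    refine inj (e.hom.app (op ((freeComplex J).obj K'))) ?_
    refine (ConcreteCategory.congr_hom (e.hom.naturality ((freeComplex J).map f).op) y).trans ?_
    refine (congrArg _ hz.symm).trans ((homologyMap_totHomMap_homClass _ _ _ _).trans
      (Eq.trans ?_ (map_zero _).symm))
    exact (homClass_eq_zero_iff _ (p - 1) (by lia)).2 ⟨y', h'.trans (by simp [cocycleMap])⟩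

end Site

end CechExt

namespace CechExt

/-! ### Graded pieces of `Tot Hom` -/

section Graded

open CochainComplex CochainComplex.HomComplex FilteredComplex

variable {A : Type u} [Category.{v} A] [Abelian A]

/-- Composition of cochains with a family of morphisms. -/
def cochainPostcomp (K : CochainComplex A ℤ) {L L' : CochainComplex A ℤ} (ρ : ∀ q, L.X q ⟶ L'.X q)
    (n : ℤ) : Cochain K L n →+ Cochain K L' n where
  toFun z := Cochain.mk fun p q hpq => z.v p q hpq ≫ ρ q
  map_zero' := Cochain.ext _ _ fun p q hpq => by simp
  map_add' z z' := Cochain.ext _ _ fun p q hpq => by simp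

lemma cochainPostcomp_v {K L L' : CochainComplex A ℤ} (ρ : ∀ q, L.X q ⟶ L'.X q) {n : ℤ}
    (z : Cochain K L n) {p q : ℤ} (hpq : p + n = q) :
    (cochainPostcomp K ρ n z).v p q hpq = z.v p q hpq ≫ ρ q := rfl

lemma cochainMap_id_v {K L L' : CochainComplex A ℤ} (g : L ⟶ L') {n : ℤ}
    (z : Cochain K L n) {p q : ℤ} (hpq : p + n = q) :
    (cochainMap (𝟙 K) g n z).v p q hpq = z.v p q hpq ≫ g.f q := by
  simp [cochainMap]

lemma totHomMap_comp_eq_zero (K : CochainComplex A ℤ) {L L' L'' : CochainComplex A ℤ} (f : L ⟶ L')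
    (g : L' ⟶ L'') (h : f ≫ g = 0) : totHomMap (𝟙 K) f ≫ totHomMap (𝟙 K) g = 0 := by
  rw [totHomMap_comp, h]
  ext n : 1
  refine AddCommGrpCat.hom_ext (AddMonoidHom.ext fun (z : Cochain K L n) => ?_)
  change cochainMap (𝟙 K ≫ 𝟙 K) 0 n z = 0
  simp [cochainMap]

/-- `Tot Hom(K, -)` is exact on short exact sequences that are split in each degree. -/
lemma shortExact_totHomMap (K : CochainComplex A ℤ) {S : ShortComplex (CochainComplex A ℤ)}
    (hS : S.ShortExact) (h : ∀ m, IsSplitMono (S.f.f m)) :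
    (ShortComplex.mk _ _ (totHomMap_comp_eq_zero K S.f S.g S.zero)).ShortExact := by
  have hs (m : ℤ) : ∃ (r : S.X₂.X m ⟶ S.X₁.X m) (s : S.X₃.X m ⟶ S.X₂.X m),
      S.f.f m ≫ r = 𝟙 _ ∧ s ≫ S.g.f m = 𝟙 _ ∧ r ≫ S.f.f m + S.g.f m ≫ s = 𝟙 _ := by
    obtain ⟨⟨r, hr⟩⟩ := h m
    let σ := ShortComplex.Splitting.ofExactOfRetraction _
      (hS.map_of_exact (HomologicalComplex.eval A _ m)).exact r hr
      (hS.map_of_exact (HomologicalComplex.eval A _ m)).epi_g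
    exact ⟨σ.r, σ.s, σ.f_r, σ.s_g, σ.id⟩
  choose r s h₁ h₂ h₃ using hs
  refine HomologicalComplex.shortExact_of_degreewise_shortExact _ fun n =>
    ShortComplex.Splitting.shortExact
      { r := AddCommGrpCat.ofHom (cochainPostcomp K r n)
        s := AddCommGrpCat.ofHom (cochainPostcomp K s n)
        f_r := ?_
        s_g := ?_
        id := ?_ }
  · refine AddCommGrpCat.hom_ext (AddMonoidHom.ext fun (z : Cochain K S.X₁ n) => ?_)
    refine Cochain.ext _ _ fun p q hpq => ?_
    change (cochainPostcomp K r n (cochainMap (𝟙 K) S.f n z)).v p q hpq = z.v p q hpq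
    rw [cochainPostcomp_v, cochainMap_id_v, Category.assoc, h₁, Category.comp_id]
  · refine AddCommGrpCat.hom_ext (AddMonoidHom.ext fun (z : Cochain K S.X₃ n) => ?_)
    refine Cochain.ext _ _ fun p q hpq => ?_
    change (cochainMap (𝟙 K) S.g n (cochainPostcomp K s n z)).v p q hpq = z.v p q hpq
    rw [cochainMap_id_v, cochainPostcomp_v, Category.assoc, h₂, Category.comp_id]
  · refine AddCommGrpCat.hom_ext (AddMonoidHom.ext fun (z : Cochain K S.X₂ n) => ?_)
    refine Cochain.ext _ _ fun p q hpq => ?_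
    change (cochainMap (𝟙 K) S.f n (cochainPostcomp K r n z)).v p q hpq +
      (cochainPostcomp K s n (cochainMap (𝟙 K) S.g n z)).v p q hpq = z.v p q hpq
    rw [cochainMap_id_v, cochainPostcomp_v, cochainPostcomp_v, cochainMap_id_v, Category.assoc,
      Category.assoc, ← Preadditive.comp_add, h₃, Category.comp_id]

/-- The comparison between the graded pieces of `Tot Hom(K, F)` and `Tot Hom(K, gr F)`. -/
def grTotHom (K : CochainComplex A ℤ) (F : FilteredComplex A) (n : ℤ) :
    (gr n).obj (totHomFilObj K F) ⟶ HomComplex K ((gr n).obj F) :=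
  cokernel.desc _ (totHomMap (𝟙 K) (cokernel.π (F.stepSucc n)))
    (totHomMap_comp_eq_zero K _ _ (cokernel.condition _))

lemma π_grTotHom (K : CochainComplex A ℤ) (F : FilteredComplex A) (n : ℤ) :
    cokernel.π ((totHomFilObj K F).stepSucc n) ≫ grTotHom K F n =
      totHomMap (𝟙 K) (cokernel.π (F.stepSucc n)) :=
  cokernel.π_desc _ _ _

/-- `Tot Hom(K, -)` is not right exact in general; the degreewise splitting makes `Tot Hom(K, gr F)`
a cokernel of the same inclusion. -/
lemma isIso_grTotHom (K : CochainComplex A ℤ) (F : FilteredComplex A) (n : ℤ)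
    (h : ∀ m, IsSplitMono ((F.stepSucc n).f m)) : IsIso (grTotHom K F n) := by
  have hS := shortExact_totHomMap K (F.shortExact_gr n) h
  have he : grTotHom K F n =
      ((cokernelIsCokernel ((totHomFilObj K F).stepSucc n)).coconePointUniqueUpToIso
        hS.gIsCokernel).hom := by
    refine coequalizer.hom_ext ((π_grTotHom K F n).trans (Eq.symm ?_))
    exact (cokernelIsCokernel ((totHomFilObj K F).stepSucc n)).comp_coconePointUniqueUpToIso_hom
      hS.gIsCokernel WalkingParallelPair.one
  rw [he]
  exact Iso.isIso_hom _

lemma comp_eq_comp_of_fac {B : Type*} [Category* B] {X₀ X₁ X₂ X₃ Y Z : B} {p : X₀ ⟶ X₁}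
    {a : X₁ ⟶ X₂} {b : X₂ ⟶ X₃} {c : X₀ ⟶ Y} {d : Y ⟶ X₂} {e : X₁ ⟶ Z} {g : X₀ ⟶ Z} {k : Z ⟶ X₃}
    {l : Y ⟶ X₃} (h₁ : p ≫ a = c ≫ d) (h₂ : d ≫ b = l) (h₃ : p ≫ e = g) (h : c ≫ l = g ≫ k) :
    p ≫ a ≫ b = p ≫ e ≫ k := by
  rw [reassoc_of% h₁, h₂, h, ← h₃, Category.assoc]

lemma grTotHom_naturality {K K' : CochainComplex A ℤ} (f : K' ⟶ K) (F : FilteredComplex A) (n : ℤ) :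
    (gr n).map ((totHomFil.map f.op).app F) ≫ grTotHom K' F n =
      grTotHom K F n ≫ totHomMap f (𝟙 ((gr n).obj F)) := by
  refine coequalizer.hom_ext ?_
  have h₁ : cokernel.π ((totHomFilObj K F).stepSucc n) ≫
      (gr n).map ((totHomFil.map f.op).app F) =
      totHomMap f (𝟙 _) ≫ cokernel.π ((totHomFilObj K' F).stepSucc n) := cokernel.π_desc _ _ _
  exact comp_eq_comp_of_fac h₁ (π_grTotHom K' F n) (π_grTotHom K F n)
    ((totHomMap_comp _ _ _ _).trans (Eq.trans
      (congrArg₂ totHomMap ((Category.id_comp _).trans (Category.comp_id _).symm)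
        ((Category.id_comp _).trans (Category.comp_id _).symm)) (totHomMap_comp _ _ _ _).symm))

lemma grTotHom_naturality_right (K : CochainComplex A ℤ) {F G : FilteredComplex A} (φ : F ⟶ G)
    (n : ℤ) : (gr n).map ((totHomFil.obj (op K)).map φ) ≫ grTotHom K G n =
      grTotHom K F n ≫ totHomMap (𝟙 K) ((gr n).map φ) := by
  refine coequalizer.hom_ext ?_
  have h₁ : cokernel.π ((totHomFilObj K F).stepSucc n) ≫
      (gr n).map ((totHomFil.obj (op K)).map φ) =
      totHomMap (𝟙 K) ((step n).map φ) ≫ cokernel.π ((totHomFilObj K G).stepSucc n) :=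
    cokernel.π_desc _ _ _
  have h₂ : cokernel.π (F.stepSucc n) ≫ (gr n).map φ =
      (step n).map φ ≫ cokernel.π (G.stepSucc n) := cokernel.π_desc _ _ _
  exact comp_eq_comp_of_fac h₁ (π_grTotHom K G n) (π_grTotHom K F n)
    ((totHomMap_comp _ _ _ _).trans (Eq.trans (congrArg _ h₂.symm) (totHomMap_comp _ _ _ _).symm))

end Graded

/-! ### The morphism from the ind-object to `RHom(ℤX, F)` -/

section

open FilteredDerivedCategory

variable {C : Type u} [Category.{v} C] {J : GrothendieckTopology C} {X : SPre C}

instance {F : FilteredComplex (AbSheaf J)} (I : FilteredInjectiveResolution F) (K : LAF J X) :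
    IsIso (Q.map (rHomToTotHom J I K)) :=
  Localization.inverts Q FilteredComplex.filteredQuasiIso _ (filteredQuasiIso_rHomToTotHom I K)

lemma cechIndObject_map_cechToTotHom {F : FilteredComplex (AbSheaf J)}
    (I : FilteredInjectiveResolution F) {K K' : LAF J X} (g : K' ⟶ K) :
    (cechIndObject J X F).map (LAF.idxMap g) ≫ cechToTotHom J I K' =
      cechToTotHom J I K ≫ Q.map ((totHomFil.map ((freeComplex J).map g.hom.left).op).app I.I) :=
  (Q.map_comp _ _).symm.trans ((congrArg Q.map
    ((totHomFil.map ((freeComplex J).map g.hom.left).op).naturality I.φ).symm).trans (Q.map_comp _ _))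

lemma rHomToTotHom_comp {F : FilteredComplex (AbSheaf J)}
    (I : FilteredInjectiveResolution F) {K K' : LAF J X} (g : K' ⟶ K) :
    rHomToTotHom J I K ≫ (totHomFil.map ((freeComplex J).map g.hom.left).op).app I.I =
      rHomToTotHom J I K' := by
  dsimp only [rHomToTotHom]
  rw [← NatTrans.comp_app, ← totHomFil.map_comp, ← op_comp, ← (freeComplex J).map_comp, Over.w]

/-- The morphism from the ind-object `Tot Hom(ℤK, F)` to `RHom(ℤX, F)`. -/
def cechToRHom {F : FilteredComplex (AbSheaf J)} (I : FilteredInjectiveResolution F) :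
    cechIndObject J X F ⟶ (Functor.const _).obj (Q.obj (I.rHom ((freeComplex J).obj X))) where
  app K := cechToTotHom J I K.unop.as ≫ inv (Q.map (rHomToTotHom J I K.unop.as))
  naturality K K' f := by
    obtain ⟨g, hg⟩ := (CategoryTheory.Quotient.functor (homotopyRel J X)).map_surjective
      (X := K'.unop.as) (Y := K.unop.as) f.unop
    obtain rfl : f = LAF.idxMap g := congrArg Quiver.Hom.op hg.symm
    refine Eq.trans ?_ (Category.comp_id _).symm
    rw [← cancel_mono (Q.map (rHomToTotHom J I K'.unop.as))]
    rw [Category.assoc, Category.assoc, IsIso.inv_hom_id, Category.comp_id, Category.assoc]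
    refine (cechIndObject_map_cechToTotHom I g).trans ?_
    rw [← rHomToTotHom_comp I g, Q.map_comp, IsIso.inv_hom_id_assoc]

lemma cechToRHom_app_comp {F : FilteredComplex (AbSheaf J)} (I : FilteredInjectiveResolution F)
    (K : LAF J X) : (cechToRHom I).app K.idx ≫ Q.map (rHomToTotHom J I K) = cechToTotHom J I K :=
  (Category.assoc _ _ _).trans ((congrArg _ (IsIso.inv_hom_id _)).trans (Category.comp_id _))

end

end CechExt

namespace CechExt

/-! ### Cohomology functors of the filtered derived category on `Tot Hom` -/

section Comparison

open CochainComplex CochainComplex.HomComplex FilteredComplex FilteredDerivedCategory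

section

variable {B : Type w} [Category.{w'} B] [Abelian B]

lemma cohomologyOf_map_Q (G : FilteredComplex B ⥤ CochainComplex B ℤ)
    (hG : ∀ ⦃F F' : FilteredComplex B⦄ (f : F ⟶ F'), filteredQuasiIso f → QuasiIso (G.map f))
    (p : ℤ) {F F' : FilteredComplex B} (f : F ⟶ F') :
    (cohomologyOf G hG p).map (Q.map f) = HomologicalComplex.homologyMap (G.map f) p := by
  have h := Functor.congr_hom (Localization.Construction.fac
    (G ⋙ HomologicalComplex.homologyFunctor B (ComplexShape.up ℤ) p) (W := filteredQuasiIso)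
    (fun _ _ f hf => by
      have := hG f hf
      exact inferInstanceAs (IsIso (HomologicalComplex.homologyMap (G.map f) p)))) f
  exact h.trans ((Category.id_comp _).trans (Category.comp_id _))

lemma cohomology_map_Q (p : ℤ) {F F' : FilteredComplex B} (f : F ⟶ F') :
    (cohomology p).map (Q.map f) = HomologicalComplex.homologyMap (Hom.hom f) p :=
  cohomologyOf_map_Q _ _ p f

lemma stepCohomology_map_Q (n p : ℤ) {F F' : FilteredComplex B} (f : F ⟶ F') :
    (stepCohomology n p).map (Q.map f) = HomologicalComplex.homologyMap ((step n).map f) p :=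
  cohomologyOf_map_Q _ _ p f

lemma grCohomology_map_Q (n p : ℤ) {F F' : FilteredComplex B} (f : F ⟶ F') :
    (grCohomology n p).map (Q.map f) = HomologicalComplex.homologyMap ((gr n).map f) p :=
  cohomologyOf_map_Q _ _ p f

end

variable {A : Type u} [Category.{v} A] [Abelian A]

/-- If the steps of the filtration of `F` are split in each degree, the cohomology of the graded
pieces of `Tot Hom(K, F)` is that of `Tot Hom(K, gr F)`. -/
def grCohomologyIso (F : FilteredComplex A) (n p : ℤ) (h : ∀ m, IsSplitMono ((F.stepSucc n).f m)) :
    totHomFil.flip.obj F ⋙ Q ⋙ grCohomology n p ≅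
      totHom.flip.obj ((gr n).obj F) ⋙ HomologicalComplex.homologyFunctor _ _ p :=
  NatIso.ofComponents (fun K => (HomologicalComplex.homologyFunctor _ _ p).mapIso
    (@asIso _ _ _ _ (grTotHom K.unop F n) (isIso_grTotHom K.unop F n h))) (fun {K K'} f => by
      refine (congrArg (· ≫ _) (grCohomology_map_Q n p _)).trans ?_
      exact (HomologicalComplex.homologyMap_comp _ _ p).symm.trans
        ((congrArg (HomologicalComplex.homologyMap · p) (grTotHom_naturality f.unop F n)).trans
          (HomologicalComplex.homologyMap_comp _ _ p)))

/-- The cohomology of `Tot Hom(K, F)`, as a functor on the filtered derived category. -/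
def cohomologyIso (F : FilteredComplex A) (p : ℤ) :
    totHomFil.flip.obj F ⋙ Q ⋙ cohomology p ≅
      totHom.flip.obj F.X ⋙ HomologicalComplex.homologyFunctor _ _ p :=
  NatIso.ofComponents (fun _ => Iso.refl _) (fun _ =>
    (Category.comp_id _).trans ((cohomology_map_Q p _).trans (Category.id_comp _).symm))

/-- The cohomology of the steps of `Tot Hom(K, F)`, as a functor on the filtered derived
category. -/
def stepCohomologyIso (F : FilteredComplex A) (n p : ℤ) :
    totHomFil.flip.obj F ⋙ Q ⋙ stepCohomology n p ≅
      totHom.flip.obj ((step n).obj F) ⋙ HomologicalComplex.homologyFunctor _ _ p :=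
  NatIso.ofComponents (fun _ => Iso.refl _) (fun _ =>
    (Category.comp_id _).trans ((stepCohomology_map_Q n p _).trans (Category.id_comp _).symm))

/-- In each degree the inclusion is an isomorphism or has zero source. -/
lemma isSplitMono_stepSucc_bete (F : CochainComplex A ℤ) (n m : ℤ) :
    IsSplitMono (((bete F).stepSucc n).f m) := by
  by_cases hm : n + 1 ≤ m
  · have h : ((bete F).stepSucc n).f m =
        (sigmaGEXIso F hm ≪≫ (sigmaGEXIso F (show n ≤ m by lia)).symm).hom := dif_pos hm
    rw [h]
    exact ⟨⟨_, Iso.hom_inv_id _⟩⟩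
  · exact IsSplitMono.mk' ⟨0, (isZero_sigmaGE_X F hm).eq_of_src _ _⟩

lemma FilteredInjectiveResolution.isSplitMono_stepSucc {F : FilteredComplex A}
    (I : FilteredInjectiveResolution F) (n m : ℤ) : IsSplitMono ((I.I.stepSucc n).f m) := by
  have := I.injective_fil_X (n + 1) m
  have : Mono ((I.I.stepSucc n).f m) :=
    inferInstanceAs (Mono ((HomologicalComplex.eval A _ m).map (I.I.stepSucc n)))
  exact IsSplitMono.mk' ⟨Injective.factorThru (𝟙 _) ((I.I.stepSucc n).f m), Injective.comp_factorThru _ _⟩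

lemma isStrictlyGE_gr (F : FilteredComplex A) (n N : ℤ) [((step n).obj F).IsStrictlyGE N] :
    ((gr n).obj F).IsStrictlyGE N := by
  rw [isStrictlyGE_iff]
  intro m hm
  have : Epi ((cokernel.π (F.stepSucc n)).f m) :=
    inferInstanceAs (Epi ((HomologicalComplex.eval A _ m).map (cokernel.π (F.stepSucc n))))
  exact @IsZero.of_epi_eq_zero _ _ _ _ _ _ this
    ((((step n).obj F).isZero_of_isStrictlyGE N m hm).eq_zero_of_src ((cokernel.π (F.stepSucc n)).f m))

lemma isStrictlyGE_sigmaGE (F : CochainComplex A ℤ) (n N : ℤ) [F.IsStrictlyGE N] :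
    (sigmaGE F n).IsStrictlyGE N := by
  rw [isStrictlyGE_iff]
  intro m hm
  by_cases h : n ≤ m
  · exact (F.isZero_of_isStrictlyGE N m hm).of_iso (sigmaGEXIso F h)
  · exact isZero_sigmaGE_X F h

end Comparison

/-! ### The filtered comparison -/

section Site

open CochainComplex FilteredComplex FilteredDerivedCategory

variable {C : Type u} [Category.{v} C] {J : GrothendieckTopology C} {X : SPre C}

/-- The ind-object `Tot Hom(ℤK, F)`, `K ∈ hD(X)`, is filtered quasi-isomorphic to
`RHom(ℤX, F)`. -/
theorem isIndFilteredQuasiIso_cechToRHom (F : CochainComplex (AbSheaf J) ℤ) (N : ℤ)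
    [F.IsStrictlyGE N] (I : FilteredInjectiveResolution (bete F)) :
    IsIndFilteredQuasiIso (cechToRHom (X := X) I) := by
  obtain ⟨N', h₁, h₂⟩ := I.exists_isStrictlyGE
  -- The refinement lemmas require a common lower bound for source and target.
  have := isStrictlyGE_of_ge F (min N N') N (min_le_left _ _)
  have := isStrictlyGE_of_ge I.I.X (min N N') N' (min_le_right _ _)
  have : (bete F).X.IsStrictlyGE (min N N') := isStrictlyGE_of_ge F (min N N') N (min_le_left _ _)
  have (n : ℤ) : ((step n).obj I.I).IsStrictlyGE (min N N') :=
    have := h₂ n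
    isStrictlyGE_of_ge (I.I.fil.obj (op n)) (min N N') N' (min_le_right _ _)
  have (n : ℤ) : ((step n).obj (bete F)).IsStrictlyGE (min N N') := isStrictlyGE_sigmaGE F n _
  have (n : ℤ) : ((gr n).obj (bete F)).IsStrictlyGE (min N N') := isStrictlyGE_gr _ n _
  have (n : ℤ) : ((gr n).obj I.I).IsStrictlyGE (min N N') := isStrictlyGE_gr _ n _
  have : QuasiIso (Hom.hom I.φ) := I.quasiIso.1
  have (n : ℤ) : QuasiIso ((step n).map I.φ) := I.quasiIso.2 n
  have (n : ℤ) : QuasiIso ((gr n).map I.φ) := quasiIso_gr_map I.φ I.quasiIso n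
  refine ⟨fun p => ?_, fun n p => ?_, fun n p => ?_⟩
  · exact nonempty_isColimit_mapCocone I _ (cechToRHom_app_comp I) _ p (Hom.hom I.φ) (min N N')
      (cohomologyIso _ p) (cohomologyIso _ p) (fun K => (Category.comp_id _).trans
        ((cohomology_map_Q p _).trans (Category.id_comp _).symm))
  · exact nonempty_isColimit_mapCocone I _ (cechToRHom_app_comp I) _ p ((step n).map I.φ) (min N N')
      (stepCohomologyIso _ n p) (stepCohomologyIso _ n p) (fun K => (Category.comp_id _).trans
        ((stepCohomology_map_Q n p _).trans (Category.id_comp _).symm))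
  · refine nonempty_isColimit_mapCocone I _ (cechToRHom_app_comp I) _ p ((gr n).map I.φ) (min N N')
      (grCohomologyIso _ n p (isSplitMono_stepSucc_bete F n))
      (grCohomologyIso _ n p (I.isSplitMono_stepSucc n)) (fun K => ?_)
    refine (congrArg (· ≫ _) (grCohomology_map_Q n p _)).trans ?_
    exact (HomologicalComplex.homologyMap_comp _ _ p).symm.trans
      ((congrArg (HomologicalComplex.homologyMap · p) (grTotHom_naturality_right K.unop I.φ n)).trans
        (HomologicalComplex.homologyMap_comp _ _ p))

end Site

end CechExt

namespace CechExt

/-! ### Cocycles and morphisms in the derived category -/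

section Derived

variable {A : Type u} [Category.{v} A] [Abelian A] [HasDerivedCategory.{w'} A]

open CochainComplex CochainComplex.HomComplex

/-- The morphism `K ⟶ L[n]` in the derived category given by a cocycle of degree `n`. -/
def derivedHom (K L : CochainComplex A ℤ) (n : ℤ) :
    Cocycle K L n →+ ShiftedHom (DerivedCategory.Q.obj K) (DerivedCategory.Q.obj L) n :=
  AddMonoidHom.mk' (fun z => ShiftedHom.map (Cocycle.equivHomShift.symm z) DerivedCategory.Q)
    (fun z z' => by rw [map_add]; exact ShiftedHom.map_add _ _ _)

variable {K L : CochainComplex A ℤ} {n : ℤ}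

lemma derivedHom_apply (z : Cocycle K L n) :
    derivedHom K L n z = ShiftedHom.map (Cocycle.equivHomShift.symm z) DerivedCategory.Q := rfl

lemma derivedHom_cocycleMap {K' L' : CochainComplex A ℤ} (f : K' ⟶ K) (g : L ⟶ L')
    (z : Cocycle K L n) : derivedHom K' L' n (cocycleMap f g n z) =
      DerivedCategory.Q.map f ≫ derivedHom K L n z ≫ (DerivedCategory.Q.map g)⟦n⟧' := by
  have h : Cocycle.equivHomShift.symm (cocycleMap f g n z) =
      f ≫ Cocycle.equivHomShift.symm z ≫ g⟦n⟧' := by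
    refine (Cocycle.equivHomShift_symm_precomp _ _).trans ?_
    rw [Cocycle.equivHomShift_symm_postcomp]
  rw [derivedHom_apply, derivedHom_apply, h]
  simp [ShiftedHom.map, ← Functor.commShiftIso_hom_naturality]

lemma derivedHom_eq_zero {z : Cocycle K L n} (hz : z ∈ coboundaries K L n) :
    derivedHom K L n z = 0 := by
  have h := (CohomologyClass.toHom_mk_eq_zero_iff z).2 hz
  rw [CohomologyClass.toHom_mk, HomotopyCategory.quotient_map_eq_zero_iff] at h
  rw [derivedHom_apply, ShiftedHom.map, DerivedCategory.Q_map_eq_of_homotopy _ h.some,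
    Functor.map_zero, zero_comp]

/-- Morphisms to a K-injective complex are the same in the homotopy category and in the derived
category, and cocycles modulo coboundaries are morphisms in the homotopy category. -/
lemma mem_coboundaries_of_derivedHom_eq_zero [L.IsKInjective] {z : Cocycle K L n}
    (hz : derivedHom K L n z = 0) : z ∈ coboundaries K L n := by
  rw [← CohomologyClass.toHom_mk_eq_zero_iff, CohomologyClass.toHom_mk]
  apply (IsKInjective.Qh_map_bijective _ (L⟦n⟧)).injective
  rw [Functor.map_zero, ← cancel_mono ((DerivedCategory.quotientCompQhIso A).hom.app _),
    DerivedCategory.quotientCompQhIso_hom_naturality, zero_comp]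
  rw [derivedHom_apply, ShiftedHom.map] at hz
  rw [← cancel_mono ((DerivedCategory.Q.commShiftIso n).hom.app L), Category.assoc, hz, comp_zero,
    zero_comp]

lemma derivedHom_surjective [L.IsKInjective] : Function.Surjective (derivedHom K L n) := by
  intro e
  obtain ⟨g, hg⟩ := (IsKInjective.Qh_map_bijective ((HomotopyCategory.quotient _ _).obj K)
    (L⟦n⟧)).surjective ((DerivedCategory.quotientCompQhIso A).hom.app K ≫ e ≫
      (DerivedCategory.Q.commShiftIso n).inv.app L ≫ (DerivedCategory.quotientCompQhIso A).inv.app _)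
  obtain ⟨g, rfl⟩ := Functor.map_surjective _ g
  refine ⟨Cocycle.equivHomShift g, ?_⟩
  rw [derivedHom_apply, AddEquiv.symm_apply_apply, ShiftedHom.map,
    ← cancel_epi ((DerivedCategory.quotientCompQhIso A).hom.app K), ← Category.assoc,
    ← DerivedCategory.quotientCompQhIso_hom_naturality, hg]
  simp

/-- The morphism `K ⟶ L[n]` in the derived category given by a cohomology class of degree `n` of
`Tot Hom(K, L)`. -/
def homologyToDerived (K L : CochainComplex A ℤ) (n : ℤ) :
    (HomComplex K L).homology n →+
      ShiftedHom (DerivedCategory.Q.obj K) (DerivedCategory.Q.obj L) n :=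
  (CohomologyClass.descAddMonoidHom (derivedHom K L n) (fun _ h => derivedHom_eq_zero h)).comp
    (homologyAddEquiv K L n).toAddMonoidHom

lemma homologyToDerived_homClass (z : Cocycle K L n) :
    homologyToDerived K L n (homClass z) = derivedHom K L n z := by
  have h : homologyAddEquiv K L n (homClass z) = CohomologyClass.mk z :=
    (homologyAddEquiv K L n).apply_symm_apply _
  exact (congrArg _ h).trans rfl

end Derived

/-! ### The comparison with hyper-Ext -/

section Site

open CochainComplex CochainComplex.HomComplex

variable {C : Type u} [Category.{v} C] {J : GrothendieckTopology C}
  [HasDerivedCategory.{w'} (AbSheaf J)] {X : SPre C} (F : CochainComplex (AbSheaf J) ℤ) (p : ℤ)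

/-- The map `H^p(Tot Hom(ℤK, F)) ⟶ Ext^p(ℤX, F)`. -/
def cechToExt (K : LAF J X) :
    (HomComplex ((freeComplex J).obj K.obj.left) F).homology p →+
      ShiftedHom (DerivedCategory.Q.obj ((freeComplex J).obj X)) (DerivedCategory.Q.obj F) p :=
  (Preadditive.leftComp _ (inv (DerivedCategory.Q.map K.augmentation))).comp
    (homologyToDerived _ F p)

variable {F p}

lemma augmentation_cechToExt (K : LAF J X) (z : Cocycle ((freeComplex J).obj K.obj.left) F p) :
    DerivedCategory.Q.map K.augmentation ≫ cechToExt F p K (homClass z) = derivedHom _ F p z := by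
  rw [← homologyToDerived_homClass]
  exact IsIso.hom_inv_id_assoc _ _

lemma augmentation_comp_injective (K : LAF J X) {Y : DerivedCategory (AbSheaf J)}
    {a b : DerivedCategory.Q.obj ((freeComplex J).obj X) ⟶ Y}
    (h : DerivedCategory.Q.map K.augmentation ≫ a = DerivedCategory.Q.map K.augmentation ≫ b) :
    a = b :=
  (cancel_epi _).1 h

lemma cechToExt_map {K K' : LAF J X} (g : K' ⟶ K)
    (x : (HomComplex ((freeComplex J).obj K.obj.left) F).homology p) :
    cechToExt F p K' (HomologicalComplex.homologyMap
      (totHomMap ((freeComplex J).map g.hom.left) (𝟙 F)) p x) = cechToExt F p K x := by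
  obtain ⟨z, rfl⟩ := homClass_surjective x
  have h : (freeComplex J).map g.hom.left ≫ K.augmentation = K'.augmentation := by
    rw [← (freeComplex J).map_comp, Over.w]
  rw [homologyMap_totHomMap_homClass, ← cancel_epi (DerivedCategory.Q.map K'.augmentation),
    augmentation_cechToExt, derivedHom_cocycleMap, ← h, Functor.map_comp, Category.assoc,
    augmentation_cechToExt]
  simp

/-- The composite of `e` with `φ` is given by a cocycle on `ℤX` with values in `I`, which after
refinement comes from a cocycle `x` with values in `F`. Since `φ` is invertible in the derived
category, `x` represents `e`. -/
lemma exists_cechToExt_eq {I : CochainComplex (AbSheaf J) ℤ} (φ : F ⟶ I) [QuasiIso φ]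
    [I.IsKInjective] (N : ℤ) [F.IsStrictlyGE N] [I.IsStrictlyGE N]
    (e : ShiftedHom (DerivedCategory.Q.obj ((freeComplex J).obj X)) (DerivedCategory.Q.obj F) p) :
    ∃ (K : LAF J X) (x : Cocycle ((freeComplex J).obj K.obj.left) F p),
      cechToExt F p K (homClass x) = e := by
  obtain ⟨z, hz⟩ := derivedHom_surjective (e ≫ (DerivedCategory.Q.map φ)⟦p⟧')
  obtain ⟨K', f, hf, x, y, h⟩ := exists_refinement_postcomp_eq φ N (show p - 1 + 1 = p by lia) z
  let K : LAF J X := ⟨Over.mk f, hf⟩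
  refine ⟨K, x, ?_⟩
  have h' : homClass (cocycleMap ((freeComplex J).map f) (𝟙 I) p z) =
      homClass (cocycleMap (𝟙 ((freeComplex J).obj K')) φ p x) :=
    (homClass_eq_iff _ _ (p - 1) (by lia)).2 ⟨y, by simpa [cocycleMap] using h⟩
  have h'' := congrArg (homologyToDerived _ I p) h'
  rw [homologyToDerived_homClass, homologyToDerived_homClass, derivedHom_cocycleMap,
    derivedHom_cocycleMap, hz] at h''
  have h₃ : derivedHom ((freeComplex J).obj K') F p x =
      DerivedCategory.Q.map ((freeComplex J).map f) ≫ e := by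
    rw [← cancel_mono ((DerivedCategory.Q.map φ)⟦p⟧')]
    simpa using h''.symm
  exact augmentation_comp_injective K ((augmentation_cechToExt K x).trans h₃)

/-- If `z` is zero in the derived category, its image in the K-injective complex `I` is a
coboundary, and `exists_refinement_eq_δ` brings this back to `F`. -/
lemma exists_refinement_of_cechToExt_eq_zero {I : CochainComplex (AbSheaf J) ℤ} (φ : F ⟶ I)
    [QuasiIso φ] [I.IsKInjective] (N : ℤ) [F.IsStrictlyGE N] [I.IsStrictlyGE N]
    (K : LAF J X)
    (z : Cocycle ((freeComplex J).obj K.obj.left) F p) (hz : cechToExt F p K (homClass z) = 0) :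
    ∃ (K' : LAF J X) (g : K' ⟶ K),
      HomologicalComplex.homologyMap (totHomMap ((freeComplex J).map g.hom.left) (𝟙 F)) p
        (homClass z) = 0 := by
  have h₀ := augmentation_cechToExt K z
  rw [hz, comp_zero] at h₀
  have h₁ : derivedHom _ I p (cocycleMap (𝟙 _) φ p z) = 0 := by
    rw [derivedHom_cocycleMap, ← h₀, zero_comp, comp_zero]
  obtain ⟨w, hw⟩ := (mem_coboundaries_iff _ (p - 1) (by lia)).1
    (mem_coboundaries_of_derivedHom_eq_zero h₁)
  obtain ⟨K', f, hf, y, h⟩ := exists_refinement_eq_δ φ N (show p - 1 + 1 = p by lia) z w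
    (hw.trans (by simp [cocycleMap]))
  refine ⟨K.over f hf, K.overHom f hf, (homologyMap_totHomMap_homClass _ _ _ _).trans ?_⟩
  exact (homClass_eq_zero_iff _ (p - 1) (by lia)).2 ⟨y, h.trans (by simp [cocycleMap])⟩

variable (X F p)

/-- The maps `H^p(Tot Hom(ℤK, F)) ⟶ Ext^p(ℤX, F)`, as a natural transformation. -/
def cechToHyperExt : cechCohomology J X F p ⋙ AddCommGrpCat.uliftFunctor.{w'} ⟶
    (Functor.const _).obj (AddCommGrpCat.uliftFunctor.{max u v}.obj (hyperExt J X F p)) where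
  app K := AddCommGrpCat.ofHom (AddEquiv.ulift.symm.toAddMonoidHom.comp
    ((cechToExt F p K.unop.as).comp AddEquiv.ulift.toAddMonoidHom))
  naturality K K' f := by
    obtain ⟨g, hg⟩ := (CategoryTheory.Quotient.functor (homotopyRel J X)).map_surjective
      (X := K'.unop.as) (Y := K.unop.as) f.unop
    obtain rfl : f = LAF.idxMap g := congrArg Quiver.Hom.op hg.symm
    refine AddCommGrpCat.hom_ext (AddMonoidHom.ext fun x => ?_)
    exact congrArg ULift.up (cechToExt_map g x.down)

lemma nonempty_isColimit_cechToHyperExt (N : ℤ) [F.IsStrictlyGE N] :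
    Nonempty (IsColimit (Cocone.mk _ (cechToHyperExt X F p))) := by
  obtain ⟨I⟩ := nonempty_filteredInjectiveResolution F N
  obtain ⟨N', _, _⟩ := I.exists_isStrictlyGE
  have := isStrictlyGE_of_ge F (min N N') N (min_le_left _ _)
  have := isStrictlyGE_of_ge I.I.X (min N N') N' (min_le_right _ _)
  have := I.isKInjective_X
  let φ : F ⟶ I.I.X := FilteredComplex.Hom.hom I.φ
  have : QuasiIso φ := I.quasiIso.1
  refine nonempty_isColimit_of_LAF _ (fun ⟨e⟩ => ?_) (fun K ⟨y⟩ hy => ?_)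
  · obtain ⟨K, x, h⟩ := exists_cechToExt_eq φ (min N N') e
    exact ⟨K, ULift.up (homClass x), congrArg ULift.up h⟩
  · obtain ⟨z, rfl⟩ := homClass_surjective y
    obtain ⟨K', g, h⟩ := exists_refinement_of_cechToExt_eq_zero φ (min N N') K z
      (congrArg ULift.down hy)
    exact ⟨K', g, congrArg ULift.up h⟩

lemma augmentation_cechToHyperExt_cechClass (K : LAF J X) (z : (freeComplex J).obj K.obj.left ⟶ F⟦p⟧) :
    DerivedCategory.Q.map ((freeComplex J).map K.obj.hom) ≫
      ((cechToHyperExt X F p).app K.idx (ULift.up (cechClass J K z))).down =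
        ShiftedHom.map z DerivedCategory.Q :=
  (augmentation_cechToExt K (Cocycle.equivHomShift z)).trans
    (congrArg (ShiftedHom.map · DerivedCategory.Q) (Cocycle.equivHomShift.symm_apply_apply z))

end Site

end CechExt

end

theorem theoremt {C : Type u} [Category.{v} C] (J : GrothendieckTopology C)
    [HasDerivedCategory.{w'} (CechExt.AbSheaf J)]
    (X : CechExt.SPre C) (F : CochainComplex (CechExt.AbSheaf J) ℤ)
    (N : ℤ) [F.IsStrictlyGE N] :
    -- the homotopy category of local acyclic fibrations over `X` is cofiltered
    IsCofiltered (CechExt.HLAF J X) ∧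
    -- the canonical maps `H^p(Tot Hom(ℤK, F)) ⟶ Ext^p(ℤK, F) ≅ Ext^p(ℤX, F)` exhibit
    -- `Ext^p(ℤX, F)` as the colimit over `hD(X)`
    (∀ p : ℤ, ∃ α : CechExt.cechCohomology J X F p ⋙ AddCommGrpCat.uliftFunctor.{w'} ⟶
        (Functor.const _).obj
          (AddCommGrpCat.uliftFunctor.{max u v}.obj (CechExt.hyperExt J X F p)),
      (∀ (K : CechExt.LAF J X) (z : (CechExt.freeComplex J).obj K.obj.left ⟶ F⟦p⟧),
        DerivedCategory.Q.map ((CechExt.freeComplex J).map K.obj.hom) ≫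
            (α.app (op ((CategoryTheory.Quotient.functor _).obj K))
              (ULift.up (CechExt.cechClass J K z))).down =
          ShiftedHom.map z DerivedCategory.Q) ∧
      Nonempty (IsColimit (Cocone.mk _ α))) ∧
    -- `F` with the filtration bête has filtered injective resolutions, which compute the filtered
    -- complex `RHom(ℤX, F)`
    Nonempty (CechExt.FilteredInjectiveResolution (CechExt.bete F)) ∧
    -- the canonical morphisms `Tot Hom(ℤK, F) ⟶ Tot Hom(ℤK, I) ≅ Tot Hom(ℤX, I) = RHom(ℤX, F)`
    -- form a filtered quasi-isomorphism from the ind-object to `RHom(ℤX, F)`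
    ∀ I : CechExt.FilteredInjectiveResolution (CechExt.bete F),
      (∀ K : CechExt.LAF J X,
        CechExt.FilteredComplex.filteredQuasiIso (CechExt.rHomToTotHom J I K)) ∧
      ∃ Φ : CechExt.cechIndObject J X (CechExt.bete F) ⟶
          (Functor.const _).obj (CechExt.FilteredDerivedCategory.Q.obj
            (I.rHom ((CechExt.freeComplex J).obj X))),
        (∀ K : CechExt.LAF J X,
          Φ.app (op ((CategoryTheory.Quotient.functor _).obj K)) ≫
              CechExt.FilteredDerivedCategory.Q.map (CechExt.rHomToTotHom J I K) =
            CechExt.cechToTotHom J I K) ∧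
        CechExt.FilteredDerivedCategory.IsIndFilteredQuasiIso Φ := by

  exact ⟨CechExt.isCofiltered_HLAF J X,
    fun p => ⟨CechExt.cechToHyperExt X F p,
      fun K z => CechExt.augmentation_cechToHyperExt_cechClass X F p K z,
      CechExt.nonempty_isColimit_cechToHyperExt X F p N⟩,
    CechExt.nonempty_filteredInjectiveResolution F N,
    fun I => ⟨fun K => CechExt.filteredQuasiIso_rHomToTotHom I K,
      CechExt.cechToRHom I, fun K => CechExt.cechToRHom_app_comp I K,
      CechExt.isIndFilteredQuasiIso_cechToRHom F N I⟩⟩
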